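/- **Setting.** Consider an episodic time-inhomogeneous MDP with state space $\mathcal S$, action space $\mathcal A$, horizon $H\ge 1$, initial density $d_1$ and transition densities $p_h(\cdot\mid s,a)$ with respect to a $\sigma$-finite reference measure $\rho$ on $\mathcal S$, and mean rewards $r_h(s,a)\in[0,1]$. Policies $\pi=(\pi_h)_{h\in[H]}$ are Markov and given by probability mass functions $\pi_h(\cdot\mid s)$. $V^\pi_h$ is the value function of $\pi$, $V^*_h=\sup_\pi V_h^\pi$, $Q^*_h(s,a)=r_h(s,a)+\mathbb E_{s'\sim p_h(\cdot|s,a)}V^*_{h+1}(s')$, and $\mathrm{SubOpt}(\pi)=\mathbb E_{s\sim d_1}[V_1^*(s)-V_1^\pi(s)]$. $d_h^\pi(s)$ is the density of the law of $s_h$ under $\pi$, $d_h^\pi(s,a)=d_h^\pi(s)\pi_h(a\mid s)$, and it is assumed that $d^\pi_h(s,a)\le 1$ for all $\pi,h,s,a$. A state $s$ is feasible at step $h$ if $d_h^\pi(s)>0$ for some $\pi$. The MDP is linear with a known feature map $\phi_h:\mathcal S\times\mathcal A\to\mathbb R^d$, $\|\phi_h\|_2\le 1$: $r_h=\langle\phi_h,\theta_h\rangle$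 and $p_h(s'\mid s,a)=\langle\phi_h(s,a),m_h(s')\rangle$ with $\|\theta_h\|_2\le\sqrt d$ and $\|\int v\,m_h\,d\rho\|_2\le\sqrt d\,\|v\|_\infty$ for every bounded measurable $v$. **Data.** $K\ge1$ episodes $(s^k_h,a^k_h,r^k_h)_{h\in[H]}$ are collected adaptively: given episodes $1,\dots,k-1$, episode $k$ is generated by the MDP and a Markov behavior policy $\mu=\mu^k$ that may depend on these earlier episodes; observed rewards lie in $[0,1]$ and have conditional mean $r_h(s_h^k,a_h^k)$. At feasible states, the support $\mathrm{supp}\,\mu_h(\cdot\mid s)$ is the same for all $k$ and known to the learner; $\Pi_h(\mu)$ is the class of policies $\pi_h$ with $\mathrm{supp}\,\pi_h(\cdot\mid s)\subseteq\mathrm{supp}\,\mu_h(\cdot\mid s)$ for all $s$ feasible at step $h$. **Algorithm (BCP-VI).** Let $\delta\in(0,1]$ and $\beta_k=c_1 dH\log(dHk/\delta)$. For $k=1,\dots,K$ put $\hat V^k_{H+1}=0$ and, for $h=H,\dots,1$, $\Sigma_h^k=I+\sum_{t<k}\phi_h(s_h^t,a_h^t)\phi_h(s_h^t,a_h^t)^\top$,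 $\hat w_h^k=(\Sigma_h^k)^{-1}\sum_{t<k}\phi_h(s_h^t,a_h^t)\,(r_h^t+\hat V^k_{h+1}(s_{h+1}^t))$, $\hat Q_h^k=\max\{0,\min\{\langle\phi_h,\hat w_h^k\rangle-\beta_k\|\phi_h\|_{(\Sigma_h^k)^{-1}},\,H-h+1\}\}$, $\hat\pi_h^k\in\arg\max_{\pi_h\in\Pi_h(\mu)}\langle\hat Q_h^k,\pi_h\rangle$ (chosen as a measurable function of the first $k-1$ episodes) and $\hat V_h^k=\langle\hat Q_h^k,\hat\pi^k_h\rangle$. The mixture policy is $\hat\pi^{mix}=\frac1K\sum_{k=1}^K\hat\pi^k$. **Assumptions.** (i) (Optimal-policy concentrability) There is a policy $\pi^*$, optimal from every state at every step, with $\pi_h^*\in\Pi_h(\mu)$ for all $h$ and $d_h^{\pi^*}(s,a)>0\Rightarrow d_h^{\mu}(s,a)>0$. (ii) There are $\kappa_h\in(0,\infty)$ with $d_h^\mu(s,a)\ge\kappa_h^{-1}$ whenever $d_h^\mu(s,a)>0$; put $\kappa=\sum_{h=1}^H\kappa_h$. For adaptive data, (i) and (ii) are required of the realized behavior policy $\mu^k$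 of each episode $k$, almost surely. (iii) $\Delta_{\min}>0$, where $\Delta_{\min}$ is the infimum of the nonzero gaps $\Delta_h(s,a)=V_h^*(s)-Q_h^*(s,a)$ over all $(s,a,h)$, at least one gap being nonzero. (iv) $K\kappa/\delta\ge2$ (automatic if $K\ge2$). **Theorem.** There are absolute constants $c_1,C>0$ such that, in this setting, with probability at least $1-\bigl(1+3\log_2(H/\Delta_{\min})\bigr)\delta$, $$\mathrm{SubOpt}(\hat\pi^{mix})\le C\cdot\frac{2d^3H^2\kappa^3}{\Delta_{\min}K}\log^3\!\Bigl(\frac{dKH}{\delta}\Bigr)+\frac{16\kappa}{3K}\log\log_2\!\Bigl(\frac{K\kappa}{\delta}\Bigr)+\frac2K .$$ This holds simultaneously for both meanings of the mixture: the Markov policy with action probabilities $\frac1K\sum_k\hat\pi_h^k(a\mid s)$, and a member of $\{\hat\pi^k\}_{k\le K}$ drawn uniformly and followed for the whole episode, whose sub-optimality is $\frac1K\sum_{k}\mathrm{SubOpt}(\hat\pi^k)$. -/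

import Mathlib

open MeasureTheory ProbabilityTheory
open scoped ENNReal NNReal RealInnerProductSpace

/-! Steps are numbered from `0`: the `H` steps of an episode are `h = 0, …, H - 1`, and the
data of steps `h ≥ H` of any family indexed by `ℕ` are never used. -/

/-- A Markov policy, `π_h(· | s)` being a probability distribution on the actions that is given by
its mass function `a ↦ π_h(a | s) = kernel h s {a}`. -/
structure Policy (S A : Type*) [MeasurableSpace S] [MeasurableSpace A] where
  kernel : ℕ → Kernel S A
  markov : ∀ h, IsMarkovKernel (kernel h)
  discrete : ∀ h s, ∑' a, kernel h s {a} = 1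

/-- One recorded step `(s, a, r)`. -/
abbrev Step (S A : Type*) := S × A × ℝ

/-- The first `k` recorded episodes. -/
abbrev History (S A : Type*) (H k : ℕ) := Fin k → Fin H → Step S A

/-- A policy that is a (measurable) function of `k` recorded episodes. -/
structure AdaptivePolicy (S A : Type*) [MeasurableSpace S] [MeasurableSpace A] (H k : ℕ) where
  kernel : ℕ → Kernel (History S A H k × S) A
  markov : ∀ h, IsMarkovKernel (kernel h)
  discrete : ∀ h x, ∑' a, kernel h x {a} = 1

/-- The policy that an adaptive policy plays once the `k` episodes are known. -/
noncomputable def AdaptivePolicy.run {S A : Type*} [MeasurableSpace S] [MeasurableSpace A]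
    {H k : ℕ} (π : AdaptivePolicy S A H k) (τ : History S A H k) : Policy S A where
  kernel h := (π.kernel h).comap (Prod.mk τ) measurable_prodMk_left
  markov h := by
    have := π.markov h
    infer_instance
  discrete h s := by
    simpa [Kernel.comap_apply] using π.discrete h (τ, s)

/-- The policy with `π_h(a | s) = (1/K) ∑_k π^k_h(a | s)`. -/
noncomputable def Policy.mixture {S A : Type*} [MeasurableSpace S] [MeasurableSpace A]
    {K : ℕ} (hK : 0 < K) (π : Fin K → Policy S A) : Policy S A where
  kernel h :=
    { toFun := fun s => (K : ℝ≥0∞)⁻¹ • ∑ k, (π k).kernel h s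
      measurable' := by
        refine Measure.measurable_of_measurable_coe _ fun B hB => ?_
        simp only [Measure.smul_apply, Measure.finsetSum_apply, smul_eq_mul]
        exact (Finset.measurable_sum _ fun k _ =>
          Kernel.measurable_coe ((π k).kernel h) hB).const_mul _ }
  markov h := by
    refine ⟨fun s => ⟨?_⟩⟩
    have h1 : ∀ k, (π k).kernel h s Set.univ = 1 := fun k => by
      have := (π k).markov h
      exact measure_univ
    have h0 : (K : ℝ≥0∞) ≠ 0 := by exact_mod_cast hK.ne'
    simp [Kernel.coe_mk, Measure.smul_apply, h1, ENNReal.inv_mul_cancel h0]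
  discrete h s := by
    have h0 : (K : ℝ≥0∞) ≠ 0 := by exact_mod_cast hK.ne'
    have h2 : ∑' a, ∑ k, (π k).kernel h s {a} = K := by
      rw [Summable.tsum_finsetSum fun _ _ => ENNReal.summable]
      simp [(π _).discrete h s]
    simp only [Kernel.coe_mk, Measure.smul_apply, Measure.finsetSum_apply, smul_eq_mul]
    rw [ENNReal.tsum_mul_left, h2, ENNReal.inv_mul_cancel h0 (ENNReal.natCast_ne_top K)]

/-- A time-inhomogeneous Markov decision process whose initial distribution and transition
probabilities have densities `init` and `p h s a` with respect to the reference measure `ρ`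
(Lebesgue measure, counting measure, …), with mean rewards `r h s a ∈ [0, 1]`. -/
structure MDP (S A : Type*) [MeasurableSpace S] [MeasurableSpace A] (ρ : Measure S) where
  init : S → ℝ≥0
  init_meas : Measurable init
  init_mass : ∫⁻ s, init s ∂ρ = 1
  p : ℕ → S → A → S → ℝ≥0
  p_meas : ∀ h, Measurable fun x : (S × A) × S => p h x.1.1 x.1.2 x.2
  p_mass : ∀ h s a, ∫⁻ s', p h s a s' ∂ρ = 1
  r : ℕ → S → A → ℝ
  r_meas : ∀ h, Measurable fun x : S × A => r h x.1 x.2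
  r_mem : ∀ h s a, r h s a ∈ Set.Icc (0 : ℝ) 1

namespace MDP

variable {S A : Type*} [MeasurableSpace S] [MeasurableSpace A] {ρ : Measure S}

/-- The initial distribution. -/
noncomputable def initLaw (M : MDP S A ρ) : Measure S := ρ.withDensity fun s => M.init s

/-- The distribution of the next state. -/
noncomputable def next (M : MDP S A ρ) (h : ℕ) (s : S) (a : A) : Measure S :=
  ρ.withDensity fun s' => M.p h s a s'

/-- Expected reward collected by `π` in the `n` steps `h, …, h + n - 1`, starting from `s`. -/
noncomputable def value (M : MDP S A ρ) (π : Policy S A) : ℕ → ℕ → S → ℝ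
  | 0, _, _ => 0
  | n + 1, h, s =>
      ∫ a, (M.r h s a + ∫ s', value M π n (h + 1) s' ∂(M.next h s a)) ∂(π.kernel h s)

/-- `V^π_h(s)` for episodes of length `H`. -/
noncomputable def V (M : MDP S A ρ) (H : ℕ) (π : Policy S A) (h : ℕ) (s : S) : ℝ :=
  M.value π (H - h) h s

/-- `V^*_h(s)`. -/
noncomputable def optV (M : MDP S A ρ) (H h : ℕ) (s : S) : ℝ := ⨆ π : Policy S A, M.V H π h s

/-- `Q^*_h(s, a)`. -/
noncomputable def optQ (M : MDP S A ρ) (H h : ℕ) (s : S) (a : A) : ℝ :=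
  M.r h s a + ∫ s', M.optV H (h + 1) s' ∂(M.next h s a)

/-- `π` attains the optimal value from every state at every step. -/
def IsOptimal (M : MDP S A ρ) (H : ℕ) (π : Policy S A) : Prop :=
  ∀ h < H, ∀ s, M.V H π h s = M.optV H h s

/-- The sub-optimality gap `Δ_h(s, a)`. -/
noncomputable def gap (M : MDP S A ρ) (H h : ℕ) (s : S) (a : A) : ℝ :=
  M.optV H h s - M.optQ H h s a

/-- The minimal nonzero sub-optimality gap `Δ_min`; its value is `0` if there is no nonzero gap. -/
noncomputable def minGap (M : MDP S A ρ) (H : ℕ) : ℝ :=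
  sInf {x : ℝ | x ≠ 0 ∧ ∃ h < H, ∃ s a, M.gap H h s a = x}

/-- `SubOpt(π) = E_{s ∼ d_1} [V^*_1(s) - V^π_1(s)]`. -/
noncomputable def subOpt (M : MDP S A ρ) (H : ℕ) (π : Policy S A) : ℝ :=
  ∫ s, (M.optV H 0 s - M.V H π 0 s) ∂M.initLaw

/-- The state-visitation density `d^π_h(s)` with respect to `ρ`. -/
noncomputable def occ (M : MDP S A ρ) (π : Policy S A) : ℕ → S → ℝ≥0∞
  | 0, s => M.init s
  | h + 1, s' => ∫⁻ s, ∫⁻ a, (M.p h s a s' : ℝ≥0∞) * occ M π h s ∂(π.kernel h s) ∂ρ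

/-- The state-action visitation density `d^π_h(s, a) = d^π_h(s) π_h(a | s)`. -/
noncomputable def occSA (M : MDP S A ρ) (π : Policy S A) (h : ℕ) (s : S) (a : A) : ℝ≥0∞ :=
  M.occ π h s * π.kernel h s {a}

/-- The visitation densities of all policies are at most `1`. -/
def BoundedDensity (M : MDP S A ρ) (H : ℕ) : Prop :=
  ∀ π : Policy S A, ∀ h < H, ∀ s a, M.occSA π h s a ≤ 1

/-- The state `s` is feasible at step `h` (under some policy). -/
def Feasible (M : MDP S A ρ) (h : ℕ) (s : S) : Prop := ∃ π : Policy S A, 0 < M.occ π h s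

/-- `M` is a linear MDP with the feature map `φ`. -/
structure IsLinear (M : MDP S A ρ) (H : ℕ) {d : ℕ}
    (φ : ℕ → S → A → EuclideanSpace ℝ (Fin d)) : Prop where
  meas : ∀ h < H, Measurable fun x : S × A => φ h x.1 x.2
  norm_le : ∀ h < H, ∀ s a, ‖φ h s a‖ ≤ 1
  reward : ∀ h < H, ∃ θ : EuclideanSpace ℝ (Fin d), ‖θ‖ ≤ √d ∧ ∀ s a, M.r h s a = ⟪φ h s a, θ⟫
  trans : ∀ h < H, ∃ m : S → EuclideanSpace ℝ (Fin d), Measurable m ∧ Integrable m ρ ∧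
    (∀ s a s', (M.p h s a s' : ℝ) = ⟪φ h s a, m s'⟫) ∧
    ∀ (v : S → ℝ) (c : ℝ), Measurable v → (∀ s, |v s| ≤ c) → ‖∫ s, v s • m s ∂ρ‖ ≤ √d * c

/-- The class `Π_h` of policies whose step-`h` action distribution at every feasible state is
supported in `supp h s`. -/
def Supported (M : MDP S A ρ) (supp : ℕ → S → Set A) (h : ℕ) (π : Policy S A) : Prop :=
  ∀ s, M.Feasible h s → {a | 0 < π.kernel h s {a}} ⊆ supp h s

end MDP

section Data

variable {S A Ω : Type*} [MeasurableSpace S] [MeasurableSpace A] {ρ : Measure S}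

/-- The first `k` episodes of the recorded data. -/
def hist (H : ℕ) (D : ℕ → ℕ → Ω → Step S A) (k : ℕ) (ω : Ω) : History S A H k :=
  fun t h => D t h ω

/-- The first `h` steps of episode `t`. -/
def partialEp (D : ℕ → ℕ → Ω → Step S A) (t h : ℕ) (ω : Ω) : Fin h → Step S A :=
  fun j => D t j ω

/-- The σ-algebra of the episodes before episode `t`. -/
abbrev sigmaHist (H : ℕ) (D : ℕ → ℕ → Ω → Step S A) (t : ℕ) : MeasurableSpace Ω :=
  MeasurableSpace.comap (hist H D t) inferInstance

/-- The σ-algebra of everything up to and including the state of step `h` of episode `t`. -/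
abbrev sigmaState (H : ℕ) (D : ℕ → ℕ → Ω → Step S A) (t h : ℕ) : MeasurableSpace Ω :=
  MeasurableSpace.comap (fun ω => (hist H D t ω, partialEp D t h ω, (D t h ω).1)) inferInstance

/-- The σ-algebra of everything up to and including the action of step `h` of episode `t`. -/
abbrev sigmaAction (H : ℕ) (D : ℕ → ℕ → Ω → Step S A) (t h : ℕ) : MeasurableSpace Ω :=
  MeasurableSpace.comap
    (fun ω => (hist H D t ω, partialEp D t h ω, (D t h ω).1, (D t h ω).2.1)) inferInstance

/-- `D` consists of `K` episodes of length `H` of the MDP `M`, collected adaptively: episode `t` is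
generated by the behavior policy `μ t`, which may depend on all earlier episodes. Recorded rewards
lie in `[0, 1]` and have conditional mean `r_h(s_h, a_h)`. -/
structure IsAdaptiveData [MeasurableSpace Ω] (P : Measure Ω) (M : MDP S A ρ) (H K : ℕ)
    (μ : (t : ℕ) → AdaptivePolicy S A H t) (D : ℕ → ℕ → Ω → Step S A) : Prop where
  meas : ∀ t < K, ∀ h < H, Measurable (D t h)
  init : ∀ t < K, ∀ B : Set S, MeasurableSet B →
    P⟦(fun ω => (D t 0 ω).1) ⁻¹' B | sigmaHist H D t⟧ =ᵐ[P] fun _ => M.initLaw.real B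
  action : ∀ t < K, ∀ h < H, ∀ B : Set A, MeasurableSet B →
    P⟦(fun ω => (D t h ω).2.1) ⁻¹' B | sigmaState H D t h⟧ =ᵐ[P]
      fun ω => (((μ t).run (hist H D t ω)).kernel h (D t h ω).1).real B
  next : ∀ t < K, ∀ h, h + 1 < H → ∀ B : Set S, MeasurableSet B →
    P⟦(fun ω => (D t (h + 1) ω).1) ⁻¹' B | sigmaAction H D t h⟧ =ᵐ[P]
      fun ω => (M.next h (D t h ω).1 (D t h ω).2.1).real B
  reward_mem : ∀ t < K, ∀ h < H, ∀ᵐ ω ∂P, (D t h ω).2.2 ∈ Set.Icc (0 : ℝ) 1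
  reward_mean : ∀ t < K, ∀ h < H,
    P[fun ω => (D t h ω).2.2 | sigmaAction H D t h] =ᵐ[P]
      fun ω => M.r h (D t h ω).1 (D t h ω).2.1

end Data

section Algorithm

variable {S A : Type*} [MeasurableSpace S] [MeasurableSpace A] {H k d : ℕ}

/-- `Σ_h = ∑_t φ_h(s_h^t, a_h^t) φ_h(s_h^t, a_h^t)ᵀ + lam I`, over the `k` episodes in `τ`. -/
noncomputable def gram (φ : ℕ → S → A → EuclideanSpace ℝ (Fin d)) (lam : ℝ)
    (τ : History S A H k) (h : Fin H) : Matrix (Fin d) (Fin d) ℝ :=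
  ∑ t, Matrix.vecMulVec (φ h (τ t h).1 (τ t h).2.1).ofLp (φ h (τ t h).1 (τ t h).2.1).ofLp
    + lam • (1 : Matrix (Fin d) (Fin d) ℝ)

/-- `ŵ_h = Σ_h⁻¹ ∑_t φ_h(s_h^t, a_h^t) (r_h^t + Vnext(s_{h+1}^t))`; at the last step there is no
next state, and the value after it is `0`. -/
noncomputable def wHat (φ : ℕ → S → A → EuclideanSpace ℝ (Fin d)) (lam : ℝ)
    (τ : History S A H k) (h : Fin H) (Vnext : S → ℝ) : Fin d → ℝ :=
  Matrix.mulVec (gram φ lam τ h)⁻¹ (∑ t,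
    ((τ t h).2.2 + if hh : (h : ℕ) + 1 < H then Vnext (τ t ⟨h + 1, hh⟩).1 else 0) •
      (φ h (τ t h).1 (τ t h).2.1).ofLp)

/-- The bonus `β ‖φ_h(s, a)‖_{Σ_h⁻¹}`. -/
noncomputable def bonus (φ : ℕ → S → A → EuclideanSpace ℝ (Fin d)) (lam β : ℝ)
    (τ : History S A H k) (h : Fin H) (s : S) (a : A) : ℝ :=
  β * √((φ h s a).ofLp ⬝ᵥ Matrix.mulVec (gram φ lam τ h)⁻¹ (φ h s a).ofLp)

/-- `Q̂_h = min {⟨φ_h, ŵ_h⟩ - b_h, remaining number of steps}⁺`. -/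
noncomputable def qHat (φ : ℕ → S → A → EuclideanSpace ℝ (Fin d)) (lam β : ℝ)
    (τ : History S A H k) (h : Fin H) (Vnext : S → ℝ) (s : S) (a : A) : ℝ :=
  max (min ((φ h s a).ofLp ⬝ᵥ wHat φ lam τ h Vnext - bonus φ lam β τ h s a) ((H : ℝ) - h)) 0

/-- `V̂` with `n` steps to go when the extracted policy is `π`: `V̂_h = ⟨Q̂_h, π_h⟩` for `n = H - h`,
by backward recursion from `V̂ = 0` after the last step. -/
noncomputable def vHat (φ : ℕ → S → A → EuclideanSpace ℝ (Fin d)) (lam β : ℝ)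
    (τ : History S A H k) (π : Policy S A) : ℕ → S → ℝ
  | 0, _ => 0
  | n + 1, s =>
      if hn : n + 1 ≤ H then
        ∫ a, qHat φ lam β τ ⟨H - (n + 1), by omega⟩ (vHat φ lam β τ π n) s a
          ∂(π.kernel (H - (n + 1)) s)
      else 0

/-- `Q̂_h` when the extracted policy is `π`. -/
noncomputable def estQ (φ : ℕ → S → A → EuclideanSpace ℝ (Fin d)) (lam β : ℝ)
    (τ : History S A H k) (π : Policy S A) (h : Fin H) (s : S) (a : A) : ℝ :=
  qHat φ lam β τ h (vHat φ lam β τ π (H - (h + 1))) s a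

/-- `π` is an output of constrained pessimistic value iteration on the `k` episodes in `τ`:
`π_h` is a maximizer of `⟨Q̂_h, ·⟩` in the class of supported policies, for every `h`. -/
def IsCPVIOutput {ρ : Measure S} (M : MDP S A ρ) (supp : ℕ → S → Set A)
    (φ : ℕ → S → A → EuclideanSpace ℝ (Fin d)) (lam β : ℝ)
    (τ : History S A H k) (π : Policy S A) : Prop :=
  ∀ h : Fin H, M.Supported supp h π ∧
    ∀ π' : Policy S A, M.Supported supp h π' → ∀ s, M.Feasible h s →
      ∫ a, estQ φ lam β τ π h s a ∂(π'.kernel h s) ≤ ∫ a, estQ φ lam β τ π h s a ∂(π.kernel h s)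

end Algorithm

/-! Fix an episode and let `W` be its estimated state values, `Q` its estimated action values.
Suppose pessimism holds: `Q` lies below the Bellman backup of `W`, by at most a bonus `b`. The
extracted policy maximizes the mean of `Q` over all supported policies, so every action it plays at
a feasible state has estimated value exactly `W`. For such an action, `Q` being below `Q*`, the gap
`V* - Q*` is at most the error `e = V* - W`. A nonzero gap is at least `Δ_min`, hence gap `≤ e² /
Δ_min`. This squaring turns a `1/√K` rate into a `1/K` rate.

Sub-optimality is the sum over the steps of the expected gaps at the visited states
(`subOpt_eq_sum_gap`), so second moments of `e` have to be bounded. Greediness gives `e_h ≤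
E_{π*}[e_{h+1} + b_h]`, and a weighted recursion bounds `E e_h²` by `H - h + 1` times the sum of the
later `E b_j²`, along the policy that visits states up to step `h` and is optimal from there on
(`integral_sq_error_le`). This spliced policy is supported, so its visitation density is at most `1
≤ κ_j d^μ`, and its expected squared bonuses are at most `κ_j` times those of the behavior policy
(`sum_integral_gap_le`). The visiting policy may be any supported one. That is needed for the policy
with averaged action probabilities: its action gaps are averages over the members, but its states
are its own.

Summed over the episodes, the conditional means of `‖φ‖²` in the inverse Gram norm are at most twice
their realized values plus a logarithm (`measure_sum_mean_ge_le`), and the realized values are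
bounded by the elliptical potential `2 d log(K + 1)` (`sum_inv_quad_le`).

Pessimism is a self-normalized bound on the regression noise, uniform over the data-dependent value
estimates. At feasible states `V̂_{h+1}` is a maximum over supported policies, hence a continuous
function of `ŵ_{h+1}` and `Σ_{h+1}⁻¹`. The quadratic form of the noise `Z` is a maximum over
directions `x`. Discretizing all these parameters and taking one sample point per cell as
representative leaves finitely many deterministic pairs of a value function and a direction, each
controlled by an exponential supermartingale (`measure_sum_noise_ge_le`,
`exists_uniform_noise_bound`).

Two events of probability `δ/2` are excluded, so failure probability `δ` already suffices; `H² κ ≤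
κ³` brings the bound to its final form. -/

set_option linter.unusedSectionVars false

/-! ### Discrete probability measures -/

section DiscreteMeasure

theorem countable_atoms {A : Type*} [MeasurableSpace A] {m : Measure A}
    (hm : ∑' a, m {a} = 1) : {a | m {a} ≠ 0}.Countable :=
  Summable.countable_support_ennreal (by rw [hm]; exact ENNReal.one_ne_top)

theorem forall_atoms_of_ae {A : Type*} [MeasurableSpace A] {m : Measure A} {p : A → Prop}
    (hp : ∀ᵐ a ∂m, p a) (a : A) (ha : 0 < m {a}) : p a := by
  by_contra h
  exact ha.ne' (measure_mono_null (by simpa using h) hp)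

theorem exists_atom {A : Type*} [MeasurableSpace A] {m : Measure A}
    (hm : ∑' a, m {a} = 1) : ∃ a, 0 < m {a} := by
  by_contra! h
  have : ∑' a, m {a} = 0 := ENNReal.tsum_eq_zero.2 fun a => le_antisymm (h a) zero_le
  simp [this] at hm

variable {A : Type*} [MeasurableSpace A] [MeasurableSingletonClass A] {m : Measure A}
  [IsProbabilityMeasure m]

/-- The atoms are countably many and disjoint, so their union already carries the whole mass. -/
theorem measure_compl_atoms (hm : ∑' a, m {a} = 1) : m {a | m {a} ≠ 0}ᶜ = 0 := by
  have hC := countable_atoms hm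
  rw [prob_compl_eq_zero_iff hC.measurableSet]
  rw [← hm, ← tsum_subtype_eq_of_support_subset (s := {a | m {a} ≠ 0}) (fun a ha => ha)]
  have := measure_biUnion (μ := m) hC (f := fun a => {a})
    (fun a _ b _ hab => by simpa using hab) (fun a _ => measurableSet_singleton a)
  rwa [Set.biUnion_of_singleton] at this

theorem lintegral_eq_tsum_atoms (hm : ∑' a, m {a} = 1) (f : A → ℝ≥0∞) :
    ∫⁻ a, f a ∂m = ∑' a, f a * m {a} := by
  have hC := countable_atoms hm
  have h1 : m.restrict {a | m {a} ≠ 0} = m :=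
    Measure.restrict_eq_self_of_ae_mem (measure_compl_atoms hm)
  conv_lhs => rw [← h1]
  rw [lintegral_countable f hC]
  exact tsum_subtype_eq_of_support_subset (f := fun a => f a * m {a}) fun a ha => by
    intro h
    simp [h] at ha

theorem ae_of_forall_atoms (hm : ∑' a, m {a} = 1) {p : A → Prop}
    (hp : ∀ a, 0 < m {a} → p a) : ∀ᵐ a ∂m, p a :=
  measure_mono_null (fun a ha h => ha (hp a (pos_iff_ne_zero.2 h))) (measure_compl_atoms hm)

end DiscreteMeasure

instance {S A : Type*} [MeasurableSpace S] [MeasurableSpace A] (π : Policy S A) (h : ℕ) :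
    IsMarkovKernel (π.kernel h) := π.markov h

instance {S A : Type*} [MeasurableSpace S] [MeasurableSpace A] {H k : ℕ}
    (π : AdaptivePolicy S A H k) (h : ℕ) : IsMarkovKernel (π.kernel h) := π.markov h

/-! ### Bounded integrands under probability measures -/

theorem integrable_of_abs_le {α : Type*} [MeasurableSpace α] {m : Measure α} [IsFiniteMeasure m]
    {f : α → ℝ} (hf : Measurable f) (c : ℝ) (hc : ∀ x, |f x| ≤ c) : Integrable f m :=
  Integrable.of_bound hf.aestronglyMeasurable c (Filter.Eventually.of_forall hc)

theorem abs_integral_le_of_abs_le {α : Type*} [MeasurableSpace α] {m : Measure α}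
    [IsProbabilityMeasure m] {f : α → ℝ} {c : ℝ} (hc : ∀ x, |f x| ≤ c) : |∫ x, f x ∂m| ≤ c := by
  simpa using norm_integral_le_of_norm_le_const (μ := m) (f := f) (Filter.Eventually.of_forall hc)

theorem integral_mem_Icc {α : Type*} [MeasurableSpace α] {m : Measure α}
    [IsProbabilityMeasure m] {f : α → ℝ} {c : ℝ} (hf : Measurable f)
    (h : ∀ x, f x ∈ Set.Icc 0 c) : ∫ x, f x ∂m ∈ Set.Icc 0 c := by
  refine ⟨integral_nonneg fun x => (h x).1, ?_⟩
  have := integral_mono (μ := m) (integrable_of_abs_le hf c fun x => by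
    rw [abs_of_nonneg (h x).1]; exact (h x).2) (integrable_const c) fun x => (h x).2
  simpa using this

/-- The square of the mean is at most the mean of the square. -/
theorem sq_integral_le {α : Type*} [MeasurableSpace α] {m : Measure α}
    [IsProbabilityMeasure m] {f : α → ℝ} {c : ℝ} (hf : Measurable f) (hc : ∀ x, |f x| ≤ c) :
    (∫ x, f x ∂m) ^ 2 ≤ ∫ x, f x ^ 2 ∂m := by
  have h1 : Integrable f m := integrable_of_abs_le hf c hc
  have h2 : Integrable (fun x => f x ^ 2) m :=
    integrable_of_abs_le (hf.pow_const 2) (c ^ 2) fun x => by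
      rw [abs_pow]; exact pow_le_pow_left₀ (abs_nonneg _) (hc x) 2
  have h3 : 0 ≤ ∫ x, (f x - ∫ y, f y ∂m) ^ 2 ∂m := integral_nonneg fun x => sq_nonneg _
  have h4 : ∫ x, (f x - ∫ y, f y ∂m) ^ 2 ∂m
      = ∫ x, f x ^ 2 ∂m - (∫ y, f y ∂m) ^ 2 := by
    have : ∀ x, (f x - ∫ y, f y ∂m) ^ 2
        = f x ^ 2 - (2 * ∫ y, f y ∂m) * f x + (∫ y, f y ∂m) ^ 2 := fun x => by ring
    simp_rw [this]
    have h5 : Integrable (fun x => (2 * ∫ y, f y ∂m) * f x) m := h1.const_mul _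
    have h6 : Integrable (fun x => f x ^ 2 - (2 * ∫ y, f y ∂m) * f x) m := h2.sub h5
    rw [integral_add h6 (integrable_const _), integral_sub h2 h5, integral_const_mul]
    simp
    ring
  linarith

/-! ### Transition kernels and visitation laws -/

namespace MDP

theorem measurable_p {S A : Type*} [MeasurableSpace S] [MeasurableSpace A] {ρ : Measure S}
    (M : MDP S A ρ) (h : ℕ) :
    Measurable fun x : (S × A) × S => (M.p h x.1.1 x.1.2 x.2 : ℝ≥0∞) :=
  (M.p_meas h).coe_nnreal_ennreal

variable {S A : Type*} [MeasurableSpace S] [MeasurableSpace A] {ρ : Measure S} [SigmaFinite ρ]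

/-- The transition probabilities as a kernel. -/
noncomputable def nextKernel (M : MDP S A ρ) (h : ℕ) : Kernel (S × A) S :=
  Kernel.withDensity (Kernel.const _ ρ) fun x s' => (M.p h x.1 x.2 s' : ℝ≥0∞)

theorem nextKernel_apply (M : MDP S A ρ) (h : ℕ) (x : S × A) :
    M.nextKernel h x = M.next h x.1 x.2 := by
  rw [nextKernel, Kernel.withDensity_apply _ (M.measurable_p h)]
  rfl

instance (M : MDP S A ρ) (h : ℕ) (s : S) (a : A) : IsProbabilityMeasure (M.next h s a) :=
  ⟨by simpa [next] using M.p_mass h s a⟩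

instance (M : MDP S A ρ) (h : ℕ) : IsMarkovKernel (M.nextKernel h) :=
  ⟨fun x => by rw [nextKernel_apply]; infer_instance⟩

instance (M : MDP S A ρ) : IsProbabilityMeasure M.initLaw :=
  ⟨by simpa [initLaw] using M.init_mass⟩

/-- Visitation densities depend measurably on parameters on which the policy depends
measurably. -/
theorem measurable_occ_family (M : MDP S A ρ) {T : Type*} [MeasurableSpace T]
    (π : T → Policy S A) (η : ℕ → Kernel (T × S) A) [∀ h, IsMarkovKernel (η h)]
    (hη : ∀ τ h s, (π τ).kernel h s = η h (τ, s)) (h : ℕ) :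
    Measurable fun x : T × S => M.occ (π x.1) h x.2 := by
  induction h with
  | zero => exact (M.init_meas.comp measurable_snd).coe_nnreal_ennreal
  | succ h ih =>
    simp only [occ, hη]
    have h1 : Measurable fun z : (T × S) × S =>
        ∫⁻ a, (M.p h z.2 a z.1.2 : ℝ≥0∞) * M.occ (π z.1.1) h z.2 ∂(η h (z.1.1, z.2)) := by
      have h2 : Measurable fun y : ((T × S) × S) × A =>
          (M.p h y.1.2 y.2 y.1.1.2 : ℝ≥0∞) * M.occ (π y.1.1.1) h y.1.2 := by
        refine Measurable.mul ?_ ?_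
        · exact (M.measurable_p h).comp
            (((measurable_snd.comp measurable_fst).prodMk measurable_snd).prodMk
              (measurable_snd.comp (measurable_fst.comp measurable_fst)))
        · exact ih.comp ((measurable_fst.comp (measurable_fst.comp measurable_fst)).prodMk
            (measurable_snd.comp measurable_fst))
      have h3 : Measurable fun z : (T × S) × S => (z.1.1, z.2) := by fun_prop
      exact Measurable.lintegral_kernel_prod_right' (κ := (η h).comap _ h3) h2
    exact h1.lintegral_prod_right'

theorem measurable_occ (M : MDP S A ρ) (π : Policy S A) (h : ℕ) : Measurable (M.occ π h) := by
  have := M.measurable_occ_family (T := Unit) (fun _ => π)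
    (fun h => (π.kernel h).comap Prod.snd measurable_snd) (fun _ _ _ => rfl) h
  exact this.comp (measurable_prodMk_left (x := ()))

/-- The law of the state of step `h` under `π`. -/
noncomputable def stateLaw (M : MDP S A ρ) (π : Policy S A) (h : ℕ) : Measure S :=
  ρ.withDensity (M.occ π h)

/-- The law of the state and the action of step `h` under `π`. -/
noncomputable def law (M : MDP S A ρ) (π : Policy S A) (h : ℕ) : Measure (S × A) :=
  M.stateLaw π h ⊗ₘ π.kernel h

theorem lintegral_stateLaw (M : MDP S A ρ) (π : Policy S A) (h : ℕ) {g : S → ℝ≥0∞}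
    (hg : Measurable g) : ∫⁻ s, g s ∂(M.stateLaw π h) = ∫⁻ s, M.occ π h s * g s ∂ρ :=
  lintegral_withDensity_eq_lintegral_mul _ (M.measurable_occ π h) hg

theorem ae_stateLaw_occ_pos (M : MDP S A ρ) (π : Policy S A) (h : ℕ) :
    ∀ᵐ s ∂(M.stateLaw π h), 0 < M.occ π h s := by
  rw [stateLaw, ae_withDensity_iff (M.measurable_occ π h)]
  exact Filter.Eventually.of_forall fun s hs => pos_iff_ne_zero.2 hs

theorem lintegral_next (M : MDP S A ρ) (h : ℕ) (s : S) (a : A) {g : S → ℝ≥0∞}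
    (hg : Measurable g) :
    ∫⁻ s', g s' ∂(M.next h s a) = ∫⁻ s', (M.p h s a s' : ℝ≥0∞) * g s' ∂ρ :=
  lintegral_withDensity_eq_lintegral_mul _
    ((M.measurable_p h).comp (measurable_prodMk_left (x := (s, a)))) hg

instance (M : MDP S A ρ) (π : Policy S A) (h : ℕ) : SFinite (M.stateLaw π h) := by
  rw [stateLaw]; infer_instance

/-- The recursion defining the densities, integrated against a test function. Everything is
nonnegative, so Tonelli moves the integral over the next state inside those over the current state
and action. -/
theorem lintegral_stateLaw_succ (M : MDP S A ρ) (π : Policy S A) (h : ℕ) {g : S → ℝ≥0∞}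
    (hg : Measurable g) :
    ∫⁻ s, g s ∂(M.stateLaw π (h + 1))
      = ∫⁻ x, ∫⁻ s', g s' ∂(M.next h x.1 x.2) ∂(M.law π h) := by
  have hm : Measurable fun x : S × A => ∫⁻ s', g s' ∂(M.next h x.1 x.2) := by
    simp_rw [← nextKernel_apply]
    exact hg.lintegral_kernel
  have hp := M.measurable_p h
  have ho := M.measurable_occ π h
  rw [M.lintegral_stateLaw π (h + 1) hg, law, Measure.lintegral_compProd hm,
    M.lintegral_stateLaw π h (Measurable.lintegral_kernel_prod_right' hm)]
  have e1 : ∀ s', M.occ π (h + 1) s' * g s'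
      = ∫⁻ s, (∫⁻ a, (M.p h s a s' : ℝ≥0∞) * M.occ π h s ∂(π.kernel h s)) * g s' ∂ρ := by
    intro s'
    rw [lintegral_mul_const]
    · rfl
    · have : Measurable fun y : S × A => (M.p h y.1 y.2 s' : ℝ≥0∞) * M.occ π h y.1 :=
        (hp.comp (measurable_prodMk_right (y := s'))).mul (ho.comp measurable_fst)
      exact this.lintegral_kernel_prod_right'
  simp_rw [e1]
  have hj : Measurable fun y : (S × S) × A =>
      (M.p h y.1.2 y.2 y.1.1 : ℝ≥0∞) * M.occ π h y.1.2 * g y.1.1 := by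
    refine Measurable.mul (Measurable.mul ?_ ?_) ?_
    · exact hp.comp (((measurable_snd.comp measurable_fst).prodMk measurable_snd).prodMk
        (measurable_fst.comp measurable_fst))
    · exact ho.comp (measurable_snd.comp measurable_fst)
    · exact hg.comp (measurable_fst.comp measurable_fst)
  have e2 : ∀ s' s, (∫⁻ a, (M.p h s a s' : ℝ≥0∞) * M.occ π h s ∂(π.kernel h s)) * g s'
      = ∫⁻ a, (M.p h s a s' : ℝ≥0∞) * M.occ π h s * g s' ∂(π.kernel h s) := by
    intro s' s
    have h1 : Measurable fun a => (M.p h s a s' : ℝ≥0∞) :=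
      hp.comp ((measurable_prodMk_left (x := s)).prodMk measurable_const)
    rw [lintegral_mul_const _ (h1.mul_const _)]
  simp_rw [e2]
  have e3 : ∀ s, M.occ π h s * ∫⁻ a, ∫⁻ s', g s' ∂(M.next h s a) ∂(π.kernel h s)
      = ∫⁻ s', ∫⁻ a, (M.p h s a s' : ℝ≥0∞) * M.occ π h s * g s' ∂(π.kernel h s) ∂ρ := by
    intro s
    have hms : Measurable fun a => ∫⁻ s', g s' ∂(M.next h s a) := by
      have h1 := hm.comp (measurable_prodMk_left (x := s))
      simpa only [Function.comp_def] using h1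
    have hy : Measurable fun y : S × A => ((y.1, s), y.2) := by fun_prop
    have hjs : Measurable fun y : S × A =>
        (M.p h s y.2 y.1 : ℝ≥0∞) * M.occ π h s * g y.1 := by
      have h1 := hj.comp hy
      simpa only [Function.comp_def] using h1
    rw [← lintegral_const_mul _ hms, lintegral_lintegral_swap hjs.aemeasurable]
    refine lintegral_congr fun a => ?_
    have hpa : Measurable fun s' => (M.p h s a s' : ℝ≥0∞) :=
      hp.comp (measurable_prodMk_left (x := (s, a)))
    have hpg : Measurable fun s' => (M.p h s a s' : ℝ≥0∞) * g s' := hpa.mul hg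
    rw [M.lintegral_next h s a hg, ← lintegral_const_mul _ hpg]
    exact lintegral_congr fun s' => by ring
  simp_rw [e3]
  have hsw : Measurable fun y : S × S =>
      ∫⁻ a, (M.p h y.2 a y.1 : ℝ≥0∞) * M.occ π h y.2 * g y.1 ∂(π.kernel h y.2) :=
    Measurable.lintegral_kernel_prod_right' (κ := (π.kernel h).comap Prod.snd measurable_snd) hj
  exact lintegral_lintegral_swap hsw.aemeasurable

instance isProbabilityMeasure_stateLaw (M : MDP S A ρ) (π : Policy S A) (h : ℕ) :
    IsProbabilityMeasure (M.stateLaw π h) := by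
  induction h with
  | zero => exact inferInstanceAs (IsProbabilityMeasure M.initLaw)
  | succ h ih =>
    refine ⟨?_⟩
    have := M.lintegral_stateLaw_succ π h (g := fun _ => 1) measurable_const
    simpa [law] using this

instance (M : MDP S A ρ) (π : Policy S A) (h : ℕ) : IsProbabilityMeasure (M.law π h) := by
  rw [law]; infer_instance

theorem stateLaw_succ (M : MDP S A ρ) (π : Policy S A) (h : ℕ) :
    M.stateLaw π (h + 1) = M.nextKernel h ∘ₘ M.law π h := by
  ext B hB
  have := M.lintegral_stateLaw_succ π h (g := B.indicator 1) (measurable_one.indicator hB)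
  rw [Measure.bind_apply hB (M.nextKernel h).aemeasurable]
  simp only [lintegral_indicator_one hB] at this
  simpa only [nextKernel_apply] using this

theorem integral_stateLaw_succ (M : MDP S A ρ) (π : Policy S A) (h : ℕ) {g : S → ℝ}
    (hg : Measurable g) (c : ℝ) (hc : ∀ s, |g s| ≤ c) :
    ∫ s, g s ∂(M.stateLaw π (h + 1))
      = ∫ x, ∫ s', g s' ∂(M.next h x.1 x.2) ∂(M.law π h) := by
  have hi : Integrable g (M.nextKernel h ∘ₘ M.law π h) := integrable_of_abs_le hg c hc
  rw [Measure.comp_eq_comp_const_apply] at hi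
  rw [stateLaw_succ, Measure.comp_eq_comp_const_apply, Kernel.integral_comp hi, Kernel.const_apply]
  simp only [nextKernel_apply]

theorem integral_law (M : MDP S A ρ) (π : Policy S A) (h : ℕ) {g : S × A → ℝ}
    (hg : Measurable g) (c : ℝ) (hc : ∀ x, |g x| ≤ c) :
    ∫ x, g x ∂(M.law π h) = ∫ s, ∫ a, g (s, a) ∂(π.kernel h s) ∂(M.stateLaw π h) := by
  rw [law]
  exact Measure.integral_compProd (integrable_of_abs_le hg c hc)

end MDP

/-! ### Modifying policies step by step -/

namespace Policy

variable {S A : Type*} [MeasurableSpace S] [MeasurableSpace A]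

/-- Follow `π` before step `n` and `π'` from step `n` on. -/
noncomputable def splice (π π' : Policy S A) (n : ℕ) : Policy S A where
  kernel h := if h < n then π.kernel h else π'.kernel h
  markov h := by split_ifs <;> infer_instance
  discrete h s := by
    split_ifs
    · exact π.discrete h s
    · exact π'.discrete h s

theorem splice_of_lt (π π' : Policy S A) {n h : ℕ} (hn : h < n) :
    (π.splice π' n).kernel h = π.kernel h := if_pos hn

theorem splice_of_le (π π' : Policy S A) {n h : ℕ} (hn : n ≤ h) :
    (π.splice π' n).kernel h = π'.kernel h := if_neg hn.not_gt

/-- Replace the action distribution of `π` at step `n`. -/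
noncomputable def update (π : Policy S A) (n : ℕ) (η : Kernel S A) (hη : IsMarkovKernel η)
    (hd : ∀ s, ∑' a, η s {a} = 1) : Policy S A where
  kernel h := if h = n then η else π.kernel h
  markov h := by split_ifs <;> infer_instance
  discrete h s := by
    split_ifs
    · exact hd s
    · exact π.discrete h s

end Policy

/-! ### Bellman operator, gaps and change of visitation measure -/

namespace MDP

variable {S A : Type*} [MeasurableSpace S] [MeasurableSpace A] {ρ : Measure S} [SigmaFinite ρ]

theorem measurable_integral_next (M : MDP S A ρ) (h : ℕ) {g : S → ℝ} (hg : Measurable g) :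
    Measurable fun x : S × A => ∫ s', g s' ∂(M.next h x.1 x.2) := by
  simp_rw [← nextKernel_apply]
  exact (StronglyMeasurable.integral_kernel (κ := M.nextKernel h) hg.stronglyMeasurable).measurable

theorem measurable_integral_policy (π : Policy S A) (h : ℕ) {f : S → A → ℝ}
    (hf : Measurable fun x : S × A => f x.1 x.2) :
    Measurable fun s => ∫ a, f s a ∂(π.kernel h s) :=
  (StronglyMeasurable.integral_kernel_prod_right' (κ := π.kernel h)
    hf.stronglyMeasurable).measurable

/-- The Bellman operator `(T g)(s, a) = r_h(s, a) + E g(s')`. -/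
noncomputable def bellman (M : MDP S A ρ) (h : ℕ) (g : S → ℝ) (s : S) (a : A) : ℝ :=
  M.r h s a + ∫ s', g s' ∂(M.next h s a)

theorem measurable_bellman (M : MDP S A ρ) (h : ℕ) {g : S → ℝ} (hg : Measurable g) :
    Measurable fun x : S × A => M.bellman h g x.1 x.2 :=
  (M.r_meas h).add (M.measurable_integral_next h hg)

theorem bellman_mem (M : MDP S A ρ) (h : ℕ) {g : S → ℝ} (hg : Measurable g) {c : ℝ}
    (hc : ∀ s, g s ∈ Set.Icc 0 c) (s : S) (a : A) : M.bellman h g s a ∈ Set.Icc 0 (c + 1) := by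
  have h1 := M.r_mem h s a
  have h2 := integral_mem_Icc (m := M.next h s a) hg hc
  exact ⟨add_nonneg h1.1 h2.1, by unfold bellman; linarith [h1.2, h2.2]⟩

theorem bellman_mono (M : MDP S A ρ) (h : ℕ) {g g' : S → ℝ} (hg : Measurable g)
    (hg' : Measurable g') (c : ℝ) (hc : ∀ s, |g s| ≤ c) (hc' : ∀ s, |g' s| ≤ c)
    (hle : ∀ s, g s ≤ g' s) (s : S) (a : A) : M.bellman h g s a ≤ M.bellman h g' s a :=
  add_le_add le_rfl (integral_mono (integrable_of_abs_le hg c hc)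
    (integrable_of_abs_le hg' c hc') hle)

theorem value_succ (M : MDP S A ρ) (π : Policy S A) (n h : ℕ) (s : S) :
    M.value π (n + 1) h s = ∫ a, M.bellman h (M.value π n (h + 1)) s a ∂(π.kernel h s) := rfl

theorem measurable_value (M : MDP S A ρ) (π : Policy S A) (n h : ℕ) :
    Measurable (M.value π n h) := by
  induction n generalizing h with
  | zero => exact measurable_const
  | succ n ih => exact measurable_integral_policy π h (M.measurable_bellman h (ih (h + 1)))

theorem value_mem (M : MDP S A ρ) (π : Policy S A) (n h : ℕ) (s : S) :
    M.value π n h s ∈ Set.Icc (0 : ℝ) n := by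
  induction n generalizing h s with
  | zero => simp [value]
  | succ n ih =>
    rw [value_succ]
    push_cast
    have hm := M.measurable_bellman h (M.measurable_value π n (h + 1))
    exact integral_mem_Icc (hm.comp (measurable_prodMk_left (x := s)))
      fun a => M.bellman_mem h (M.measurable_value π n (h + 1)) (ih (h + 1)) s a

theorem value_congr (M : MDP S A ρ) {π π' : Policy S A} (n h : ℕ)
    (hk : ∀ j, h ≤ j → π.kernel j = π'.kernel j) : M.value π n h = M.value π' n h := by
  induction n generalizing h with
  | zero => rfl
  | succ n ih =>
    ext s
    rw [value_succ, value_succ, ih (h + 1) fun j hj => hk j (by omega), hk h le_rfl]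

theorem occ_congr (M : MDP S A ρ) {π π' : Policy S A} (h : ℕ)
    (hk : ∀ j < h, π.kernel j = π'.kernel j) : M.occ π h = M.occ π' h := by
  induction h with
  | zero => rfl
  | succ h ih =>
    ext s
    simp only [occ]
    rw [ih fun j hj => hk j (by omega), hk h (by omega)]

theorem measurable_V (M : MDP S A ρ) (H : ℕ) (π : Policy S A) (h : ℕ) :
    Measurable (M.V H π h) := M.measurable_value π _ h

theorem V_self (M : MDP S A ρ) (H : ℕ) (π : Policy S A) (s : S) : M.V H π H s = 0 := by
  simp [V, value]

theorem V_eq (M : MDP S A ρ) {H h : ℕ} (hh : h < H) (π : Policy S A) (s : S) :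
    M.V H π h s = ∫ a, M.bellman h (M.V H π (h + 1)) s a ∂(π.kernel h s) := by
  have : H - h = H - (h + 1) + 1 := by omega
  unfold V
  rw [this, value_succ]

theorem V_mem (M : MDP S A ρ) {H h : ℕ} (hh : h ≤ H) (π : Policy S A) (s : S) :
    M.V H π h s ∈ Set.Icc (0 : ℝ) (H - h) := by
  have := M.value_mem π (H - h) h s
  rwa [Nat.cast_sub hh] at this

theorem abs_V_le (M : MDP S A ρ) {H h : ℕ} (hh : h ≤ H) (π : Policy S A) (s : S) :
    |M.V H π h s| ≤ H := by
  have := M.V_mem hh π s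
  rw [abs_of_nonneg this.1]
  exact this.2.trans (by simp)

theorem V_le_optV (M : MDP S A ρ) {H h : ℕ} (hh : h ≤ H) (π : Policy S A) (s : S) :
    M.V H π h s ≤ M.optV H h s :=
  le_ciSup (f := fun π => M.V H π h s)
    ⟨H - h, by rintro _ ⟨π, rfl⟩; exact (M.V_mem hh π s).2⟩ π

/-- Replaces the pointwise supremum over policies by the value of one policy, from which
measurability and bounds are inherited. -/
theorem optV_eq (M : MDP S A ρ) {H : ℕ} {πopt : Policy S A} (hopt : M.IsOptimal H πopt) {h : ℕ}
    (hh : h ≤ H) : M.optV H h = M.V H πopt h := by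
  ext s
  rcases hh.lt_or_eq with hh | rfl
  · exact (hopt h hh s).symm
  · have : Nonempty (Policy S A) := ⟨πopt⟩
    simp [optV, V_self]

theorem optQ_eq (M : MDP S A ρ) (H h : ℕ) (s : S) (a : A) :
    M.optQ H h s a = M.bellman h (M.optV H (h + 1)) s a := rfl

theorem measurable_gap (M : MDP S A ρ) {H : ℕ} {πopt : Policy S A} (hopt : M.IsOptimal H πopt)
    {h : ℕ} (hh : h < H) : Measurable fun x : S × A => M.gap H h x.1 x.2 := by
  unfold gap
  simp_rw [optQ_eq, M.optV_eq hopt hh, M.optV_eq hopt hh.le]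
  exact ((M.measurable_V H πopt h).comp measurable_fst).sub
    (M.measurable_bellman h (M.measurable_V H πopt (h + 1)))

theorem abs_gap_le (M : MDP S A ρ) {H : ℕ} {πopt : Policy S A} (hopt : M.IsOptimal H πopt)
    {h : ℕ} (hh : h < H) (s : S) (a : A) : |M.gap H h s a| ≤ H := by
  unfold gap
  rw [optQ_eq, M.optV_eq hopt hh, M.optV_eq hopt hh.le]
  have h1 := M.V_mem hh.le πopt s
  have h2 := M.bellman_mem h (M.measurable_V H πopt (h + 1)) (M.V_mem hh πopt) s a
  have h3 : (0 : ℝ) ≤ h := by positivity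
  push_cast at h2
  rw [abs_le]
  constructor <;> linarith [h1.1, h1.2, h2.1, h2.2]

variable [MeasurableSingletonClass A]

theorem gap_nonneg (M : MDP S A ρ) {H : ℕ} {πopt : Policy S A} (hopt : M.IsOptimal H πopt)
    {h : ℕ} (hh : h < H) (s : S) (a : A) : 0 ≤ M.gap H h s a := by
  have hd : ∀ s : S, ∑' b, (Kernel.const S (Measure.dirac a)) s {b} = 1 := fun s => by
    rw [tsum_eq_single a]
    · simp
    · intro b hb
      simp [hb.symm]
  -- Playing `a` once and then acting optimally is a policy with value `Q*_h(s, a)`, which cannot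
  -- exceed `V*_h(s)`.
  let π := πopt.update h (Kernel.const S (Measure.dirac a)) inferInstance hd
  have h1 : M.V H π h s = M.optQ H h s a := by
    rw [M.V_eq hh]
    have h2 : M.V H π (h + 1) = M.optV H (h + 1) := by
      rw [M.optV_eq hopt hh]
      exact M.value_congr _ _ fun j hj => if_neg (by omega)
    have h3 : π.kernel h = Kernel.const S (Measure.dirac a) := if_pos rfl
    rw [h2, h3, optQ_eq]
    simp
  have := M.V_le_optV hh.le π s
  unfold gap
  linarith

theorem gap_eq_zero_or_minGap_le (M : MDP S A ρ) {H : ℕ} {πopt : Policy S A}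
    (hopt : M.IsOptimal H πopt) {h : ℕ} (hh : h < H) (s : S) (a : A) :
    M.gap H h s a = 0 ∨ M.minGap H ≤ M.gap H h s a := by
  by_cases h0 : M.gap H h s a = 0
  · exact Or.inl h0
  -- A real infimum is a lower bound only for a set bounded below; nonnegativity of the gaps
  -- provides this.
  · refine Or.inr (csInf_le ⟨0, ?_⟩ ⟨h0, h, hh, s, a, rfl⟩)
    rintro _ ⟨_, h', hh', s', a', rfl⟩
    exact M.gap_nonneg hopt hh' s' a'

/-- For a nonzero gap, `Δ_min · gap ≤ gap² ≤ e²`. This is the only place where the minimal gap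
sharpens the rate. -/
theorem gap_le_sq_div (M : MDP S A ρ) {H : ℕ} {πopt : Policy S A}
    (hopt : M.IsOptimal H πopt) (hg : 0 < M.minGap H) {h : ℕ} (hh : h < H) (s : S) (a : A) {e : ℝ}
    (he : M.gap H h s a ≤ e) : M.gap H h s a ≤ e ^ 2 / M.minGap H := by
  have h0 := M.gap_nonneg hopt hh s a
  rcases M.gap_eq_zero_or_minGap_le hopt hh s a with h1 | h1
  · rw [h1]; positivity
  · rw [le_div_iff₀ hg]
    nlinarith

/-- One step of the performance difference identity: `V*_h(s) - (T V^π_{h+1})(s, a)` splits into the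
gap of `a` and the expected difference of values at the next state. -/
theorem integral_optV_sub_V (M : MDP S A ρ) {H : ℕ} {πopt : Policy S A}
    (hopt : M.IsOptimal H πopt) (π : Policy S A) {h : ℕ} (hh : h < H) :
    ∫ s, (M.optV H h s - M.V H π h s) ∂(M.stateLaw π h)
      = ∫ s, ∫ a, M.gap H h s a ∂(π.kernel h s) ∂(M.stateLaw π h)
        + ∫ s, (M.optV H (h + 1) s - M.V H π (h + 1) s) ∂(M.stateLaw π (h + 1)) := by
  have mo : Measurable (M.optV H (h + 1)) := by
    rw [M.optV_eq hopt hh]; exact M.measurable_V H πopt _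
  have mV := M.measurable_V H π (h + 1)
  have bo : ∀ s, |M.optV H (h + 1) s| ≤ H := by
    rw [M.optV_eq hopt hh]; exact M.abs_V_le hh πopt
  have bV := M.abs_V_le hh π
  have md : Measurable fun s => M.optV H (h + 1) s - M.V H π (h + 1) s := mo.sub mV
  have bd : ∀ s, |M.optV H (h + 1) s - M.V H π (h + 1) s| ≤ H + H := fun s =>
    (abs_sub _ _).trans (add_le_add (bo s) (bV s))
  have mg := M.measurable_gap hopt hh
  have bg := M.abs_gap_le hopt hh
  have mn := M.measurable_integral_next h md
  have bn : ∀ x : S × A, |∫ s', (M.optV H (h + 1) s' - M.V H π (h + 1) s') ∂(M.next h x.1 x.2)|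
      ≤ H + H := fun x => abs_integral_le_of_abs_le bd
  have mgn : Measurable fun x : S × A => M.gap H h x.1 x.2
      + ∫ s', (M.optV H (h + 1) s' - M.V H π (h + 1) s') ∂(M.next h x.1 x.2) := mg.add mn
  rw [M.integral_stateLaw_succ π h md _ bd, ← M.integral_law π h mg _ fun x => bg x.1 x.2,
    ← integral_add (integrable_of_abs_le mg _ fun x => bg x.1 x.2)
      (integrable_of_abs_le mn _ bn),
    M.integral_law π h mgn (H + (H + H))
      fun x => (abs_add_le _ _).trans (add_le_add (bg x.1 x.2) (bn x))]
  refine integral_congr_ae (Filter.Eventually.of_forall fun s => ?_)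
  have e1 : ∀ a, M.gap H h s a
        + ∫ s', (M.optV H (h + 1) s' - M.V H π (h + 1) s') ∂(M.next h s a)
      = M.optV H h s - M.bellman h (M.V H π (h + 1)) s a := fun a => by
    rw [integral_sub (integrable_of_abs_le mo _ bo) (integrable_of_abs_le mV _ bV)]
    unfold gap optQ bellman
    ring
  simp only [e1]
  have mb : Measurable fun a => M.bellman h (M.V H π (h + 1)) s a :=
    (M.measurable_bellman h mV).comp (measurable_prodMk_left (x := s))
  have bb : ∀ a, |M.bellman h (M.V H π (h + 1)) s a| ≤ (H - (h + 1 : ℕ)) + 1 := fun a => by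
    have := M.bellman_mem h mV (M.V_mem hh π) s a
    rw [abs_of_nonneg this.1]
    exact this.2
  rw [integral_sub (integrable_const _) (integrable_of_abs_le mb _ bb), ← M.V_eq hh]
  simp

/-- Telescopes the one-step identity; the remainder vanishes because both values are zero after the
last step. -/
theorem subOpt_eq_sum_gap (M : MDP S A ρ) {H : ℕ} {πopt : Policy S A}
    (hopt : M.IsOptimal H πopt) (π : Policy S A) :
    M.subOpt H π
      = ∑ h ∈ Finset.range H, ∫ s, ∫ a, M.gap H h s a ∂(π.kernel h s) ∂(M.stateLaw π h) := by
  have key : ∀ n ≤ H, M.subOpt H π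
      = ∑ h ∈ Finset.range n, ∫ s, ∫ a, M.gap H h s a ∂(π.kernel h s) ∂(M.stateLaw π h)
        + ∫ s, (M.optV H n s - M.V H π n s) ∂(M.stateLaw π n) := by
    intro n hn
    induction n with
    | zero => simp [subOpt, initLaw, stateLaw, occ]
    | succ n ih =>
      rw [ih (by omega), M.integral_optV_sub_V hopt π (by omega), Finset.sum_range_succ]
      ring
  rw [key H le_rfl, M.optV_eq hopt le_rfl]
  simp [V_self]

/-- A policy that plays, at feasible states, only actions that `μ` plays reaches only states that
`μ` reaches. -/
theorem occ_pos_of_support_subset (M : MDP S A ρ) {H : ℕ} {π μ : Policy S A}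
    (hsub : ∀ h < H, ∀ s, M.Feasible h s → ∀ a, 0 < π.kernel h s {a} → 0 < μ.kernel h s {a})
    {h : ℕ} (hh : h < H) (s : S) (hs : 0 < M.occ π h s) : 0 < M.occ μ h s := by
  induction h generalizing s with
  | zero => exact hs
  | succ h ih =>
    rw [pos_iff_ne_zero] at hs ⊢
    contrapose! hs
    simp only [occ] at hs ⊢
    have hm : Measurable fun z : S × A => (M.p h z.1 z.2 s : ℝ≥0∞) * M.occ μ h z.1 :=
      ((M.measurable_p h).comp (measurable_prodMk_right (y := s))).mul
        ((M.measurable_occ μ h).comp measurable_fst)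
    rw [lintegral_eq_zero_iff (Measurable.lintegral_kernel_prod_right' hm)] at hs
    rw [← lintegral_zero (α := S) (μ := ρ)]
    refine lintegral_congr_ae ?_
    filter_upwards [hs] with s₀ hs₀
    by_cases h0 : M.occ π h s₀ = 0
    · simp [h0]
    -- If `μ` cannot reach `s` in the next step, then from almost every state reached by `π` no
    -- action of `μ` leads to `s`; the actions of `π` are among them.
    have hpos : 0 < M.occ π h s₀ := pos_iff_ne_zero.2 h0
    have hμ := ih (by omega) s₀ hpos
    have hms : Measurable fun a => (M.p h s₀ a s : ℝ≥0∞) * M.occ μ h s₀ := by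
      have := hm.comp (measurable_prodMk_left (x := s₀))
      simpa only [Function.comp_def] using this
    have hz : ∀ᵐ a ∂(μ.kernel h s₀), (M.p h s₀ a s : ℝ≥0∞) * M.occ μ h s₀ = 0 := by
      have := (lintegral_eq_zero_iff hms).1 hs₀
      exact this
    have hz' : ∀ᵐ a ∂(π.kernel h s₀), (M.p h s₀ a s : ℝ≥0∞) * M.occ π h s₀ = 0 := by
      -- The two action distributions need not be absolutely continuous a priori; discreteness lets
      -- null sets be compared atom by atom.
      refine ae_of_forall_atoms (π.discrete h s₀) fun a ha => ?_
      have h1 := forall_atoms_of_ae hz a (hsub h (by omega) s₀ ⟨π, hpos⟩ a ha)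
      rcases mul_eq_zero.1 h1 with h1 | h1
      · simp [h1]
      · exact absurd h1 hμ.ne'
    rw [lintegral_congr_ae hz']
    simp

theorem lintegral_law_eq (M : MDP S A ρ) (π : Policy S A) (h : ℕ) {f : S × A → ℝ≥0∞}
    (hf : Measurable f) :
    ∫⁻ x, f x ∂(M.law π h) = ∫⁻ s, ∑' a, f (s, a) * M.occSA π h s a ∂ρ := by
  rw [law, Measure.lintegral_compProd hf,
    M.lintegral_stateLaw π h (Measurable.lintegral_kernel_prod_right' hf)]
  refine lintegral_congr fun s => ?_
  rw [lintegral_eq_tsum_atoms (π.discrete h s), ← ENNReal.tsum_mul_left]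
  exact tsum_congr fun a => by rw [occSA]; ring

/-- Policies being discrete, `occSA` acts as the density of the state-action law for `ρ` times
counting, so a pointwise comparison passes to the measures. -/
theorem law_le_of_occSA_le (M : MDP S A ρ) {π μ : Policy S A} {h : ℕ} {c : ℝ≥0∞}
    (hc : ∀ s a, M.occSA π h s a ≤ c * M.occSA μ h s a) : M.law π h ≤ c • M.law μ h := by
  refine Measure.le_iff.2 fun B hB => ?_
  have hf : Measurable (B.indicator (1 : S × A → ℝ≥0∞)) := measurable_one.indicator hB
  have h1 := M.lintegral_law_eq π h hf
  have h2 : ∫⁻ x, B.indicator 1 x ∂(c • M.law μ h)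
      = ∫⁻ s, ∑' a, (c * B.indicator 1 (s, a)) * M.occSA μ h s a ∂ρ := by
    rw [lintegral_smul_measure, smul_eq_mul, ← lintegral_const_mul _ hf,
      M.lintegral_law_eq μ h (hf.const_mul c)]
  rw [lintegral_indicator_one hB] at h1 h2
  rw [h1, h2]
  refine lintegral_mono fun s => ENNReal.tsum_le_tsum fun a => ?_
  calc _ ≤ B.indicator 1 (s, a) * (c * M.occSA μ h s a) := by gcongr; exact hc s a
    _ = _ := by ring

theorem integral_law_le (M : MDP S A ρ) {π μ : Policy S A} {h : ℕ} {c : ℝ} (hc0 : 0 ≤ c)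
    (hc : ∀ s a, M.occSA π h s a ≤ ENNReal.ofReal c * M.occSA μ h s a) {f : S × A → ℝ}
    (hf : Measurable f) (hf0 : ∀ x, 0 ≤ f x) (C : ℝ) (hC : ∀ x, f x ≤ C) :
    ∫ x, f x ∂(M.law π h) ≤ c * ∫ x, f x ∂(M.law μ h) := by
  have h1 := M.law_le_of_occSA_le hc
  have h2 : Integrable f (M.law μ h) := integrable_of_abs_le hf C fun x => by
    rw [abs_of_nonneg (hf0 x)]; exact hC x
  have h3 := integral_mono_measure h1 (Filter.Eventually.of_forall hf0)
    (h2.smul_measure ENNReal.ofReal_ne_top)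
  rwa [integral_smul_measure, ENNReal.toReal_ofReal hc0, smul_eq_mul] at h3

end MDP

/-- A random density with values proportional to `1 + f` increases the mean of a nonnegative
function `f` strictly, unless `f` is almost surely constant. -/
theorem ae_eq_integral_of_tilt_le {A : Type*} [MeasurableSpace A] {m : Measure A}
    [IsProbabilityMeasure m] {f : A → ℝ} {c : ℝ} (hf : Measurable f)
    (h0 : ∀ a, f a ∈ Set.Icc 0 c)
    (hle : ∫ a, (1 + f a) / (1 + ∫ b, f b ∂m) * f a ∂m ≤ ∫ a, f a ∂m) :
    ∀ᵐ a ∂m, f a = ∫ b, f b ∂m := by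
  set w := ∫ b, f b ∂m with hw
  have hw0 : 0 ≤ w := integral_nonneg fun a => (h0 a).1
  have hb : ∀ a, |f a| ≤ c := fun a => by rw [abs_of_nonneg (h0 a).1]; exact (h0 a).2
  have i1 : Integrable f m := integrable_of_abs_le hf c hb
  have i2 : Integrable (fun a => f a ^ 2) m :=
    integrable_of_abs_le (hf.pow_const 2) (c ^ 2) fun a => by
      rw [abs_pow]; exact pow_le_pow_left₀ (abs_nonneg _) (hb a) 2
  have e1 : ∫ a, (1 + f a) / (1 + w) * f a ∂m = (w + ∫ a, f a ^ 2 ∂m) / (1 + w) := by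
    have : ∀ a, (1 + f a) / (1 + w) * f a = (f a + f a ^ 2) / (1 + w) := fun a => by ring
    simp_rw [this]
    rw [integral_div, integral_add i1 i2]
  -- The hypothesis now reads `w + E f² ≤ w (1 + w)`: the variance of `f` is nonpositive.
  rw [e1, div_le_iff₀ (by linarith)] at hle
  have i3 : Integrable (fun a => (2 * w) * f a) m := i1.const_mul _
  have i4 : Integrable (fun a => f a ^ 2 - (2 * w) * f a) m := i2.sub i3
  have e2 : ∫ a, (f a - w) ^ 2 ∂m = ∫ a, f a ^ 2 ∂m - w ^ 2 := by
    have : ∀ a, (f a - w) ^ 2 = f a ^ 2 - (2 * w) * f a + w ^ 2 := fun a => by ring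
    simp_rw [this]
    rw [integral_add i4 (integrable_const _), integral_sub i2 i3, integral_const_mul, ← hw]
    simp
    ring
  have e3 : ∫ a, (f a - w) ^ 2 ∂m = 0 :=
    le_antisymm (by rw [e2]; nlinarith) (integral_nonneg fun a => sq_nonneg _)
  have i5 : Integrable (fun a => (f a - w) ^ 2) m := by
    have : (fun a => (f a - w) ^ 2) = fun a => f a ^ 2 - (2 * w) * f a + w ^ 2 := by
      ext a; ring
    rw [this]
    exact i4.add (integrable_const _)
  rw [integral_eq_zero_iff_of_nonneg (fun a => sq_nonneg _) i5] at e3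
  filter_upwards [e3] with a ha
  have : (f a - w) ^ 2 = 0 := ha
  nlinarith [pow_eq_zero_iff (two_ne_zero) |>.1 this]

/-! ### Pessimistic greedy estimates and the quadratic gap bound -/

namespace MDP

variable {S A : Type*} [MeasurableSpace S] [MeasurableSpace A] {ρ : Measure S}

/-- `π` is greedy, within the supported policies, for action-value estimates `Q` that lie below the
Bellman backup of the state values `W h s = ⟨Q_h(s, ·), π_h(· | s)⟩`, by at most `b`. -/
structure IsPessimistic (M : MDP S A ρ) (H : ℕ) (supp : ℕ → S → Set A) (π : Policy S A)
    (Q : ℕ → S → A → ℝ) (W : ℕ → S → ℝ) (b : ℕ → S → A → ℝ) : Prop where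
  Q_meas : ∀ h < H, Measurable fun x : S × A => Q h x.1 x.2
  Q_mem : ∀ h < H, ∀ s a, Q h s a ∈ Set.Icc (0 : ℝ) (H - h)
  W_eq : ∀ h < H, ∀ s, W h s = ∫ a, Q h s a ∂(π.kernel h s)
  W_top : ∀ s, W H s = 0
  supported : ∀ h < H, M.Supported supp h π
  greedy : ∀ h < H, ∀ π' : Policy S A, M.Supported supp h π' → ∀ s, M.Feasible h s →
    ∫ a, Q h s a ∂(π'.kernel h s) ≤ W h s
  le_bellman : ∀ h < H, ∀ s a, Q h s a ≤ M.bellman h (W (h + 1)) s a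
  bellman_le : ∀ h < H, ∀ s a, M.bellman h (W (h + 1)) s a ≤ Q h s a + b h s a
  b_meas : ∀ h < H, Measurable fun x : S × A => b h x.1 x.2
  b_bdd : ∃ c, ∀ h < H, ∀ s a, |b h s a| ≤ c

namespace IsPessimistic

variable {M : MDP S A ρ} {H : ℕ} {supp : ℕ → S → Set A} {π : Policy S A}
  {Q : ℕ → S → A → ℝ} {W : ℕ → S → ℝ} {b : ℕ → S → A → ℝ}

theorem W_meas (E : M.IsPessimistic H supp π Q W b) {h : ℕ} (hh : h ≤ H) : Measurable (W h) := by
  rcases hh.lt_or_eq with hh | rfl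
  · rw [funext (E.W_eq h hh)]
    exact measurable_integral_policy π h (E.Q_meas h hh)
  · rw [funext E.W_top]
    exact measurable_const

theorem W_mem (E : M.IsPessimistic H supp π Q W b) {h : ℕ} (hh : h ≤ H) (s : S) :
    W h s ∈ Set.Icc (0 : ℝ) (H - h) := by
  rcases hh.lt_or_eq with hh | rfl
  · rw [E.W_eq h hh]
    exact integral_mem_Icc ((E.Q_meas h hh).comp (measurable_prodMk_left (x := s)))
      fun a => E.Q_mem h hh s a
  · simp [E.W_top]

theorem abs_W_le (E : M.IsPessimistic H supp π Q W b) {h : ℕ} (hh : h ≤ H) (s : S) :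
    |W h s| ≤ H := by
  have := E.W_mem hh s
  rw [abs_of_nonneg this.1]
  exact this.2.trans (by simp)

variable [SigmaFinite ρ]

/-- Backward induction: `Q_h` is below the backup of `W_{h+1}`, which by monotonicity is below that
of `V^π_{h+1}`; averaging over the actions of `π` preserves this. -/
theorem W_le_V (E : M.IsPessimistic H supp π Q W b) {h : ℕ} (hh : h ≤ H) (s : S) :
    W h s ≤ M.V H π h s := by
  induction hh using Nat.decreasingInduction generalizing s with
  | self => rw [E.W_top, V_self]
  | of_succ h hh ih =>
    have hh' : h < H := hh
    rw [E.W_eq h hh', M.V_eq hh']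
    have mb : Measurable fun x : S × A => M.bellman h (M.V H π (h + 1)) x.1 x.2 :=
      M.measurable_bellman h (M.measurable_V H π (h + 1))
    refine integral_mono
      (integrable_of_abs_le ((E.Q_meas h hh').comp (measurable_prodMk_left (x := s))) H
        fun a => ?_)
      (integrable_of_abs_le (mb.comp (measurable_prodMk_left (x := s))) (H - (h + 1 : ℕ) + 1)
        fun a => ?_) fun a => ?_
    · have := E.Q_mem h hh' s a
      exact (abs_of_nonneg this.1).le.trans (this.2.trans (by simp))
    · have := M.bellman_mem h (M.measurable_V H π (h + 1)) (M.V_mem hh' π) s a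
      exact (abs_of_nonneg this.1).le.trans this.2
    · exact (E.le_bellman h hh' s a).trans (M.bellman_mono h (E.W_meas hh')
        (M.measurable_V H π (h + 1)) H (E.abs_W_le hh') (M.abs_V_le hh' π) ih s a)

theorem error_mem (E : M.IsPessimistic H supp π Q W b) {πopt : Policy S A}
    (hopt : M.IsOptimal H πopt) {h : ℕ} (hh : h ≤ H) (s : S) :
    M.optV H h s - W h s ∈ Set.Icc (0 : ℝ) H := by
  have h1 := E.W_le_V hh s
  have h2 := M.V_le_optV hh π s
  have h3 := E.W_mem hh s
  have h4 := M.V_mem hh πopt s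
  rw [← M.optV_eq hopt hh] at h4
  have h5 : (0 : ℝ) ≤ h := by positivity
  constructor <;> linarith [h3.1, h4.2]

theorem error_meas (E : M.IsPessimistic H supp π Q W b) {πopt : Policy S A}
    (hopt : M.IsOptimal H πopt) {h : ℕ} (hh : h ≤ H) :
    Measurable fun s => M.optV H h s - W h s := by
  rw [M.optV_eq hopt hh]
  exact (M.measurable_V H πopt h).sub (E.W_meas hh)

theorem integral_error (E : M.IsPessimistic H supp π Q W b) {πopt : Policy S A}
    (hopt : M.IsOptimal H πopt) {h : ℕ} (hh : h < H) (s : S) (a : A) :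
    ∫ s', (M.optV H (h + 1) s' - W (h + 1) s') ∂(M.next h s a)
      = M.bellman h (M.optV H (h + 1)) s a - M.bellman h (W (h + 1)) s a := by
  have h1 : Integrable (M.optV H (h + 1)) (M.next h s a) := by
    rw [M.optV_eq hopt hh]
    exact integrable_of_abs_le (M.measurable_V H πopt _) H (M.abs_V_le hh πopt)
  have h2 : Integrable (W (h + 1)) (M.next h s a) :=
    integrable_of_abs_le (E.W_meas hh) H (E.abs_W_le hh)
  rw [integral_sub h1 h2]
  unfold bellman
  ring

/-- One step of the recursion for the error of the value estimate. -/
theorem error_le (E : M.IsPessimistic H supp π Q W b) {πopt : Policy S A}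
    (hopt : M.IsOptimal H πopt) {h : ℕ} (hh : h < H) (hos : M.Supported supp h πopt) (s : S)
    (hs : M.Feasible h s) :
    M.optV H h s - W h s
      ≤ ∫ a, (∫ s', (M.optV H (h + 1) s' - W (h + 1) s') ∂(M.next h s a) + b h s a)
          ∂(πopt.kernel h s) := by
  obtain ⟨c, hc⟩ := E.b_bdd
  have h1 := E.greedy h hh πopt hos s hs
  have hp : Measurable fun a : A => (s, a) := measurable_prodMk_left
  have m1 : Measurable fun a => M.bellman h (M.optV H (h + 1)) s a := by
    rw [M.optV_eq hopt hh]
    exact (M.measurable_bellman h (M.measurable_V H πopt (h + 1))).comp hp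
  have m2 : Measurable fun a => Q h s a := (E.Q_meas h hh).comp hp
  have i1 : Integrable (fun a => M.bellman h (M.optV H (h + 1)) s a) (πopt.kernel h s) := by
    refine integrable_of_abs_le m1 (H - (h + 1 : ℕ) + 1) fun a => ?_
    have := M.bellman_mem h (M.measurable_V H πopt (h + 1)) (M.V_mem hh πopt) s a
    rw [← M.optV_eq hopt hh] at this
    rw [abs_of_nonneg this.1]
    exact this.2
  have i2 : Integrable (fun a => Q h s a) (πopt.kernel h s) :=
    integrable_of_abs_le m2 (H - h) fun a => by
      have := E.Q_mem h hh s a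
      rw [abs_of_nonneg this.1]
      exact this.2
  have h2 : M.optV H h s = ∫ a, M.bellman h (M.optV H (h + 1)) s a ∂(πopt.kernel h s) := by
    rw [M.optV_eq hopt hh, M.optV_eq hopt hh.le, M.V_eq hh]
  have h3 : M.optV H h s - W h s
      ≤ ∫ a, (M.bellman h (M.optV H (h + 1)) s a - Q h s a) ∂(πopt.kernel h s) := by
    rw [integral_sub i1 i2, ← h2]
    linarith
  refine h3.trans (integral_mono (i1.sub i2) ?_ fun a => ?_)
  · have me : Measurable fun a =>
        ∫ s', (M.optV H (h + 1) s' - W (h + 1) s') ∂(M.next h s a) := by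
      have := (M.measurable_integral_next h (E.error_meas hopt hh)).comp hp
      simpa only [Function.comp_def] using this
    have mb : Measurable fun a => b h s a := (E.b_meas h hh).comp hp
    refine integrable_of_abs_le (me.add mb) (H + c) fun a => ?_
    refine (abs_add_le _ _).trans (add_le_add (abs_integral_le_of_abs_le fun s' => ?_)
      (hc h hh s a))
    have := E.error_mem hopt hh s'
    rw [abs_of_nonneg this.1]
    exact this.2
  · have := E.bellman_le h hh s a
    beta_reduce
    rw [E.integral_error hopt hh]
    linarith

variable [MeasurableSingletonClass A]

/-- The estimated optimal actions all have the same estimated value. -/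
theorem ae_Q_eq (E : M.IsPessimistic H supp π Q W b) {h : ℕ} (hh : h < H) (s : S)
    (hs : M.Feasible h s) : ∀ᵐ a ∂(π.kernel h s), Q h s a = W h s := by
  have mQ := E.Q_meas h hh
  have mW := E.W_meas hh.le
  -- Comparison with a pointwise maximizer would need a measurable selection. Instead the policy is
  -- reweighted by a density proportional to `1 + Q`: this is a Markov kernel with support inside
  -- that of `π`, and it has a larger mean of `Q` unless `Q` is constant on the played actions. The
  -- `1` keeps the normalization positive when `W` vanishes.
  let f : S → A → ℝ≥0∞ := fun s a => ENNReal.ofReal ((1 + Q h s a) / (1 + W h s))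
  have hf : Measurable (Function.uncurry f) :=
    ((mQ.const_add 1).div ((mW.comp measurable_fst).const_add 1)).ennreal_ofReal
  have hfs : ∀ s, Measurable (f s) := fun s => hf.comp (measurable_prodMk_left (x := s))
  have hpos : ∀ s a, 0 ≤ (1 + Q h s a) / (1 + W h s) := fun s a =>
    div_nonneg (by linarith [(E.Q_mem h hh s a).1]) (by linarith [(E.W_mem hh.le s).1])
  have hmQ : ∀ s, Measurable (Q h s) := fun s => mQ.comp (measurable_prodMk_left (x := s))
  have hiQ : ∀ s, Integrable (Q h s) (π.kernel h s) := fun s =>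
    integrable_of_abs_le (hmQ s) (H - h) fun a => by
      have := E.Q_mem h hh s a
      rw [abs_of_nonneg this.1]
      exact this.2
  have hmass : ∀ s, ∫⁻ a, f s a ∂(π.kernel h s) = 1 := fun s => by
    have hi : Integrable (fun a => (1 + Q h s a) / (1 + W h s)) (π.kernel h s) :=
      ((integrable_const 1).add (hiQ s)).div_const _
    rw [← ofReal_integral_eq_lintegral_ofReal hi
      (Filter.Eventually.of_forall fun a => hpos s a)]
    rw [integral_div, integral_add (integrable_const 1) (hiQ s), ← E.W_eq h hh]
    have : 1 + W h s ≠ 0 := by linarith [(E.W_mem hh.le s).1]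
    simp [this]
  let η : Kernel S A := Kernel.withDensity (π.kernel h) f
  have hη : ∀ s, η s = (π.kernel h s).withDensity (f s) := fun s =>
    Kernel.withDensity_apply _ hf s
  have hηm : IsMarkovKernel η := ⟨fun s => ⟨by
    rw [hη, withDensity_apply _ MeasurableSet.univ, Measure.restrict_univ, hmass]⟩⟩
  have hηa : ∀ s a, η s {a} = f s a * π.kernel h s {a} := fun s a => by
    rw [hη, withDensity_apply _ (measurableSet_singleton a), lintegral_singleton]
  have hηd : ∀ s, ∑' a, η s {a} = 1 := fun s => by
    simp_rw [hηa]
    rw [← lintegral_eq_tsum_atoms (π.discrete h s), hmass]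
  let π' := π.update h η hηm hηd
  have hk : π'.kernel h = η := if_pos rfl
  have hsup : M.Supported supp h π' := fun s hs a ha => by
    refine E.supported h hh s hs ?_
    have ha' : 0 < π'.kernel h s {a} := ha
    rw [hk, hηa] at ha'
    exact pos_of_mul_pos_right ha' zero_le
  have key := E.greedy h hh π' hsup s hs
  rw [hk, hη, integral_withDensity_eq_integral_toReal_smul (hfs s)
    (Filter.Eventually.of_forall fun a => ENNReal.ofReal_lt_top)] at key
  have e : ∀ a, (f s a).toReal • Q h s a = (1 + Q h s a) / (1 + W h s) * Q h s a := fun a => by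
    rw [ENNReal.toReal_ofReal (hpos s a), smul_eq_mul]
  simp_rw [e] at key
  have hW := E.W_eq h hh s
  rw [hW] at key ⊢
  exact ae_eq_integral_of_tilt_le (hmQ s) (E.Q_mem h hh s) key

/-- Almost every played action has `Q = W`, and `Q ≤ T W ≤ T V* = Q*`; so its gap is at most the
error `V* - W`, to which the minimal gap argument applies. -/
theorem integral_gap_le (E : M.IsPessimistic H supp π Q W b) {πopt : Policy S A}
    (hopt : M.IsOptimal H πopt) (hg : 0 < M.minGap H) {h : ℕ} (hh : h < H) (s : S)
    (hs : M.Feasible h s) :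
    ∫ a, M.gap H h s a ∂(π.kernel h s) ≤ (M.optV H h s - W h s) ^ 2 / M.minGap H := by
  have h1 : ∀ᵐ a ∂(π.kernel h s),
      M.gap H h s a ≤ (M.optV H h s - W h s) ^ 2 / M.minGap H := by
    filter_upwards [E.ae_Q_eq hh s hs] with a ha
    refine M.gap_le_sq_div hopt hg hh s a ?_
    have h2 := E.le_bellman h hh s a
    have h3 : M.bellman h (W (h + 1)) s a ≤ M.bellman h (M.optV H (h + 1)) s a := by
      rw [M.optV_eq hopt hh]
      refine M.bellman_mono h (E.W_meas hh) (M.measurable_V H πopt _) H (E.abs_W_le hh)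
        (M.abs_V_le hh πopt) (fun s' => ?_) s a
      rw [← M.optV_eq hopt hh]
      linarith [(E.error_mem hopt hh s').1]
    unfold gap
    rw [optQ_eq]
    linarith
  have h2 := integral_mono_ae
    (integrable_of_abs_le ((M.measurable_gap hopt hh).comp (measurable_prodMk_left (x := s))) H
      fun a => M.abs_gap_le hopt hh s a) (integrable_const _) h1
  simpa using h2

/-- Accumulated error, along a policy that is optimal from step `n` on. -/
theorem integral_sq_error_le (E : M.IsPessimistic H supp π Q W b) {πopt : Policy S A}
    (hopt : M.IsOptimal H πopt) (hos : ∀ h < H, M.Supported supp h πopt) {σ : Policy S A} {n : ℕ}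
    (hσ : ∀ j, n ≤ j → σ.kernel j = πopt.kernel j) {h : ℕ} (hh : h ≤ H) (hn : n ≤ h) :
    ∫ s, (M.optV H h s - W h s) ^ 2 ∂(M.stateLaw σ h)
      ≤ (H - h + 1) * ∑ j ∈ Finset.Ico h H, ∫ x, b j x.1 x.2 ^ 2 ∂(M.law σ j) := by
  obtain ⟨c, hc⟩ := E.b_bdd
  induction hh using Nat.decreasingInduction with
  | self =>
    rw [M.optV_eq hopt le_rfl]
    simp [V_self, E.W_top]
  | of_succ h hh ih =>
    have hh : h < H := hh
    have ih := ih (by omega)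
    set e : S → ℝ := fun s => M.optV H (h + 1) s - W (h + 1) s with he
    have me : Measurable e := E.error_meas hopt hh
    have be : ∀ s, |e s| ≤ H := fun s => by
      have := E.error_mem hopt hh s
      rw [abs_of_nonneg this.1]
      exact this.2
    have me0 := E.error_meas hopt hh.le
    have mn := M.measurable_integral_next h me
    have bn : ∀ s a, |∫ s', e s' ∂(M.next h s a)| ≤ H := fun s a => abs_integral_le_of_abs_le be
    have mb := E.b_meas h hh
    have m1 : Measurable fun x : S × A => ∫ s', e s' ∂(M.next h x.1 x.2) + b h x.1 x.2 :=
      mn.add mb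
    have b1 : ∀ x : S × A, |∫ s', e s' ∂(M.next h x.1 x.2) + b h x.1 x.2| ≤ H + c := fun x =>
      (abs_add_le _ _).trans (add_le_add (bn _ _) (hc h hh _ _))
    have bsq : ∀ {x y : ℝ}, |x| ≤ y → |x ^ 2| ≤ y ^ 2 := fun h => by
      rw [abs_pow]; exact pow_le_pow_left₀ (abs_nonneg _) h 2
    have m1s := m1.pow_const 2
    have b1s : ∀ x : S × A, |(∫ s', e s' ∂(M.next h x.1 x.2) + b h x.1 x.2) ^ 2| ≤ (H + c) ^ 2 :=
      fun x => bsq (b1 x)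
    have step1 : ∫ s, (M.optV H h s - W h s) ^ 2 ∂(M.stateLaw σ h)
        ≤ ∫ x, (∫ s', e s' ∂(M.next h x.1 x.2) + b h x.1 x.2) ^ 2 ∂(M.law σ h) := by
      rw [M.integral_law σ h m1s _ b1s]
      refine integral_mono_ae
        (integrable_of_abs_le (me0.pow_const 2) ((H : ℝ) ^ 2) fun s => bsq ?_)
        (integrable_of_abs_le (measurable_integral_policy σ h m1s) ((H + c) ^ 2)
          fun s => abs_integral_le_of_abs_le fun a => b1s (s, a)) ?_
      · have := E.error_mem hopt hh.le s
        rw [abs_of_nonneg this.1]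
        exact this.2
      · filter_upwards [M.ae_stateLaw_occ_pos σ h] with s hs
        have h1 := E.error_le hopt hh (hos h hh) s ⟨σ, hs⟩
        have h2 := (E.error_mem hopt hh.le s).1
        rw [hσ h hn]
        refine (pow_le_pow_left₀ h2 h1 2).trans ?_
        have m1s : Measurable fun a => ∫ s', e s' ∂(M.next h s a) + b h s a := by
          have hp : Measurable fun a : A => (s, a) := measurable_prodMk_left
          have := m1.comp hp
          simpa only [Function.comp_def] using this
        exact sq_integral_le m1s fun a => b1 (s, a)
    have hmn : (0 : ℝ) < H - (h + 1 : ℕ) + 1 := by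
      have : ((h + 1 : ℕ) : ℝ) ≤ H := by exact_mod_cast hh
      linarith
    -- `m = H - h` is the factor in the induction hypothesis. The weights `1 + 1/m` and `1 + m`
    -- satisfy `(1 + 1/m) m = 1 + m`, so the factor grows by exactly one per step instead of
    -- doubling.
    set m : ℝ := H - (h + 1 : ℕ) + 1 with hm
    have mes := M.measurable_integral_next h (me.pow_const 2)
    have mes' : Measurable fun s => e s ^ 2 := me.pow_const 2
    have bes : ∀ x : S × A, |∫ s', e s' ^ 2 ∂(M.next h x.1 x.2)| ≤ (H : ℝ) ^ 2 := fun x =>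
      abs_integral_le_of_abs_le fun s' => bsq (be s')
    have i1 : Integrable (fun x : S × A => (1 + 1 / m) * ∫ s', e s' ^ 2 ∂(M.next h x.1 x.2))
        (M.law σ h) := (integrable_of_abs_le mes _ bes).const_mul _
    have i2 : Integrable (fun x : S × A => (1 + m) * b h x.1 x.2 ^ 2) (M.law σ h) :=
      (integrable_of_abs_le (mb.pow_const 2) (c ^ 2) fun x => bsq (hc h hh _ _)).const_mul _
    have step2 : ∫ x, (∫ s', e s' ∂(M.next h x.1 x.2) + b h x.1 x.2) ^ 2 ∂(M.law σ h)
        ≤ (1 + 1 / m) * ∫ s, e s ^ 2 ∂(M.stateLaw σ (h + 1))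
          + (1 + m) * ∫ x, b h x.1 x.2 ^ 2 ∂(M.law σ h) := by
      rw [M.integral_stateLaw_succ σ h mes' ((H : ℝ) ^ 2) fun s => bsq (be s),
        ← integral_const_mul, ← integral_const_mul, ← integral_add i1 i2]
      refine integral_mono (integrable_of_abs_le m1s _ b1s) (i1.add i2) fun x => ?_
      have h1 := sq_integral_le (m := M.next h x.1 x.2) me be
      set u := ∫ s', e s' ∂(M.next h x.1 x.2)
      set v := b h x.1 x.2
      have h2 : (u + v) ^ 2 ≤ (1 + 1 / m) * u ^ 2 + (1 + m) * v ^ 2 := by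
        have : (1 + 1 / m) * u ^ 2 + (1 + m) * v ^ 2 - (u + v) ^ 2 = (u - m * v) ^ 2 / m := by
          field_simp
          ring
        have h3 : 0 ≤ (u - m * v) ^ 2 / m := by positivity
        linarith
      beta_reduce
      have h4 : (1 + 1 / m) * u ^ 2
          ≤ (1 + 1 / m) * ∫ s', e s' ^ 2 ∂(M.next h x.1 x.2) := by gcongr
      linarith
    refine step1.trans (step2.trans ?_)
    rw [Finset.sum_eq_sum_Ico_succ_bot hh]
    have hm2 : (H : ℝ) - h + 1 = 1 + m := by rw [hm]; push_cast; ring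
    rw [hm2, mul_add]
    have h5 : (1 + 1 / m) * ∫ s, e s ^ 2 ∂(M.stateLaw σ (h + 1))
        ≤ (1 + 1 / m) * (m * ∑ j ∈ Finset.Ico (h + 1) H, ∫ x, b j x.1 x.2 ^ 2 ∂(M.law σ j)) := by
      gcongr
    have h6 : (1 + 1 / m) * (m * ∑ j ∈ Finset.Ico (h + 1) H, ∫ x, b j x.1 x.2 ^ 2 ∂(M.law σ j))
        = (1 + m) * ∑ j ∈ Finset.Ico (h + 1) H, ∫ x, b j x.1 x.2 ^ 2 ∂(M.law σ j) := by
      field_simp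
      ring
    linarith

/-- The gaps of the actions of `π` at the states visited by a supported policy `π'`, bounded in
terms of the visitation probabilities of `μ`. -/
theorem sum_integral_gap_le (E : M.IsPessimistic H supp π Q W b) (hbd : M.BoundedDensity H)
    {πopt : Policy S A} (hopt : M.IsOptimal H πopt) (hos : ∀ h < H, M.Supported supp h πopt)
    (hg : 0 < M.minGap H) {μ : Policy S A}
    (hμ : ∀ h < H, ∀ s, M.Feasible h s → {a | 0 < μ.kernel h s {a}} = supp h s)
    {κ : ℕ → ℝ} (hκ0 : ∀ h < H, 0 < κ h)
    (hκ : ∀ h < H, ∀ s a, 0 < M.occSA μ h s a → ENNReal.ofReal (κ h)⁻¹ ≤ M.occSA μ h s a)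
    {π' : Policy S A} (hπ' : ∀ h < H, M.Supported supp h π') :
    ∑ h ∈ Finset.range H, ∫ s, ∫ a, M.gap H h s a ∂(π.kernel h s) ∂(M.stateLaw π' h)
      ≤ 2 * H ^ 2 / M.minGap H
        * ∑ j ∈ Finset.range H, κ j * ∫ x, b j x.1 x.2 ^ 2 ∂(M.law μ j) := by
  obtain ⟨c, hc⟩ := E.b_bdd
  -- Where a supported policy has positive density, so has `μ`, with density at least `1/κ_h`; the
  -- other density is at most one, so the ratio is at most `κ_h`.
  have hdom : ∀ σ : Policy S A, (∀ h < H, M.Supported supp h σ) → ∀ h < H, ∀ s a,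
      M.occSA σ h s a ≤ ENNReal.ofReal (κ h) * M.occSA μ h s a := by
    intro σ hσ h hh s a
    rcases (zero_le (a := M.occSA σ h s a)).eq_or_lt with h0 | h0
    · rw [← h0]; exact zero_le
    have h1 : 0 < M.occ σ h s := pos_of_mul_pos_left h0 zero_le
    have h2 : 0 < σ.kernel h s {a} := pos_of_mul_pos_right h0 zero_le
    have hsub : ∀ h < H, ∀ s, M.Feasible h s → ∀ a, 0 < σ.kernel h s {a} →
        0 < μ.kernel h s {a} := fun h hh s hs a ha => by
      have : a ∈ {a | 0 < μ.kernel h s {a}} := by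
        rw [hμ h hh s hs]
        exact hσ h hh s hs ha
      exact this
    have h3 := M.occ_pos_of_support_subset hsub hh s h1
    have h4 := hsub h hh s ⟨σ, h1⟩ a h2
    have h5 := hκ h hh s a (ENNReal.mul_pos h3.ne' h4.ne')
    calc M.occSA σ h s a ≤ 1 := hbd σ h hh s a
      _ = ENNReal.ofReal (κ h) * ENNReal.ofReal (κ h)⁻¹ := by
        rw [← ENNReal.ofReal_mul (hκ0 h hh).le, mul_inv_cancel₀ (hκ0 h hh).ne',
          ENNReal.ofReal_one]
      _ ≤ _ := by gcongr
  set B : ℝ := ∑ j ∈ Finset.range H, κ j * ∫ x, b j x.1 x.2 ^ 2 ∂(M.law μ j) with hB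
  have hB0 : ∀ j ∈ Finset.range H, 0 ≤ κ j * ∫ x, b j x.1 x.2 ^ 2 ∂(M.law μ j) := fun j hj =>
    mul_nonneg (hκ0 j (Finset.mem_range.1 hj)).le (integral_nonneg fun x => sq_nonneg _)
  have hBnn : 0 ≤ B := Finset.sum_nonneg hB0
  have hstep : ∀ h ∈ Finset.range H,
      ∫ s, ∫ a, M.gap H h s a ∂(π.kernel h s) ∂(M.stateLaw π' h)
        ≤ 2 * H / M.minGap H * B := by
    intro h hh
    have hh : h < H := Finset.mem_range.1 hh
    -- Visits the same states as `π'` at step `h` and is optimal from there on; being supported, it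
    -- is dominated by `μ` at every step.
    let σ := π'.splice πopt h
    have hσs : ∀ j < H, M.Supported supp j σ := fun j hj => by
      intro s hs
      rcases lt_or_ge j h with h1 | h1
      · rw [show σ.kernel j = π'.kernel j from π'.splice_of_lt πopt h1]
        exact hπ' j hj s hs
      · rw [show σ.kernel j = πopt.kernel j from π'.splice_of_le πopt h1]
        exact hos j hj s hs
    have hlaw : M.stateLaw π' h = M.stateLaw σ h := by
      unfold stateLaw
      rw [M.occ_congr h fun j hj => (π'.splice_of_lt πopt hj).symm]
    have h1 := E.integral_sq_error_le hopt hos (σ := σ) (n := h)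
      (fun j hj => π'.splice_of_le πopt hj) hh.le le_rfl
    have h2 : ∑ j ∈ Finset.Ico h H, ∫ x, b j x.1 x.2 ^ 2 ∂(M.law σ j) ≤ B := by
      refine (Finset.sum_le_sum fun j hj => ?_).trans
        (Finset.sum_le_sum_of_subset_of_nonneg ?_ fun j hj _ => hB0 j hj)
      · have hj : j < H := (Finset.mem_Ico.1 hj).2
        refine M.integral_law_le (hκ0 j hj).le (hdom σ hσs j hj) ((E.b_meas j hj).pow_const 2)
          (fun x => sq_nonneg _) (c ^ 2) fun x => ?_
        rw [← sq_abs]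
        exact pow_le_pow_left₀ (abs_nonneg _) (hc j hj x.1 x.2) 2
      · intro j hj
        exact Finset.mem_range.2 (Finset.mem_Ico.1 hj).2
    have h3 : ∫ s, ∫ a, M.gap H h s a ∂(π.kernel h s) ∂(M.stateLaw π' h)
        ≤ ∫ s, (M.optV H h s - W h s) ^ 2 / M.minGap H ∂(M.stateLaw σ h) := by
      rw [hlaw]
      have hi : Integrable (fun s => (M.optV H h s - W h s) ^ 2) (M.stateLaw σ h) :=
        integrable_of_abs_le ((E.error_meas hopt hh.le).pow_const 2) ((H : ℝ) ^ 2) fun s => by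
          have := E.error_mem hopt hh.le s
          rw [abs_pow, abs_of_nonneg this.1]
          exact pow_le_pow_left₀ this.1 this.2 2
      refine integral_mono_ae (integrable_of_abs_le
        (measurable_integral_policy π h (M.measurable_gap hopt hh)) H
        fun s => abs_integral_le_of_abs_le fun a => M.abs_gap_le hopt hh s a)
        (hi.div_const _) ?_
      filter_upwards [M.ae_stateLaw_occ_pos σ h] with s hs
      exact E.integral_gap_le hopt hg hh s ⟨σ, hs⟩
    rw [integral_div] at h3
    refine h3.trans ?_
    rw [div_mul_eq_mul_div]
    refine div_le_div_of_nonneg_right (h1.trans ?_) hg.le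
    -- The factor `H - h + 1` is bounded by `2H`; the sum over `h` supplies the second factor `H`.
    have h4 : (1 : ℝ) ≤ H := by exact_mod_cast (by omega : 1 ≤ H)
    have h5 : (0 : ℝ) ≤ h := by positivity
    have h6 : (h : ℝ) ≤ H := by exact_mod_cast hh.le
    exact mul_le_mul (by linarith) h2 (Finset.sum_nonneg fun j _ =>
      integral_nonneg fun x => sq_nonneg _) (by linarith)
  refine (Finset.sum_le_sum hstep).trans (le_of_eq ?_)
  simp
  ring

end IsPessimistic

end MDP

/-! ### Regularized Gram matrices, ridge regression and the elliptical potential -/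

section RegularizedGram

open Matrix

variable {d : ℕ}

theorem dotProduct_self_nonneg_real (x : Fin d → ℝ) : 0 ≤ x ⬝ᵥ x :=
  Finset.sum_nonneg fun _ _ => mul_self_nonneg _

theorem sq_dotProduct_le (x y : Fin d → ℝ) : (x ⬝ᵥ y) ^ 2 ≤ (x ⬝ᵥ x) * (y ⬝ᵥ y) := by
  have := Finset.sum_mul_sq_le_sq_mul_sq Finset.univ x y
  simpa [dotProduct, sq] using this

/-- `G` is symmetric and `G ≥ 1`. -/
structure Matrix.GeOne (G : Matrix (Fin d) (Fin d) ℝ) : Prop where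
  symm : Gᵀ = G
  ge : ∀ x : Fin d → ℝ, x ⬝ᵥ x ≤ x ⬝ᵥ G *ᵥ x

namespace Matrix.GeOne

variable {G : Matrix (Fin d) (Fin d) ℝ}

theorem posDef (hG : G.GeOne) : G.PosDef := by
  refine PosDef.of_dotProduct_mulVec_pos (by rw [IsHermitian, conjTranspose_eq_transpose_of_trivial,
    hG.symm]) fun x hx => ?_
  have h1 : 0 < x ⬝ᵥ x := by
    refine (dotProduct_self_nonneg_real x).lt_of_ne fun h => hx ?_
    exact dotProduct_self_eq_zero.1 h.symm
  simpa using h1.trans_le (hG.ge x)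

theorem isUnit_det (hG : G.GeOne) : IsUnit G.det := hG.posDef.det_pos.ne'.isUnit

theorem mulVec_inv (hG : G.GeOne) (x : Fin d → ℝ) : G *ᵥ (G⁻¹ *ᵥ x) = x := by
  rw [mulVec_mulVec, mul_nonsing_inv _ hG.isUnit_det, one_mulVec]

theorem inv_mulVec (hG : G.GeOne) (x : Fin d → ℝ) : G⁻¹ *ᵥ (G *ᵥ x) = x := by
  rw [mulVec_mulVec, nonsing_inv_mul _ hG.isUnit_det, one_mulVec]

theorem inv_symm (hG : G.GeOne) : (G⁻¹)ᵀ = G⁻¹ := by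
  rw [transpose_nonsing_inv, hG.symm]

theorem dot_comm (hG : G.GeOne) (x y : Fin d → ℝ) : x ⬝ᵥ G *ᵥ y = y ⬝ᵥ G *ᵥ x := by
  rw [dotProduct_mulVec, ← mulVec_transpose, hG.symm, dotProduct_comm]

theorem dot_inv_comm (hG : G.GeOne) (x y : Fin d → ℝ) : x ⬝ᵥ G⁻¹ *ᵥ y = y ⬝ᵥ G⁻¹ *ᵥ x := by
  rw [dotProduct_mulVec, ← mulVec_transpose, hG.inv_symm, dotProduct_comm]

theorem inv_quad_eq (hG : G.GeOne) (y : Fin d → ℝ) :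
    y ⬝ᵥ G⁻¹ *ᵥ y = (G⁻¹ *ᵥ y) ⬝ᵥ G *ᵥ (G⁻¹ *ᵥ y) := by
  rw [hG.mulVec_inv, dotProduct_comm]

theorem quad_nonneg (hG : G.GeOne) (x : Fin d → ℝ) : 0 ≤ x ⬝ᵥ G *ᵥ x :=
  (dotProduct_self_nonneg_real x).trans (hG.ge x)

theorem inv_quad_nonneg (hG : G.GeOne) (y : Fin d → ℝ) : 0 ≤ y ⬝ᵥ G⁻¹ *ᵥ y := by
  rw [hG.inv_quad_eq]
  exact hG.quad_nonneg _

theorem inv_mulVec_self_le (hG : G.GeOne) (y : Fin d → ℝ) :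
    (G⁻¹ *ᵥ y) ⬝ᵥ (G⁻¹ *ᵥ y) ≤ y ⬝ᵥ G⁻¹ *ᵥ y := by
  rw [hG.inv_quad_eq]
  exact hG.ge _

theorem inv_quad_le (hG : G.GeOne) (y : Fin d → ℝ) : y ⬝ᵥ G⁻¹ *ᵥ y ≤ y ⬝ᵥ y := by
  have h1 := hG.inv_mulVec_self_le y
  have h2 := sq_dotProduct_le y (G⁻¹ *ᵥ y)
  have h3 := hG.inv_quad_nonneg y
  have h4 := dotProduct_self_nonneg_real y
  -- With `q = ⟨y, G⁻¹ y⟩`, Cauchy–Schwarz gives `q² ≤ ‖y‖² ‖G⁻¹ y‖² ≤ ‖y‖² q`, which is impossible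
  -- if `q > ‖y‖²`.
  by_contra! h
  nlinarith

theorem inv_mulVec_le (hG : G.GeOne) (y : Fin d → ℝ) :
    (G⁻¹ *ᵥ y) ⬝ᵥ (G⁻¹ *ᵥ y) ≤ y ⬝ᵥ y :=
  (hG.inv_mulVec_self_le y).trans (hG.inv_quad_le y)

/-- The Cauchy–Schwarz inequality for the form of `G⁻¹`. -/
theorem sq_dot_inv_le (hG : G.GeOne) (x y : Fin d → ℝ) :
    (x ⬝ᵥ G⁻¹ *ᵥ y) ^ 2 ≤ (x ⬝ᵥ G⁻¹ *ᵥ x) * (y ⬝ᵥ G⁻¹ *ᵥ y) := by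
  set a := x ⬝ᵥ G⁻¹ *ᵥ x
  set b := x ⬝ᵥ G⁻¹ *ᵥ y
  set c := y ⬝ᵥ G⁻¹ *ᵥ y
  have key : ∀ t u : ℝ, 0 ≤ t ^ 2 * a - 2 * t * u * b + u ^ 2 * c := fun t u => by
    have h := hG.inv_quad_nonneg (t • x - u • y)
    have e : (t • x - u • y) ⬝ᵥ G⁻¹ *ᵥ (t • x - u • y)
        = t ^ 2 * a - 2 * t * u * b + u ^ 2 * c := by
      simp only [mulVec_sub, mulVec_smul, dotProduct_sub, sub_dotProduct, smul_dotProduct,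
        dotProduct_smul, smul_eq_mul]
      rw [hG.dot_inv_comm y x]
      simp only [a, b, c]
      ring
    rwa [e] at h
  have hc : 0 ≤ c := hG.inv_quad_nonneg y
  rcases hc.eq_or_lt with hc | hc
  · have hb : b = 0 := by
      by_contra hb
      -- For `c = 0` the form is affine in `u`; this `u` makes it equal to `-1` unless `b = 0`.
      have h1 := key 1 ((a + 1) / (2 * b))
      have h2 : 2 * 1 * ((a + 1) / (2 * b)) * b = a + 1 := by field_simp
      rw [h2, ← hc] at h1
      linarith
    rw [hb, ← hc]
    simp
  · have := key c b
    nlinarith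

theorem abs_dot_inv_le (hG : G.GeOne) (x y : Fin d → ℝ) :
    |x ⬝ᵥ G⁻¹ *ᵥ y| ≤ √(x ⬝ᵥ G⁻¹ *ᵥ x) * √(y ⬝ᵥ G⁻¹ *ᵥ y) := by
  rw [← Real.sqrt_mul (hG.inv_quad_nonneg x)]
  exact Real.abs_le_sqrt (hG.sq_dot_inv_le x y)

/-- A column of `G⁻¹` is the image of a unit vector under a contraction. It puts the inverse Gram
matrix in a bounded box when the estimates are discretized. -/
theorem abs_inv_apply_le (hG : G.GeOne) (i j : Fin d) : |G⁻¹ i j| ≤ 1 := by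
  have h1 := hG.inv_mulVec_le (Pi.single j 1)
  have h2 : G⁻¹ *ᵥ Pi.single j 1 = fun i => G⁻¹ i j := by
    ext i; simp
  rw [h2] at h1
  have h3 : (Pi.single j (1 : ℝ) : Fin d → ℝ) ⬝ᵥ Pi.single j 1 = 1 := by simp
  rw [h3] at h1
  have h4 : G⁻¹ i j * G⁻¹ i j ≤ (fun i => G⁻¹ i j) ⬝ᵥ (fun i => G⁻¹ i j) :=
    Finset.single_le_sum (f := fun i => G⁻¹ i j * G⁻¹ i j) (fun i _ => mul_self_nonneg _)
      (Finset.mem_univ i)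
  rw [← abs_one, ← sq_le_sq]
  nlinarith

/-- A lower bound for the concave function `x ↦ ⟨x, y⟩ - c ‖x‖²_G / 2` near its maximizer. -/
theorem quad_max_le (hG : G.GeOne) {c : ℝ} (hc : 0 < c) (x y : Fin d → ℝ) :
    y ⬝ᵥ G⁻¹ *ᵥ y / (2 * c)
      = x ⬝ᵥ y - c / 2 * (x ⬝ᵥ G *ᵥ x)
        + c / 2 * ((x - c⁻¹ • G⁻¹ *ᵥ y) ⬝ᵥ G *ᵥ (x - c⁻¹ • G⁻¹ *ᵥ y)) := by
  have e : (x - c⁻¹ • G⁻¹ *ᵥ y) ⬝ᵥ G *ᵥ (x - c⁻¹ • G⁻¹ *ᵥ y)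
      = x ⬝ᵥ G *ᵥ x - 2 * c⁻¹ * (x ⬝ᵥ y) + c⁻¹ ^ 2 * (y ⬝ᵥ G⁻¹ *ᵥ y) := by
    simp only [mulVec_sub, mulVec_smul, dotProduct_sub, sub_dotProduct, smul_dotProduct,
      dotProduct_smul, smul_eq_mul, hG.mulVec_inv]
    rw [hG.dot_comm (G⁻¹ *ᵥ y) x, hG.mulVec_inv, dotProduct_comm (G⁻¹ *ᵥ y) y]
    ring
  rw [e]
  field_simp
  ring

end Matrix.GeOne

/-- `∑_t v_t v_tᵀ + 1`. -/
theorem sum_vecMulVec_quad {ι : Type*} [Fintype ι] (v : ι → Fin d → ℝ) (x : Fin d → ℝ) :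
    x ⬝ᵥ (∑ t, vecMulVec (v t) (v t) + 1) *ᵥ x = ∑ t, (x ⬝ᵥ v t) ^ 2 + x ⬝ᵥ x := by
  rw [add_mulVec, one_mulVec, dotProduct_add, sum_mulVec, dotProduct_sum]
  congr 1
  refine Finset.sum_congr rfl fun t _ => ?_
  rw [vecMulVec_mulVec, op_smul_eq_smul, dotProduct_smul, smul_eq_mul, dotProduct_comm (v t) x, sq]

theorem sum_vecMulVec_mulVec {ι : Type*} [Fintype ι] (v : ι → Fin d → ℝ) (x : Fin d → ℝ) :
    (∑ t, vecMulVec (v t) (v t) + 1) *ᵥ x = ∑ t, (v t ⬝ᵥ x) • v t + x := by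
  rw [add_mulVec, one_mulVec, sum_mulVec]
  congr 1
  refine Finset.sum_congr rfl fun t _ => ?_
  rw [vecMulVec_mulVec, op_smul_eq_smul]

theorem geOne_sum_vecMulVec {ι : Type*} [Fintype ι] (v : ι → Fin d → ℝ) :
    (∑ t, vecMulVec (v t) (v t) + 1 : Matrix (Fin d) (Fin d) ℝ).GeOne where
  symm := by
    rw [transpose_add, transpose_one, transpose_sum]
    simp [transpose_vecMulVec]
  ge x := by
    rw [sum_vecMulVec_quad]
    have : 0 ≤ ∑ t, (x ⬝ᵥ v t) ^ 2 := Finset.sum_nonneg fun t _ => sq_nonneg _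
    linarith

theorem sum_vecMulVec_quad_le {ι : Type*} [Fintype ι] {v : ι → Fin d → ℝ}
    (hv : ∀ t, v t ⬝ᵥ v t ≤ 1) (x : Fin d → ℝ) :
    x ⬝ᵥ (∑ t, vecMulVec (v t) (v t) + 1) *ᵥ x ≤ (Fintype.card ι + 1) * (x ⬝ᵥ x) := by
  rw [sum_vecMulVec_quad, add_mul, one_mul]
  gcongr
  calc ∑ t, (x ⬝ᵥ v t) ^ 2 ≤ ∑ _t : ι, x ⬝ᵥ x := Finset.sum_le_sum fun t _ => by
        have := sq_dotProduct_le x (v t)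
        have h0 := dotProduct_self_nonneg_real x
        nlinarith [hv t]
    _ = _ := by simp

/-- The error of ridge regression. -/
theorem abs_ridge_sub_le {ι : Type*} [Fintype ι] (v : ι → Fin d → ℝ) (y : ι → ℝ)
    (w φ : Fin d → ℝ) {G : Matrix (Fin d) (Fin d) ℝ} (hG : G = ∑ t, vecMulVec (v t) (v t) + 1)
    {S : Fin d → ℝ} (hS : S = ∑ t, (y t - v t ⬝ᵥ w) • v t) :
    |φ ⬝ᵥ G⁻¹ *ᵥ (∑ t, y t • v t) - φ ⬝ᵥ w|
      ≤ √(φ ⬝ᵥ G⁻¹ *ᵥ φ) * (√(S ⬝ᵥ G⁻¹ *ᵥ S) + √(w ⬝ᵥ w)) := by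
  have hg : G.GeOne := hG ▸ geOne_sum_vecMulVec v
  -- The regression sum equals noise plus `G w`, minus the regularization bias `w`.
  have h1 : ∑ t, y t • v t = S + G *ᵥ w - w := by
    rw [hS, hG, sum_vecMulVec_mulVec]
    simp only [sub_smul, Finset.sum_sub_distrib]
    abel
  have h2 : φ ⬝ᵥ G⁻¹ *ᵥ (∑ t, y t • v t) - φ ⬝ᵥ w = φ ⬝ᵥ G⁻¹ *ᵥ S - φ ⬝ᵥ G⁻¹ *ᵥ w := by
    rw [h1, mulVec_sub, mulVec_add, hg.inv_mulVec, dotProduct_sub, dotProduct_add]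
    ring
  rw [h2, mul_add]
  refine (abs_sub _ _).trans (add_le_add (hg.abs_dot_inv_le φ S)
    ((hg.abs_dot_inv_le φ w).trans ?_))
  exact mul_le_mul_of_nonneg_left (Real.sqrt_le_sqrt (hg.inv_quad_le w)) (Real.sqrt_nonneg _)

/-- The matrix determinant lemma: adding a feature multiplies the determinant by one plus its
squared inverse-Gram norm. -/
theorem det_add_vecMulVec {G : Matrix (Fin d) (Fin d) ℝ} (hG : G.GeOne) (v : Fin d → ℝ) :
    (G + vecMulVec v v).det = G.det * (1 + v ⬝ᵥ G⁻¹ *ᵥ v) := by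
  have h := det_add_replicateCol_mul_replicateRow (ι := Unit) hG.isUnit_det v v
  rw [vecMulVec_eq Unit, h]
  congr 1
  rw [det_unique]
  simp only [Matrix.add_apply, one_apply_eq]
  congr 1
  rw [dotProduct_mulVec]
  rfl

/-- The determinant is the product of the eigenvalues, each a value of the form at a unit
eigenvector. -/
theorem det_le_pow {G : Matrix (Fin d) (Fin d) ℝ} (hG : G.GeOne) {c : ℝ}
    (hc : ∀ x : Fin d → ℝ, x ⬝ᵥ G *ᵥ x ≤ c * (x ⬝ᵥ x)) : G.det ≤ c ^ d := by
  have hH := hG.posDef.isHermitian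
  rw [hH.det_eq_prod_eigenvalues]
  have h1 : ∀ i, 0 ≤ hH.eigenvalues i ∧ hH.eigenvalues i ≤ c := fun i => by
    have e := hH.eigenvalues_eq i
    set u := (hH.eigenvectorBasis i).ofLp with hu
    have hn : u ⬝ᵥ u = 1 := by
      have h2 := hH.eigenvectorBasis.orthonormal.1 i
      have h3 := EuclideanSpace.real_norm_sq_eq (hH.eigenvectorBasis i)
      rw [h2] at h3
      simp only [dotProduct, ← sq]
      linarith
    simp only [star_trivial, RCLike.re_to_real] at e
    rw [e]
    refine ⟨hG.quad_nonneg u, (hc u).trans ?_⟩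
    rw [hn, mul_one]
  calc ∏ i, ((hH.eigenvalues i : ℝ) : ℝ) ≤ ∏ _i : Fin d, c :=
        Finset.prod_le_prod (fun i _ => (h1 i).1) fun i _ => (h1 i).2
    _ = c ^ d := by simp

theorem le_two_mul_log_one_add {u : ℝ} (h0 : 0 ≤ u) (h1 : u ≤ 1) : u ≤ 2 * Real.log (1 + u) := by
  have h2 := Real.one_sub_inv_le_log_of_pos (x := 1 + u) (by linarith)
  have h3 : 1 - (1 + u)⁻¹ = u / (1 + u) := by field_simp; ring
  have h4 : u / 2 ≤ u / (1 + u) := div_le_div_of_nonneg_left h0 (by linarith) (by linarith)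
  linarith

/-- The elliptical potential lemma. -/
theorem sum_inv_quad_le (v : ℕ → Fin d → ℝ) (hv : ∀ t, v t ⬝ᵥ v t ≤ 1) (K : ℕ) :
    ∑ k ∈ Finset.range K,
      v k ⬝ᵥ (∑ t : Fin k, vecMulVec (v t) (v t) + 1 : Matrix (Fin d) (Fin d) ℝ)⁻¹ *ᵥ v k
      ≤ 2 * d * Real.log (K + 1) := by
  let G : ℕ → Matrix (Fin d) (Fin d) ℝ := fun k => ∑ t : Fin k, vecMulVec (v t) (v t) + 1
  have hG : ∀ k, (G k).GeOne := fun k => geOne_sum_vecMulVec fun t : Fin k => v t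
  have hs : ∀ k, G (k + 1) = G k + vecMulVec (v k) (v k) := fun k => by
    simp only [G, Fin.sum_univ_castSucc, Fin.val_castSucc, Fin.val_last]
    abel
  -- Each new feature of squared norm `u ≤ 1` raises `log det` by `log (1 + u) ≥ u / 2`.
  have key : ∑ k ∈ Finset.range K, v k ⬝ᵥ (G k)⁻¹ *ᵥ v k ≤ 2 * Real.log (G K).det := by
    induction K with
    | zero => simp [G]
    | succ K ih =>
      rw [Finset.sum_range_succ, hs, det_add_vecMulVec (hG K)]
      have h0 := (hG K).inv_quad_nonneg (v K)
      have h1 := ((hG K).inv_quad_le (v K)).trans (hv K)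
      have h2 := le_two_mul_log_one_add h0 h1
      rw [Real.log_mul (hG K).posDef.det_pos.ne' (by linarith)]
      linarith
  have h1 : (G K).det ≤ ((K : ℝ) + 1) ^ d := det_le_pow (hG K) fun x => by
    have := sum_vecMulVec_quad_le (v := fun t : Fin K => v t) (fun t => hv t) x
    simpa using this
  have h2 := Real.log_le_log (hG K).posDef.det_pos h1
  rw [Real.log_pow] at h2
  linarith

/-- By Cramer's rule the entries are quotients of polynomials in the entries of the matrix. -/
theorem measurable_matrix_inv_apply {X : Type*} [MeasurableSpace X]
    {F : X → Matrix (Fin d) (Fin d) ℝ} (hF : ∀ i j, Measurable fun x => F x i j) (i j : Fin d) :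
    Measurable fun x => (F x)⁻¹ i j := by
  have hdet : ∀ (N : X → Matrix (Fin d) (Fin d) ℝ), (∀ i j, Measurable fun x => N x i j) →
      Measurable fun x => (N x).det := fun N hN => by
    simp only [det_apply']
    exact Finset.measurable_sum _ fun σ _ =>
      (Finset.measurable_prod _ fun k _ => hN (σ k) k).const_mul _
  have hadj : Measurable fun x => (F x).adjugate i j := by
    simp only [adjugate_apply]
    refine hdet _ fun a b => ?_
    by_cases h : a = j
    · subst h
      simp only [updateRow_self]
      exact measurable_const
    · simp only [updateRow_ne h]
      exact hF a b
  simp only [inv_def, Ring.inverse_eq_inv', Matrix.smul_apply, smul_eq_mul]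
  exact (hdet F hF).inv.mul hadj

end RegularizedGram

/-! ### From conditional probabilities to joint laws -/

section ConditionalLaw

variable {Ω 𝓧 𝓨 : Type*} [MeasurableSpace Ω] [m𝓧 : MeasurableSpace 𝓧] [MeasurableSpace 𝓨]
  {P : Measure Ω} [IsProbabilityMeasure P] {X : Ω → 𝓧} {Y : Ω → 𝓨} {κ : Kernel 𝓧 𝓨}
  [IsMarkovKernel κ]

/-- `κ` is the conditional distribution of `Y` given `X`. -/
theorem map_prodMk_eq_compProd (hX : Measurable X) (hY : Measurable Y)
    (h : ∀ B : Set 𝓨, MeasurableSet B →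
      P⟦Y ⁻¹' B | m𝓧.comap X⟧ =ᵐ[P] fun ω => (κ (X ω)).real B) :
    P.map (fun ω => (X ω, Y ω)) = P.map X ⊗ₘ κ := by
  have : IsProbabilityMeasure (P.map X) := Measure.isProbabilityMeasure_map hX.aemeasurable
  have : IsProbabilityMeasure (P.map fun ω => (X ω, Y ω)) :=
    Measure.isProbabilityMeasure_map (hX.prodMk hY).aemeasurable
  refine Measure.ext_prod fun {C} {B} hC hB => ?_
  rw [Measure.map_apply (hX.prodMk hY) (hC.prod hB), Measure.compProd_apply_prod hC hB,
    setLIntegral_map hC (Kernel.measurable_coe κ hB) hX]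
  have hXC : MeasurableSet[m𝓧.comap X] (X ⁻¹' C) := ⟨C, hC, rfl⟩
  have h1 := setIntegral_condExp (μ := P) hX.comap_le
    (f := (Y ⁻¹' B).indicator fun _ => (1 : ℝ))
    ((integrable_const 1).indicator (hY hB)) hXC
  rw [setIntegral_congr_ae (g := fun ω => (κ (X ω)).real B) (hX hC)
    ((h B hB).mono fun ω hω _ => hω), setIntegral_indicator (hY hB)] at h1
  have h2 : ((fun ω => (X ω, Y ω)) ⁻¹' C ×ˢ B) = X ⁻¹' C ∩ Y ⁻¹' B := rfl
  have mk : Measurable fun ω => κ (X ω) B := (Kernel.measurable_coe κ hB).comp hX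
  rw [h2]
  have h3 : ∫⁻ ω in X ⁻¹' C, κ (X ω) B ∂P
      = ENNReal.ofReal (∫ ω in X ⁻¹' C, (κ (X ω)).real B ∂P) := by
    rw [ofReal_integral_eq_lintegral_ofReal]
    · simp [Measure.real]
    · refine (integrable_of_abs_le mk.ennreal_toReal 1 fun ω => ?_)
      rw [abs_of_nonneg measureReal_nonneg]
      exact measureReal_le_one
    · exact Filter.Eventually.of_forall fun ω => ENNReal.toReal_nonneg
  rw [h3, h1]
  simp

theorem lintegral_prodMk_eq (hX : Measurable X) (hY : Measurable Y)
    (h : ∀ B : Set 𝓨, MeasurableSet B →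
      P⟦Y ⁻¹' B | m𝓧.comap X⟧ =ᵐ[P] fun ω => (κ (X ω)).real B)
    {f : 𝓧 × 𝓨 → ℝ≥0∞} (hf : Measurable f) :
    ∫⁻ ω, f (X ω, Y ω) ∂P = ∫⁻ ω, ∫⁻ y, f (X ω, y) ∂(κ (X ω)) ∂P := by
  have : IsProbabilityMeasure (P.map X) := Measure.isProbabilityMeasure_map hX.aemeasurable
  rw [← lintegral_map hf (hX.prodMk hY), map_prodMk_eq_compProd hX hY h,
    Measure.lintegral_compProd hf,
    lintegral_map (Measurable.lintegral_kernel_prod_right' hf) hX]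

theorem integral_prodMk_eq (hX : Measurable X) (hY : Measurable Y)
    (h : ∀ B : Set 𝓨, MeasurableSet B →
      P⟦Y ⁻¹' B | m𝓧.comap X⟧ =ᵐ[P] fun ω => (κ (X ω)).real B)
    {f : 𝓧 × 𝓨 → ℝ} (hf : Measurable f) (c : ℝ) (hc : ∀ x, |f x| ≤ c) :
    ∫ ω, f (X ω, Y ω) ∂P = ∫ ω, ∫ y, f (X ω, y) ∂(κ (X ω)) ∂P := by
  have : IsProbabilityMeasure (P.map X) := Measure.isProbabilityMeasure_map hX.aemeasurable
  rw [← integral_map (hX.prodMk hY).aemeasurable hf.aestronglyMeasurable,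
    map_prodMk_eq_compProd hX hY h,
    Measure.integral_compProd (integrable_of_abs_le hf c hc),
    integral_map hX.aemeasurable]
  exact hf.stronglyMeasurable.integral_kernel_prod_right'.aestronglyMeasurable

end ConditionalLaw

/-! ### The law of adaptively collected episodes -/

section DataLaw

variable {S A Ω : Type*} [MeasurableSpace S] [MeasurableSpace A] [MeasurableSpace Ω]
  {ρ : Measure S} [SigmaFinite ρ] {P : Measure Ω} [IsProbabilityMeasure P] {M : MDP S A ρ}
  {H K : ℕ} {μ : (t : ℕ) → AdaptivePolicy S A H t} {D : ℕ → ℕ → Ω → Step S A}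

theorem AdaptivePolicy.run_kernel {k : ℕ} (π : AdaptivePolicy S A H k) (τ : History S A H k)
    (h : ℕ) (s : S) : (π.run τ).kernel h s = π.kernel h (τ, s) := rfl

theorem MDP.measurable_occ_run (M : MDP S A ρ) {k : ℕ} (π : AdaptivePolicy S A H k) (h : ℕ) :
    Measurable fun x : History S A H k × S => M.occ (π.run x.1) h x.2 :=
  M.measurable_occ_family (fun τ => π.run τ) π.kernel (fun τ h s => π.run_kernel τ h s) h

theorem MDP.measurable_lintegral_law_run (M : MDP S A ρ) {k : ℕ} (π : AdaptivePolicy S A H k)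
    (h : ℕ) {f : History S A H k × S × A → ℝ≥0∞} (hf : Measurable f) :
    Measurable fun τ => ∫⁻ x, f (τ, x) ∂(M.law (π.run τ) h) := by
  have hg : Measurable fun x : History S A H k × S =>
      ∫⁻ a, f (x.1, x.2, a) ∂((π.run x.1).kernel h x.2) := by
    simp_rw [AdaptivePolicy.run_kernel]
    have : Measurable fun y : (History S A H k × S) × A => f (y.1.1, y.1.2, y.2) :=
      hf.comp (by fun_prop)
    exact Measurable.lintegral_kernel_prod_right' this
  have e : ∀ τ, ∫⁻ x, f (τ, x) ∂(M.law (π.run τ) h)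
      = ∫⁻ s, M.occ (π.run τ) h s * ∫⁻ a, f (τ, s, a) ∂((π.run τ).kernel h s) ∂ρ := fun τ => by
    have hfτ : Measurable fun x : S × A => f (τ, x) := hf.comp measurable_prodMk_left
    rw [MDP.law, Measure.lintegral_compProd hfτ, M.lintegral_stateLaw]
    exact Measurable.lintegral_kernel_prod_right' hfτ
  simp_rw [e]
  exact ((M.measurable_occ_run π h).mul hg).lintegral_prod_right'

namespace IsAdaptiveData

theorem measurable_hist (hD : IsAdaptiveData P M H K μ D) {t : ℕ} (ht : t ≤ K) :
    Measurable (hist H D t) :=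
  measurable_pi_lambda _ fun j => measurable_pi_lambda _ fun h =>
    hD.meas j (j.2.trans_le ht) h h.2

theorem measurable_partialEp (hD : IsAdaptiveData P M H K μ D) {t h : ℕ} (ht : t < K)
    (hh : h ≤ H) : Measurable (partialEp D t h) :=
  measurable_pi_lambda _ fun j => hD.meas t ht j (j.2.trans_le hh)

theorem measurable_state (hD : IsAdaptiveData P M H K μ D) {t h : ℕ} (ht : t < K)
    (hh : h < H) : Measurable fun ω => (D t h ω).1 := (hD.meas t ht h hh).fst

theorem measurable_action (hD : IsAdaptiveData P M H K μ D) {t h : ℕ} (ht : t < K)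
    (hh : h < H) : Measurable fun ω => (D t h ω).2.1 := (hD.meas t ht h hh).snd.fst

theorem measurable_upToState (hD : IsAdaptiveData P M H K μ D) {t h : ℕ} (ht : t < K)
    (hh : h < H) :
    Measurable fun ω => (hist H D t ω, partialEp D t h ω, (D t h ω).1) :=
  (hD.measurable_hist ht.le).prodMk
    ((hD.measurable_partialEp ht hh.le).prodMk (hD.measurable_state ht hh))

theorem measurable_upToAction (hD : IsAdaptiveData P M H K μ D) {t h : ℕ} (ht : t < K)
    (hh : h < H) :
    Measurable fun ω => (hist H D t ω, partialEp D t h ω, (D t h ω).1, (D t h ω).2.1) :=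
  (hD.measurable_hist ht.le).prodMk ((hD.measurable_partialEp ht hh.le).prodMk
    ((hD.measurable_state ht hh).prodMk (hD.measurable_action ht hh)))

theorem lintegral_action (hD : IsAdaptiveData P M H K μ D) {t h : ℕ} (ht : t < K) (hh : h < H)
    {f : History S A H t × S × A → ℝ≥0∞} (hf : Measurable f) :
    ∫⁻ ω, f (hist H D t ω, (D t h ω).1, (D t h ω).2.1) ∂P
      = ∫⁻ ω, ∫⁻ a, f (hist H D t ω, (D t h ω).1, a)
          ∂(((μ t).run (hist H D t ω)).kernel h (D t h ω).1) ∂P := by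
  have hpr : Measurable fun x : History S A H t × (Fin h → Step S A) × S => (x.1, x.2.2) := by
    fun_prop
  have := lintegral_prodMk_eq (P := P) (κ := ((μ t).kernel h).comap _ hpr)
    (hD.measurable_upToState ht hh) (hD.measurable_action ht hh) (hD.action t ht h hh)
    (f := fun z => f (z.1.1, z.1.2.2, z.2)) (hf.comp (by fun_prop))
  exact this

theorem lintegral_next (hD : IsAdaptiveData P M H K μ D) {t h : ℕ} (ht : t < K) (hh : h + 1 < H)
    {f : History S A H t × S → ℝ≥0∞} (hf : Measurable f) :
    ∫⁻ ω, f (hist H D t ω, (D t (h + 1) ω).1) ∂P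
      = ∫⁻ ω, ∫⁻ s', f (hist H D t ω, s') ∂(M.next h (D t h ω).1 (D t h ω).2.1) ∂P := by
  have hpr : Measurable fun x : History S A H t × (Fin h → Step S A) × S × A => x.2.2 := by
    fun_prop
  have := lintegral_prodMk_eq (P := P) (κ := (M.nextKernel h).comap _ hpr)
    (hD.measurable_upToAction ht (by omega)) (hD.measurable_state ht hh)
    (fun B hB => by
      simp only [Kernel.comap_apply, MDP.nextKernel_apply]
      exact hD.next t ht h hh B hB)
    (f := fun z => f (z.1.1, z.2)) (hf.comp (by fun_prop))
  simpa only [Kernel.comap_apply, MDP.nextKernel_apply] using this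

theorem lintegral_init (hD : IsAdaptiveData P M H K μ D) {t : ℕ} (ht : t < K) (hH : 0 < H)
    {f : History S A H t × S → ℝ≥0∞} (hf : Measurable f) :
    ∫⁻ ω, f (hist H D t ω, (D t 0 ω).1) ∂P
      = ∫⁻ ω, ∫⁻ s, f (hist H D t ω, s) ∂M.initLaw ∂P := by
  have := lintegral_prodMk_eq (P := P) (κ := Kernel.const _ M.initLaw)
    (hD.measurable_hist ht.le) (hD.measurable_state ht hH)
    (fun B hB => by simpa only [Kernel.const_apply] using hD.init t ht B hB) hf
  simpa only [Kernel.const_apply] using this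

theorem lintegral_law_of_state (hD : IsAdaptiveData P M H K μ D) {t h : ℕ} (ht : t < K)
    (hh : h < H)
    (hs : ∀ g : History S A H t × S → ℝ≥0∞, Measurable g →
      ∫⁻ ω, g (hist H D t ω, (D t h ω).1) ∂P
        = ∫⁻ ω, ∫⁻ s, g (hist H D t ω, s) ∂(M.stateLaw ((μ t).run (hist H D t ω)) h) ∂P)
    {f : History S A H t × S × A → ℝ≥0∞} (hf : Measurable f) :
    ∫⁻ ω, f (hist H D t ω, (D t h ω).1, (D t h ω).2.1) ∂P
      = ∫⁻ ω, ∫⁻ x, f (hist H D t ω, x) ∂(M.law ((μ t).run (hist H D t ω)) h) ∂P := by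
  have hg : Measurable fun x : History S A H t × S =>
      ∫⁻ a, f (x.1, x.2, a) ∂(((μ t).run x.1).kernel h x.2) := by
    simp_rw [AdaptivePolicy.run_kernel]
    have : Measurable fun y : (History S A H t × S) × A => f (y.1.1, y.1.2, y.2) :=
      hf.comp (by fun_prop)
    exact Measurable.lintegral_kernel_prod_right' this
  rw [hD.lintegral_action ht hh hf, hs _ hg]
  refine lintegral_congr fun ω => ?_
  have hfτ : Measurable fun x : S × A => f (hist H D t ω, x) := hf.comp measurable_prodMk_left
  rw [MDP.law, Measure.lintegral_compProd hfτ]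

/-- Induction on the step: state and action at step `h` follow the visitation law of the played
policy given the earlier episodes, and the transition kernel carries this to step `h + 1`. The test
function may depend on the earlier episodes, so this is a conditional statement. -/
theorem lintegral_state (hD : IsAdaptiveData P M H K μ D) {t h : ℕ} (ht : t < K) (hh : h < H)
    {f : History S A H t × S → ℝ≥0∞} (hf : Measurable f) :
    ∫⁻ ω, f (hist H D t ω, (D t h ω).1) ∂P
      = ∫⁻ ω, ∫⁻ s, f (hist H D t ω, s) ∂(M.stateLaw ((μ t).run (hist H D t ω)) h) ∂P := by
  induction h generalizing f with
  | zero => exact hD.lintegral_init ht hh hf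
  | succ h ih =>
    rw [hD.lintegral_next ht hh hf]
    have hg : Measurable fun x : History S A H t × S × A =>
        ∫⁻ s', f (x.1, s') ∂(M.next h x.2.1 x.2.2) := by
      simp_rw [← MDP.nextKernel_apply]
      have : Measurable fun y : (History S A H t × S × A) × S => f (y.1.1, y.2) :=
        hf.comp (by fun_prop)
      exact Measurable.lintegral_kernel_prod_right'
        (κ := (M.nextKernel h).comap (fun x : History S A H t × S × A => x.2) measurable_snd) this
    have := hD.lintegral_law_of_state ht (by omega) (fun g hg => ih (by omega) hg) hg
    rw [this]
    refine lintegral_congr fun ω => ?_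
    have hfτ : Measurable fun s => f (hist H D t ω, s) := hf.comp measurable_prodMk_left
    rw [M.lintegral_stateLaw_succ _ h hfτ]

/-- The law of the state and the action of step `h` of episode `t`, given the earlier episodes. -/
theorem lintegral_law (hD : IsAdaptiveData P M H K μ D) {t h : ℕ} (ht : t < K) (hh : h < H)
    {f : History S A H t × S × A → ℝ≥0∞} (hf : Measurable f) :
    ∫⁻ ω, f (hist H D t ω, (D t h ω).1, (D t h ω).2.1) ∂P
      = ∫⁻ ω, ∫⁻ x, f (hist H D t ω, x) ∂(M.law ((μ t).run (hist H D t ω)) h) ∂P :=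
  hD.lintegral_law_of_state ht hh (fun _ hg => hD.lintegral_state ht hh hg) hf

theorem measurableSet_occ_eq_zero (M : MDP S A ρ) {t : ℕ} (π : AdaptivePolicy S A H t) (h : ℕ) :
    MeasurableSet {x : History S A H t × S | M.occ (π.run x.1) h x.2 = 0} :=
  M.measurable_occ_run π h (measurableSet_singleton 0)

/-- The conditional state law has the visitation density, hence does not charge the zero set of that
density. -/
theorem lintegral_occ_eq_zero (hD : IsAdaptiveData P M H K μ D) {t h : ℕ} (ht : t < K)
    (hh : h < H) :
    ∫⁻ ω, {x : History S A H t × S | M.occ ((μ t).run x.1) h x.2 = 0}.indicator 1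
      (hist H D t ω, (D t h ω).1) ∂P = 0 := by
  rw [hD.lintegral_state ht hh
    (measurable_one.indicator (measurableSet_occ_eq_zero M (μ t) h)), ← lintegral_zero (μ := P)]
  refine lintegral_congr fun ω => ?_
  rw [← lintegral_zero (μ := M.stateLaw ((μ t).run (hist H D t ω)) h)]
  refine lintegral_congr_ae ?_
  filter_upwards [M.ae_stateLaw_occ_pos ((μ t).run (hist H D t ω)) h] with s hs
  simp [Set.indicator, hs.ne']

theorem ae_feasible (hD : IsAdaptiveData P M H K μ D) {t h : ℕ} (ht : t < K) (hh : h < H) :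
    ∀ᵐ ω ∂P, M.Feasible h (D t h ω).1 := by
  have h0 := hD.lintegral_occ_eq_zero ht hh
  have hI : Measurable ({x : History S A H t × S |
      M.occ ((μ t).run x.1) h x.2 = 0}.indicator (1 : History S A H t × S → ℝ≥0∞)) :=
    measurable_one.indicator (measurableSet_occ_eq_zero M (μ t) h)
  have h2 := (lintegral_eq_zero_iff (hI.comp
    ((hD.measurable_hist ht.le).prodMk (hD.measurable_state ht hh)))).1 h0
  filter_upwards [h2] with ω hω
  refine ⟨(μ t).run (hist H D t ω), pos_iff_ne_zero.2 fun h1 => ?_⟩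
  have hm : (hist H D t ω, (D t h ω).1)
      ∈ {x : History S A H t × S | M.occ ((μ t).run x.1) h x.2 = 0} := h1
  simp only [Function.comp] at hω
  rw [Set.indicator_of_mem hm] at hω
  simp at hω

/-- The noise involves the mean of the value estimate under the transition law, not only its value
at the recorded state. Estimates are comparable at feasible states only, so almost all possible
successors must be feasible. -/
theorem ae_ae_next_feasible (hD : IsAdaptiveData P M H K μ D) {t h : ℕ} (ht : t < K)
    (hh : h + 1 < H) :
    ∀ᵐ ω ∂P, ∀ᵐ s' ∂(M.next h (D t h ω).1 (D t h ω).2.1), M.Feasible (h + 1) s' := by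
  have h0 := hD.lintegral_occ_eq_zero ht hh
  have hI : Measurable ({x : History S A H t × S |
      M.occ ((μ t).run x.1) (h + 1) x.2 = 0}.indicator (1 : History S A H t × S → ℝ≥0∞)) :=
    measurable_one.indicator (measurableSet_occ_eq_zero M (μ t) (h + 1))
  rw [hD.lintegral_next ht hh hI] at h0
  have hm : Measurable fun ω => ∫⁻ s', {x : History S A H t × S |
      M.occ ((μ t).run x.1) (h + 1) x.2 = 0}.indicator (1 : History S A H t × S → ℝ≥0∞)
        (hist H D t ω, s') ∂(M.next h (D t h ω).1 (D t h ω).2.1) := by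
    simp_rw [show ∀ ω, M.next h (D t h ω).1 (D t h ω).2.1
      = M.nextKernel h ((D t h ω).1, (D t h ω).2.1) from
        fun ω => (M.nextKernel_apply h ((D t h ω).1, (D t h ω).2.1)).symm]
    have hsa : Measurable fun ω => ((D t h ω).1, (D t h ω).2.1) :=
      (hD.measurable_state ht (by omega)).prodMk (hD.measurable_action ht (by omega))
    have h1 : Measurable fun y : Ω × S => (hist H D t y.1, y.2) :=
      ((hD.measurable_hist ht.le).comp measurable_fst).prodMk measurable_snd
    exact Measurable.lintegral_kernel_prod_right' (κ := (M.nextKernel h).comap _ hsa)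
      (hI.comp h1)
  rw [lintegral_eq_zero_iff hm] at h0
  filter_upwards [h0] with ω hω
  have h2 := (lintegral_eq_zero_iff (hI.comp measurable_prodMk_left)).1 hω
  filter_upwards [h2] with s' hs'
  refine ⟨(μ t).run (hist H D t ω), pos_iff_ne_zero.2 fun h1 => ?_⟩
  have hm : (hist H D t ω, s')
      ∈ {x : History S A H t × S | M.occ ((μ t).run x.1) (h + 1) x.2 = 0} := h1
  simp only [Function.comp] at hs'
  rw [Set.indicator_of_mem hm] at hs'
  simp at hs'

end IsAdaptiveData

end DataLaw

/-- Chernoff's bound for a variable with exponential moment at most `1`. -/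
theorem measure_log_inv_le_of_integral_exp_le {Ω : Type*} [MeasurableSpace Ω] {P : Measure Ω}
    [IsProbabilityMeasure P] {Y : Ω → ℝ} (hY : Integrable (fun ω => Real.exp (Y ω)) P)
    (h1 : ∫ ω, Real.exp (Y ω) ∂P ≤ 1) {δ : ℝ} (hδ : 0 < δ) :
    P {ω | Real.log (1 / δ) ≤ Y ω} ≤ ENNReal.ofReal δ := by
  have h2 := mul_meas_ge_le_integral_of_nonneg (μ := P)
    (Filter.Eventually.of_forall fun ω => (Real.exp_pos (Y ω)).le) hY (1 / δ)
  have h3 : {ω | Real.log (1 / δ) ≤ Y ω} = {ω | 1 / δ ≤ Real.exp (Y ω)} := by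
    ext ω
    exact Real.log_le_iff_le_exp (by positivity)
  have h4 : P.real {ω | 1 / δ ≤ Real.exp (Y ω)} ≤ δ := by
    have := h2.trans h1
    rw [one_div_mul_eq_div, div_le_one hδ] at this
    exact this
  rw [h3, ← ofReal_measureReal]
  exact ENNReal.ofReal_le_ofReal h4

theorem integral_add_sub_add {Ω : Type*} [MeasurableSpace Ω] {P : Measure Ω}
    {f₁ f₂ f₃ f₄ : Ω → ℝ} (h₁ : Integrable f₁ P) (h₂ : Integrable f₂ P) (h₃ : Integrable f₃ P)
    (h₄ : Integrable f₄ P) :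
    ∫ ω, (f₁ ω + f₂ ω - (f₃ ω + f₄ ω)) ∂P
      = ∫ ω, f₁ ω ∂P + ∫ ω, f₂ ω ∂P - (∫ ω, f₃ ω ∂P + ∫ ω, f₄ ω ∂P) := by
  rw [← integral_add h₁ h₂, ← integral_add h₃ h₄]
  exact integral_sub (h₁.add h₂) (h₃.add h₄)

/-- The chord of the exponential over `[-lc, lc]`. It is affine in `e`, so its second term
disappears under a mean-zero law. -/
theorem exp_mul_le_cosh_add {l c e : ℝ} (hc : 0 < c) (he : |e| ≤ c) :
    Real.exp (l * e) ≤ Real.cosh (l * c) + e * (Real.sinh (l * c) / c) := by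
  have h1 := abs_le.1 he
  have ha : 0 ≤ (c + e) / (2 * c) := div_nonneg (by linarith) (by linarith)
  have hb : 0 ≤ (c - e) / (2 * c) := div_nonneg (by linarith) (by linarith)
  have hab : (c + e) / (2 * c) + (c - e) / (2 * c) = 1 := by field_simp; ring
  have h := convexOn_exp.2 (Set.mem_univ (l * c)) (Set.mem_univ (-(l * c))) ha hb hab
  have e1 : (c + e) / (2 * c) * (l * c) + (c - e) / (2 * c) * (-(l * c)) = l * e := by
    field_simp
    ring
  simp only [smul_eq_mul] at h
  rw [e1] at h
  refine h.trans (le_of_eq ?_)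
  rw [Real.cosh_eq, Real.sinh_eq]
  field_simp
  ring

/-- The chord of the exponential over `[-1, 0]`, with `1/e ≤ 1/2`. -/
theorem exp_neg_le_one_sub_half {x : ℝ} (h0 : 0 ≤ x) (h1 : x ≤ 1) :
    Real.exp (-x) ≤ 1 - x / 2 := by
  have hx : 0 ≤ 1 - x := by linarith
  have h := convexOn_exp.2 (Set.mem_univ (-1 : ℝ)) (Set.mem_univ (0 : ℝ)) h0 hx (by ring)
  simp only [smul_eq_mul, mul_neg, mul_one, mul_zero, add_zero, Real.exp_zero] at h
  have h2 : Real.exp (-1) ≤ 1 / 2 := by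
    rw [Real.exp_neg, one_div]
    exact inv_anti₀ (by norm_num) (by linarith [Real.add_one_le_exp (1 : ℝ)])
  nlinarith

/-! ### Sums along the recorded episodes -/

section HistorySum

variable {S A Ω : Type*} [MeasurableSpace S] [MeasurableSpace A] {H : ℕ}

/-- The sum over the recorded episodes of terms that depend on the episode and on the earlier
ones. -/
noncomputable def histSum (ψ : (n : ℕ) → History S A H n → (Fin H → Step S A) → ℝ) :
    (n : ℕ) → History S A H n → ℝ
  | 0, _ => 0
  | n + 1, τ => histSum ψ n (fun t => τ t.castSucc)
      + ψ n (fun t => τ t.castSucc) (τ (Fin.last n))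

/-- The record of episode `t`. -/
def episode (H : ℕ) (D : ℕ → ℕ → Ω → Step S A) (t : ℕ) (ω : Ω) : Fin H → Step S A :=
  fun h => D t h ω

theorem histSum_hist (ψ : (n : ℕ) → History S A H n → (Fin H → Step S A) → ℝ)
    (D : ℕ → ℕ → Ω → Step S A) (n : ℕ) (ω : Ω) :
    histSum ψ n (hist H D n ω)
      = ∑ k ∈ Finset.range n, ψ k (hist H D k ω) (episode H D k ω) := by
  induction n with
  | zero => rfl
  | succ n ih =>
    rw [Finset.sum_range_succ, ← ih]
    rfl

theorem histSum_hist_succ (ψ : (n : ℕ) → History S A H n → (Fin H → Step S A) → ℝ)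
    (D : ℕ → ℕ → Ω → Step S A) (n : ℕ) (ω : Ω) :
    histSum ψ (n + 1) (hist H D (n + 1) ω)
      = histSum ψ n (hist H D n ω) + ψ n (hist H D n ω) (episode H D n ω) := rfl

theorem measurable_histSum {ψ : (n : ℕ) → History S A H n → (Fin H → Step S A) → ℝ}
    (hψ : ∀ n, Measurable fun x : History S A H n × (Fin H → Step S A) => ψ n x.1 x.2) (n : ℕ) :
    Measurable (histSum ψ n) := by
  induction n with
  | zero => exact measurable_const
  | succ n ih =>
    have h1 : Measurable fun τ : History S A H (n + 1) => (fun t : Fin n => τ t.castSucc) :=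
      measurable_pi_lambda _ fun t => measurable_pi_apply _
    exact (ih.comp h1).add ((hψ n).comp (h1.prodMk (measurable_pi_apply (Fin.last n))))

theorem abs_histSum_le {ψ : (n : ℕ) → History S A H n → (Fin H → Step S A) → ℝ} {c : ℝ}
    (hc : ∀ n τ e, |ψ n τ e| ≤ c) (n : ℕ) (τ : History S A H n) : |histSum ψ n τ| ≤ n * c := by
  induction n with
  | zero => simp [histSum]
  | succ n ih =>
    refine (abs_add_le _ _).trans ((add_le_add (ih _) (hc _ _ _)).trans ?_)
    push_cast
    linarith

end HistorySum

/-! ### Exponential supermartingales for adaptive data -/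

namespace IsAdaptiveData

variable {S A Ω : Type*} [MeasurableSpace S] [MeasurableSpace A] [MeasurableSpace Ω]
  {ρ : Measure S} [SigmaFinite ρ] {P : Measure Ω} [IsProbabilityMeasure P] {M : MDP S A ρ}
  {H K : ℕ} {μ : (t : ℕ) → AdaptivePolicy S A H t} {D : ℕ → ℕ → Ω → Step S A}

theorem integral_law (hD : IsAdaptiveData P M H K μ D) {t h : ℕ} (ht : t < K) (hh : h < H)
    {f : History S A H t × S × A → ℝ} (hf : Measurable f) {c : ℝ} (h0 : ∀ x, 0 ≤ f x)
    (hc : ∀ x, f x ≤ c) :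
    ∫ ω, f (hist H D t ω, (D t h ω).1, (D t h ω).2.1) ∂P
      = ∫ ω, ∫ x, f (hist H D t ω, x) ∂(M.law ((μ t).run (hist H D t ω)) h) ∂P := by
  have hm : Measurable fun ω => f (hist H D t ω, (D t h ω).1, (D t h ω).2.1) :=
    hf.comp ((hD.measurable_hist ht.le).prodMk
      ((hD.measurable_state ht hh).prodMk (hD.measurable_action ht hh)))
  rw [integral_eq_lintegral_of_nonneg_ae (Filter.Eventually.of_forall fun ω => h0 _)
    hm.aestronglyMeasurable]
  have hl := hD.lintegral_law ht hh hf.ennreal_ofReal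
  rw [hl]
  have e : ∀ τ : History S A H t, ∫ x, f (τ, x) ∂(M.law ((μ t).run τ) h)
      = (∫⁻ x, ENNReal.ofReal (f (τ, x)) ∂(M.law ((μ t).run τ) h)).toReal := fun τ =>
    integral_eq_lintegral_of_nonneg_ae (Filter.Eventually.of_forall fun x => h0 _)
      (hf.comp measurable_prodMk_left).aestronglyMeasurable
  have hfin : ∀ τ : History S A H t,
      ∫⁻ x, ENNReal.ofReal (f (τ, x)) ∂(M.law ((μ t).run τ) h) ≤ ENNReal.ofReal c := fun τ => by
    refine (lintegral_mono fun x => ENNReal.ofReal_le_ofReal (hc (τ, x))).trans ?_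
    simp
  simp_rw [e]
  rw [integral_toReal]
  · exact ((M.measurable_lintegral_law_run (μ t) h hf.ennreal_ofReal).comp
      (hD.measurable_hist ht.le)).aemeasurable
  · exact Filter.Eventually.of_forall fun ω => (hfin _).trans_lt ENNReal.ofReal_lt_top

theorem measurable_integral_law_run (M : MDP S A ρ) {k : ℕ} (π : AdaptivePolicy S A H k)
    (h : ℕ) {f : History S A H k × S × A → ℝ} (hf : Measurable f) (h0 : ∀ x, 0 ≤ f x) :
    Measurable fun τ => ∫ x, f (τ, x) ∂(M.law (π.run τ) h) := by
  have e : ∀ τ : History S A H k, ∫ x, f (τ, x) ∂(M.law (π.run τ) h)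
      = (∫⁻ x, ENNReal.ofReal (f (τ, x)) ∂(M.law (π.run τ) h)).toReal := fun τ =>
    integral_eq_lintegral_of_nonneg_ae (Filter.Eventually.of_forall fun x => h0 _)
      (hf.comp measurable_prodMk_left).aestronglyMeasurable
  simp_rw [e]
  exact (M.measurable_lintegral_law_run π h hf.ennreal_ofReal).ennreal_toReal

theorem measurable_episode (hD : IsAdaptiveData P M H K μ D) {t : ℕ} (ht : t < K) :
    Measurable (episode H D t) :=
  measurable_pi_lambda _ fun h => hD.meas t ht h h.2

/-- Sums of conditional means of nonnegative bounded variables are at most twice the sums of the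
variables, up to a logarithmic term. -/
theorem measure_sum_mean_ge_le (hD : IsAdaptiveData P M H K μ D)
    {f : (k : ℕ) → Fin H → History S A H k × S × A → ℝ} (hf : ∀ k h, Measurable (f k h))
    (h0 : ∀ k h x, 0 ≤ f k h x) (h1 : ∀ k h x, f k h x ≤ 1)
    (hsum : ∀ k τ (e : Fin H → Step S A), ∑ h, f k h (τ, (e h).1, (e h).2.1) ≤ 1)
    {δ : ℝ} (hδ : 0 < δ) :
    P {ω | 2 * ∑ k ∈ Finset.range K, ∑ h : Fin H,
            f k h (hist H D k ω, (D k h ω).1, (D k h ω).2.1) + 2 * Real.log (1 / δ)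
          ≤ ∑ k ∈ Finset.range K, ∑ h : Fin H,
            ∫ x, f k h (hist H D k ω, x) ∂(M.law ((μ k).run (hist H D k ω)) h)}
      ≤ ENNReal.ofReal δ := by
  let m : (k : ℕ) → History S A H k → ℝ := fun k τ =>
    ∑ h : Fin H, ∫ x, f k h (τ, x) ∂(M.law ((μ k).run τ) h)
  let X : (k : ℕ) → History S A H k → (Fin H → Step S A) → ℝ := fun k τ e =>
    ∑ h, f k h (τ, (e h).1, (e h).2.1)
  let ψ : (k : ℕ) → History S A H k → (Fin H → Step S A) → ℝ := fun k τ e =>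
    m k τ / 2 - X k τ e
  have hmm : ∀ k, Measurable (m k) := fun k => Finset.measurable_sum _ fun h _ =>
    measurable_integral_law_run M (μ k) h (hf k h) (h0 k h)
  have hXm : ∀ k, Measurable fun x : History S A H k × (Fin H → Step S A) => X k x.1 x.2 :=
    fun k => Finset.measurable_sum _ fun h _ => (hf k h).comp (by fun_prop)
  have hψm : ∀ k, Measurable fun x : History S A H k × (Fin H → Step S A) => ψ k x.1 x.2 :=
    fun k => (((hmm k).comp measurable_fst).div_const 2).sub (hXm k)
  have hX0 : ∀ k τ e, 0 ≤ X k τ e := fun k τ e => Finset.sum_nonneg fun h _ => h0 _ _ _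
  have hmb : ∀ k τ, m k τ ∈ Set.Icc (0 : ℝ) H := fun k τ => by
    have : ∀ h : Fin H, ∫ x, f k h (τ, x) ∂(M.law ((μ k).run τ) h) ∈ Set.Icc (0 : ℝ) 1 :=
      fun h => integral_mem_Icc ((hf k h).comp measurable_prodMk_left)
        fun x => ⟨h0 _ _ _, h1 _ _ _⟩
    refine ⟨Finset.sum_nonneg fun h _ => (this h).1, ?_⟩
    refine (Finset.sum_le_sum fun h _ => (this h).2).trans ?_
    simp
  have hψb : ∀ k τ e, |ψ k τ e| ≤ H + 1 := fun k τ e => by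
    have h2 := hmb k τ
    have h3 := hX0 k τ e
    have h4 := hsum k τ e
    rw [abs_le]
    constructor
    · have : X k τ e ≤ 1 := h4
      simp only [ψ]
      linarith [h2.1, h2.2]
    · simp only [ψ]
      linarith [h2.1, h2.2]
  have hSm := measurable_histSum hψm
  have hSb := abs_histSum_le hψb
  have hint : ∀ n ≤ K, Integrable (fun ω => Real.exp (histSum ψ n (hist H D n ω))) P :=
    fun n hn => integrable_of_abs_le (((hSm n).comp (hD.measurable_hist hn)).exp)
      (Real.exp (n * (H + 1))) fun ω => by
        rw [abs_of_pos (Real.exp_pos _)]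
        exact Real.exp_le_exp.2 ((le_abs_self _).trans (hSb n _))
  -- The exponential of the sum of `m / 2 - X` is a supermartingale: given the past, `E exp(-X) ≤ 1
  -- - m / 2 ≤ exp(-m / 2)`. Only the conditional mean of `X` enters, so the dependence between the
  -- steps of one episode is harmless.
  have key : ∀ n ≤ K, ∫ ω, Real.exp (histSum ψ n (hist H D n ω)) ∂P ≤ 1 := by
    intro n hn
    induction n with
    | zero => simp [histSum]
    | succ n ih =>
      have hn' : n < K := hn
      refine le_trans ?_ (ih hn'.le)
      let g : History S A H n → ℝ := fun τ => Real.exp (histSum ψ n τ + m n τ / 2)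
      have hgm : Measurable g := ((hSm n).add ((hmm n).div_const 2)).exp
      have hg0 : ∀ τ, 0 ≤ g τ := fun τ => (Real.exp_pos _).le
      set c := Real.exp (n * (H + 1) + H / 2) with hcdef
      have hgb : ∀ τ, g τ ≤ c := fun τ => Real.exp_le_exp.2
        (add_le_add ((le_abs_self _).trans (hSb n _)) (by linarith [(hmb n τ).2]))
      have hc0 : 0 ≤ c := (Real.exp_pos _).le
      have hmh := hD.measurable_hist hn'.le
      have hgi : Integrable (fun ω => g (hist H D n ω)) P :=
        integrable_of_abs_le (hgm.comp hmh) c fun ω => by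
          rw [abs_of_nonneg (hg0 _)]; exact hgb _
      have hXi : Integrable
          (fun ω => g (hist H D n ω) * X n (hist H D n ω) (episode H D n ω)) P :=
        integrable_of_abs_le ((hgm.comp hmh).mul
          ((hXm n).comp (hmh.prodMk (hD.measurable_episode hn')))) (c * 1) fun ω => by
            rw [abs_mul, abs_of_nonneg (hg0 _), abs_of_nonneg (hX0 _ _ _)]
            exact mul_le_mul (hgb _) (hsum n _ _) (hX0 _ _ _) hc0
      have hmi : Integrable (fun ω => g (hist H D n ω) * m n (hist H D n ω)) P :=
        integrable_of_abs_le ((hgm.comp hmh).mul ((hmm n).comp hmh)) (c * H) fun ω => by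
            rw [abs_mul, abs_of_nonneg (hg0 _), abs_of_nonneg (hmb n _).1]
            exact mul_le_mul (hgb _) (hmb n _).2 (hmb n _).1 hc0
      have hXE : ∫ ω, g (hist H D n ω) * X n (hist H D n ω) (episode H D n ω) ∂P
          = ∫ ω, g (hist H D n ω) * m n (hist H D n ω) ∂P := by
        have hfi : ∀ h : Fin H, Integrable
            (fun ω => g (hist H D n ω) * f n h (hist H D n ω, (D n h ω).1, (D n h ω).2.1)) P :=
          fun h => integrable_of_abs_le ((hgm.comp hmh).mul ((hf n h).comp (hmh.prodMk
            ((hD.measurable_state hn' h.2).prodMk (hD.measurable_action hn' h.2))))) (c * 1)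
            fun ω => by
              rw [abs_mul, abs_of_nonneg (hg0 _), abs_of_nonneg (h0 _ _ _)]
              exact mul_le_mul (hgb _) (h1 _ _ _) (h0 _ _ _) hc0
        have hli : ∀ h : Fin H, Integrable (fun ω => g (hist H D n ω)
            * ∫ x, f n h (hist H D n ω, x) ∂(M.law ((μ n).run (hist H D n ω)) h)) P :=
          fun h => integrable_of_abs_le ((hgm.comp hmh).mul
            ((measurable_integral_law_run M (μ n) h (hf n h) (h0 n h)).comp hmh)) (c * 1)
            fun ω => by
              rw [abs_mul, abs_of_nonneg (hg0 _)]
              exact mul_le_mul (hgb _) (abs_integral_le_of_abs_le fun x => by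
                rw [abs_of_nonneg (h0 _ _ _)]; exact h1 _ _ _) (abs_nonneg _) hc0
        simp only [X, m, Finset.mul_sum, episode]
        rw [integral_finsetSum _ fun h _ => hfi h, integral_finsetSum _ fun h _ => hli h]
        refine Finset.sum_congr rfl fun h _ => ?_
        have hmf : Measurable fun y : History S A H n × S × A => g y.1 * f n h y :=
          (hgm.comp measurable_fst).mul (hf n h)
        have := hD.integral_law hn' h.2 hmf (c := c * 1)
          (fun y => mul_nonneg (hg0 _) (h0 _ _ _))
          (fun y => mul_le_mul (hgb _) (h1 _ _ _) (h0 _ _ _) hc0)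
        rw [this]
        simp_rw [integral_const_mul]
      calc ∫ ω, Real.exp (histSum ψ (n + 1) (hist H D (n + 1) ω)) ∂P
          ≤ ∫ ω, (g (hist H D n ω)
              - g (hist H D n ω) * X n (hist H D n ω) (episode H D n ω) / 2) ∂P := by
            refine integral_mono (hint _ hn) (hgi.sub (hXi.div_const 2)) fun ω => ?_
            beta_reduce
            rw [histSum_hist_succ]
            have e1 := exp_neg_le_one_sub_half (hX0 n (hist H D n ω) (episode H D n ω))
              (hsum n (hist H D n ω) (episode H D n ω))
            have e2 : histSum ψ n (hist H D n ω) + ψ n (hist H D n ω) (episode H D n ω)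
                = (histSum ψ n (hist H D n ω) + m n (hist H D n ω) / 2)
                  + -X n (hist H D n ω) (episode H D n ω) := by
              simp only [ψ]; ring
            rw [e2, Real.exp_add]
            have e3 := mul_le_mul_of_nonneg_left e1 (hg0 (hist H D n ω))
            refine e3.trans (le_of_eq ?_)
            ring
        _ = ∫ ω, (g (hist H D n ω) - g (hist H D n ω) * m n (hist H D n ω) / 2) ∂P := by
            rw [integral_sub hgi (hXi.div_const 2), integral_sub hgi (hmi.div_const 2),
              integral_div, integral_div, hXE]
        _ ≤ ∫ ω, Real.exp (histSum ψ n (hist H D n ω)) ∂P := by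
            refine integral_mono (hgi.sub (hmi.div_const 2)) (hint n hn'.le) fun ω => ?_
            beta_reduce
            have e1 : Real.exp (histSum ψ n (hist H D n ω))
                = g (hist H D n ω) * Real.exp (-(m n (hist H D n ω) / 2)) := by
              rw [← Real.exp_add]
              congr 1
              ring
            rw [e1]
            have e2 := Real.add_one_le_exp (-(m n (hist H D n ω) / 2))
            have e3 := mul_le_mul_of_nonneg_left e2 (hg0 (hist H D n ω))
            linarith
  refine (measure_mono fun ω hω => ?_).trans
    (measure_log_inv_le_of_integral_exp_le (hint K le_rfl) (key K le_rfl) hδ)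
  have hω : 2 * ∑ k ∈ Finset.range K, X k (hist H D k ω) (episode H D k ω)
      + 2 * Real.log (1 / δ) ≤ ∑ k ∈ Finset.range K, m k (hist H D k ω) := hω
  simp only [Set.mem_ofPred_eq, histSum_hist, ψ, Finset.sum_sub_distrib, ← Finset.sum_div]
  linarith

/-- The deviation of the regression target of step `h` from its conditional mean, recorded rewards
being clipped to `[0, 1]`. -/
noncomputable def noise (M : MDP S A ρ) {H : ℕ} (h : Fin H) (V : S → ℝ)
    (e : Fin H → Step S A) : ℝ :=
  max (min (e h).2.2 1) 0 + (if hh : (h : ℕ) + 1 < H then V (e ⟨h + 1, hh⟩).1 else 0)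
    - M.bellman h V (e h).1 (e h).2.1

theorem measurable_noise (M : MDP S A ρ) (h : Fin H) {V : S → ℝ} (hV : Measurable V) :
    Measurable (noise M h V) := by
  unfold noise
  refine Measurable.sub (Measurable.add ?_ ?_) ?_
  · exact ((measurable_pi_apply h).snd.snd.min measurable_const).max measurable_const
  · split_ifs with hh
    · exact hV.comp (measurable_pi_apply _).fst
    · exact measurable_const
  · exact (M.measurable_bellman h hV).comp
      ((measurable_pi_apply h).fst.prodMk (measurable_pi_apply h).snd.fst)

theorem abs_noise_le (M : MDP S A ρ) (h : Fin H) {V : S → ℝ} (hV : Measurable V)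
    (hb : ∀ s, V s ∈ Set.Icc (0 : ℝ) (H - (h + 1))) (e : Fin H → Step S A) :
    |noise M h V e| ≤ H := by
  have h1 := M.bellman_mem h hV hb (e h).1 (e h).2.1
  have h2 : max (min (e h).2.2 1) 0 ∈ Set.Icc (0 : ℝ) 1 :=
    ⟨le_max_right _ _, max_le (min_le_right _ _) zero_le_one⟩
  have h3 : (if hh : (h : ℕ) + 1 < H then V (e ⟨h + 1, hh⟩).1 else 0)
      ∈ Set.Icc (0 : ℝ) (H - (h + 1)) := by
    split_ifs with hh
    · exact hb _
    · refine ⟨le_rfl, ?_⟩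
      have : ((h : ℕ) : ℝ) + 1 ≤ H := by exact_mod_cast h.2
      linarith
  have h4 : (0 : ℝ) ≤ (h : ℕ) := by positivity
  unfold noise
  rw [abs_le]
  constructor <;> linarith [h1.1, h1.2, h2.1, h2.2, h3.1, h3.2]

/-- A factor known at the time of the action is pulled out of the conditional expectation of the
reward. -/
theorem integral_mul_reward (hD : IsAdaptiveData P M H K μ D) {t h : ℕ} (ht : t < K) (hh : h < H)
    {G : Ω → ℝ} (hGs : StronglyMeasurable[sigmaAction H D t h] G) (hGm : Measurable G)
    {c : ℝ} (hGb : ∀ ω, |G ω| ≤ c) :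
    Integrable (fun ω => G ω * (D t h ω).2.2) P ∧
      ∫ ω, G ω * (D t h ω).2.2 ∂P = ∫ ω, G ω * M.r h (D t h ω).1 (D t h ω).2.1 ∂P := by
  have hrm : Measurable fun ω => (D t h ω).2.2 := (hD.meas t ht h hh).snd.snd
  have hri : Integrable (fun ω => (D t h ω).2.2) P := by
    refine Integrable.of_bound hrm.aestronglyMeasurable 1 ?_
    filter_upwards [hD.reward_mem t ht h hh] with ω hω
    rw [Real.norm_eq_abs, abs_of_nonneg hω.1]
    exact hω.2
  have hGr : Integrable (fun ω => G ω * (D t h ω).2.2) P :=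
    hri.bdd_mul hGm.aestronglyMeasurable (Filter.Eventually.of_forall hGb)
  refine ⟨hGr, ?_⟩
  have h1 := condExp_mul_of_stronglyMeasurable_left hGs hGr hri
  rw [← integral_condExp (hD.measurable_upToAction ht hh).comap_le]
  refine integral_congr_ae ?_
  filter_upwards [h1, hD.reward_mean t ht h hh] with ω h2 h3
  refine Eq.trans h2 ?_
  rw [Pi.mul_apply, h3]

theorem integral_mul_next (hD : IsAdaptiveData P M H K μ D) {t h : ℕ} (ht : t < K)
    (hh : h + 1 < H) {V : S → ℝ} (hV : Measurable V) {b : ℝ} (hb : ∀ s, |V s| ≤ b)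
    {g : History S A H t × S × A → ℝ} (hg : Measurable g) {c : ℝ} (hc : ∀ x, |g x| ≤ c) :
    ∫ ω, g (hist H D t ω, (D t h ω).1, (D t h ω).2.1) * V (D t (h + 1) ω).1 ∂P
      = ∫ ω, g (hist H D t ω, (D t h ω).1, (D t h ω).2.1)
          * ∫ s', V s' ∂(M.next h (D t h ω).1 (D t h ω).2.1) ∂P := by
  have hgX : Measurable fun z : (History S A H t × (Fin h → Step S A) × S × A) × S =>
      g (z.1.1, z.1.2.2) := hg.comp (by fun_prop)
  have hpr : Measurable fun x : History S A H t × (Fin h → Step S A) × S × A =>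
      x.2.2 := by fun_prop
  have := integral_prodMk_eq (P := P) (κ := (M.nextKernel h).comap _ hpr)
    (hD.measurable_upToAction ht (by omega))
    (hD.measurable_state ht hh)
    (fun B hB => by
      simp only [Kernel.comap_apply, MDP.nextKernel_apply]
      exact hD.next t ht h hh B hB)
    (f := fun z => g (z.1.1, z.1.2.2) * V z.2)
    (hgX.mul (hV.comp measurable_snd)) (c * b)
    (fun z => by
      rw [abs_mul]
      exact mul_le_mul (hc _) (hb _) (abs_nonneg _) ((abs_nonneg _).trans (hc (z.1.1, z.1.2.2))))
  simp only [Kernel.comap_apply, MDP.nextKernel_apply, integral_const_mul] at this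
  exact this

/-- The noise has mean zero given everything up to the action. -/
theorem integral_mul_noise (hD : IsAdaptiveData P M H K μ D) {t : ℕ} (ht : t < K) (h : Fin H)
    {V : S → ℝ} (hV : Measurable V) (hb : ∀ s, V s ∈ Set.Icc (0 : ℝ) (H - (h + 1)))
    {g : History S A H t × S × A → ℝ} (hg : Measurable g) {c : ℝ} (hc : ∀ x, |g x| ≤ c) :
    ∫ ω, g (hist H D t ω, (D t h ω).1, (D t h ω).2.1) * noise M h V (episode H D t ω) ∂P = 0 := by
  have hh := h.2
  have hsa := (hD.measurable_state ht hh).prodMk (hD.measurable_action ht hh)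
  -- Clipping makes the noise bounded at every sample point and changes nothing almost surely.
  have hr01 : ∀ᵐ ω ∂P, max (min (D t h ω).2.2 1) 0 = (D t h ω).2.2 := by
    filter_upwards [hD.reward_mem t ht h hh] with ω hω
    rw [min_eq_left hω.2, max_eq_left hω.1]
  have hGs : StronglyMeasurable[sigmaAction H D t h]
      fun ω => g (hist H D t ω, (D t h ω).1, (D t h ω).2.1) := by
    have hgX : Measurable fun x : History S A H t × (Fin (h : ℕ) → Step S A) × S × A =>
      g (x.1, x.2.2) := hg.comp (by fun_prop)
    exact (hgX.comp (comap_measurable _)).stronglyMeasurable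
  have hGm : Measurable fun ω => g (hist H D t ω, (D t h ω).1, (D t h ω).2.1) :=
    hg.comp ((hD.measurable_hist ht.le).prodMk hsa)
  have hGb : ∀ ω, |g (hist H D t ω, (D t h ω).1, (D t h ω).2.1)| ≤ c := fun ω => hc _
  have part1 := hD.integral_mul_reward ht hh hGs hGm hGb
  have hVb : ∀ s, |V s| ≤ H - (h + 1) := fun s => by
    rw [abs_of_nonneg (hb s).1]; exact (hb s).2
  have hnext : ∫ ω, g (hist H D t ω, (D t h ω).1, (D t h ω).2.1)
        * (if (h : ℕ) + 1 < H then V (D t (h + 1) ω).1 else 0) ∂P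
      = ∫ ω, g (hist H D t ω, (D t h ω).1, (D t h ω).2.1)
          * ∫ s', V s' ∂(M.next h (D t h ω).1 (D t h ω).2.1) ∂P := by
    split_ifs with hh'
    · exact hD.integral_mul_next ht hh' hV hVb hg hc
    -- At the last step the prescribed range `[0, H - (h + 1)]` is `{0}`, so the absent next state
    -- contributes nothing on either side.
    · have hV0 : ∀ s, V s = 0 := fun s => by
        have h1 := hb s
        have h2 : (H : ℝ) ≤ (h : ℕ) + 1 := by exact_mod_cast not_lt.1 hh'
        exact le_antisymm (by linarith [h1.2]) h1.1
      simp [hV0]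
  have hNi : Integrable (fun ω => if (h : ℕ) + 1 < H then V (D t (h + 1) ω).1 else 0) P := by
    split_ifs with hh'
    · exact integrable_of_abs_le (hV.comp (hD.measurable_state ht hh')) _ fun ω => hVb _
    · exact integrable_const 0
  have hRi : Integrable (fun ω => M.r h (D t h ω).1 (D t h ω).2.1) P :=
    integrable_of_abs_le ((M.r_meas h).comp hsa) 1 fun ω => by
      have := M.r_mem h (D t h ω).1 (D t h ω).2.1
      exact (abs_of_nonneg this.1).le.trans this.2
  have hWm : Measurable fun ω => ∫ s', V s' ∂(M.next h (D t h ω).1 (D t h ω).2.1) := by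
    have := (M.measurable_integral_next h hV).comp hsa
    simpa only [Function.comp_def] using this
  have hWi : Integrable (fun ω => ∫ s', V s' ∂(M.next h (D t h ω).1 (D t h ω).2.1)) P :=
    integrable_of_abs_le hWm (H - (h + 1)) fun ω => abs_integral_le_of_abs_le hVb
  have e : ∀ᵐ ω ∂P, g (hist H D t ω, (D t h ω).1, (D t h ω).2.1)
        * noise M h V (episode H D t ω)
      = (g (hist H D t ω, (D t h ω).1, (D t h ω).2.1) * (D t h ω).2.2
          + g (hist H D t ω, (D t h ω).1, (D t h ω).2.1)
            * (if (h : ℕ) + 1 < H then V (D t (h + 1) ω).1 else 0))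
        - (g (hist H D t ω, (D t h ω).1, (D t h ω).2.1) * M.r h (D t h ω).1 (D t h ω).2.1
          + g (hist H D t ω, (D t h ω).1, (D t h ω).2.1)
            * ∫ s', V s' ∂(M.next h (D t h ω).1 (D t h ω).2.1)) := by
    filter_upwards [hr01] with ω hω
    have h1 : noise M h V (episode H D t ω) = max (min (D t h ω).2.2 1) 0
        + (if (h : ℕ) + 1 < H then V (D t (h + 1) ω).1 else 0)
        - (M.r h (D t h ω).1 (D t h ω).2.1
          + ∫ s', V s' ∂(M.next h (D t h ω).1 (D t h ω).2.1)) := by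
      simp only [noise, MDP.bellman, episode, dite_eq_ite]
    rw [h1, hω]
    ring
  have gN := hNi.bdd_mul hGm.aestronglyMeasurable (Filter.Eventually.of_forall hGb)
  have gR := hRi.bdd_mul hGm.aestronglyMeasurable (Filter.Eventually.of_forall hGb)
  have gW := hWi.bdd_mul hGm.aestronglyMeasurable (Filter.Eventually.of_forall hGb)
  refine (integral_congr_ae e).trans ((integral_add_sub_add part1.1 gN gR gW).trans ?_)
  rw [part1.2, hnext]
  ring

/-- Deviations of sums of noise in a fixed direction `l` of the features. -/
theorem measure_sum_noise_ge_le (hD : IsAdaptiveData P M H K μ D) {n : ℕ} (hn : n ≤ K) (h : Fin H)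
    {V : S → ℝ} (hV : Measurable V) (hb : ∀ s, V s ∈ Set.Icc (0 : ℝ) (H - (h + 1)))
    {l : S × A → ℝ} (hl : Measurable l) {c : ℝ} (hc : ∀ x, |l x| ≤ c) {δ : ℝ} (hδ : 0 < δ) :
    P {ω | Real.log (1 / δ) ≤ ∑ t ∈ Finset.range n,
        (l ((D t h ω).1, (D t h ω).2.1) * noise M h V (episode H D t ω)
          - (l ((D t h ω).1, (D t h ω).2.1) * H) ^ 2 / 2)} ≤ ENNReal.ofReal δ := by
  have hH : (0 : ℝ) < H := by exact_mod_cast (Nat.zero_le _).trans_lt h.2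
  let L : (Fin H → Step S A) → ℝ := fun e => l ((e h).1, (e h).2.1)
  let ψ : (n : ℕ) → History S A H n → (Fin H → Step S A) → ℝ := fun _ _ e =>
    L e * noise M h V e - (L e * H) ^ 2 / 2
  have hLm : Measurable L :=
    hl.comp ((measurable_pi_apply h).fst.prodMk (measurable_pi_apply h).snd.fst)
  have hψm : ∀ n, Measurable fun x : History S A H n × (Fin H → Step S A) => ψ n x.1 x.2 :=
    fun n => ((hLm.mul (measurable_noise M h hV)).sub
      (((hLm.mul_const _).pow_const 2).div_const 2)).comp measurable_snd
  have hnb := abs_noise_le M h hV hb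
  have hLb : ∀ e, |L e * H| ≤ c * H := fun e => by
    rw [abs_mul, abs_of_pos hH]
    exact mul_le_mul_of_nonneg_right (hc _) hH.le
  have hψb : ∀ k τ e, |ψ k τ e| ≤ c * H + (c * H) ^ 2 / 2 := fun k τ e => by
    refine (abs_sub _ _).trans (add_le_add ?_ ?_)
    · rw [abs_mul]
      exact mul_le_mul (hc _) (hnb e) (abs_nonneg _) ((abs_nonneg _).trans (hc ((e h).1, (e h).2.1)))
    · rw [abs_div, abs_pow, abs_two]
      exact div_le_div_of_nonneg_right (pow_le_pow_left₀ (abs_nonneg _) (hLb e) 2) two_pos.le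
  have hSm := measurable_histSum hψm
  set C := c * H + (c * H) ^ 2 / 2 with hC
  have hSb := abs_histSum_le hψb
  have hint : ∀ n ≤ K, Integrable (fun ω => Real.exp (histSum ψ n (hist H D n ω))) P :=
    fun n hn => integrable_of_abs_le (((hSm n).comp (hD.measurable_hist hn)).exp)
      (Real.exp (n * C)) fun ω => by
        rw [abs_of_pos (Real.exp_pos _)]
        exact Real.exp_le_exp.2 ((le_abs_self _).trans (hSb n _))
  have key : ∀ n ≤ K, ∫ ω, Real.exp (histSum ψ n (hist H D n ω)) ∂P ≤ 1 := by
    intro n hn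
    induction n with
    | zero => simp [histSum]
    | succ n ih =>
      have hn' : n < K := hn
      refine le_trans ?_ (ih hn'.le)
      -- The coefficient of the noise in the chord bound for the exponential. It depends only on
      -- earlier episodes and the current state and action, so its product with the noise integrates
      -- to zero.
      let g : History S A H n × S × A → ℝ := fun y =>
        Real.exp (histSum ψ n y.1) * (Real.exp (-((l y.2 * H) ^ 2 / 2))
          * (Real.sinh (l y.2 * H) / H))
      have hgm : Measurable g := by
        have h1 : Measurable fun y : History S A H n × S × A => l y.2 * H :=
          (hl.comp measurable_snd).mul_const _
        have h2 : Measurable fun y : History S A H n × S × A => Real.sinh (l y.2 * H) / H :=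
          (Real.continuous_sinh.measurable.comp h1).div_const _
        have h3 : Measurable fun y : History S A H n × S × A =>
            Real.exp (-((l y.2 * H) ^ 2 / 2)) := ((h1.pow_const 2).div_const 2).neg.exp
        exact ((hSm n).comp measurable_fst).exp.mul (h3.mul h2)
      have hgb : ∀ y, |g y| ≤ Real.exp (n * C) * (1 * (Real.cosh (c * H) / H)) := fun y => by
        simp only [g, abs_mul, abs_of_pos (Real.exp_pos _), abs_div, abs_of_pos hH]
        refine mul_le_mul (Real.exp_le_exp.2 ((le_abs_self _).trans (hSb n _))) ?_
          (by positivity) (Real.exp_pos _).le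
        refine mul_le_mul (Real.exp_le_one_iff.2 (by have := sq_nonneg (l y.2 * H); linarith)) ?_
          (by positivity) zero_le_one
        refine div_le_div_of_nonneg_right ?_ hH.le
        have h1 : |Real.sinh (l y.2 * H)| ≤ Real.cosh (l y.2 * H) := by
          rw [abs_le]
          have h2 := Real.cosh_add_sinh (l y.2 * H)
          have h3 := Real.cosh_sub_sinh (l y.2 * H)
          have h4 := Real.exp_pos (l y.2 * H)
          have h5 := Real.exp_pos (-(l y.2 * H))
          constructor <;> linarith
        refine h1.trans (Real.cosh_le_cosh.2 ?_)
        rw [abs_mul, abs_of_pos hH, abs_of_nonneg (a := c * H) (mul_nonneg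
          ((abs_nonneg _).trans (hc y.2)) hH.le)]
        exact mul_le_mul_of_nonneg_right (hc _) hH.le
      have hz := hD.integral_mul_noise hn' h hV hb hgm hgb
      have hzi : Integrable (fun ω => g (hist H D n ω, (D n h ω).1, (D n h ω).2.1)
          * noise M h V (episode H D n ω)) P := by
        refine integrable_of_abs_le ((hgm.comp ((hD.measurable_hist hn'.le).prodMk
          ((hD.measurable_state hn' h.2).prodMk (hD.measurable_action hn' h.2)))).mul
          ((measurable_noise M h hV).comp (hD.measurable_episode hn')))
          (Real.exp (n * C) * (1 * (Real.cosh (c * H) / H)) * H) fun ω => ?_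
        rw [abs_mul]
        exact mul_le_mul (hgb _) (hnb _) (abs_nonneg _) ((abs_nonneg _).trans
          (hgb (hist H D n ω, (D n h ω).1, (D n h ω).2.1)))
      calc ∫ ω, Real.exp (histSum ψ (n + 1) (hist H D (n + 1) ω)) ∂P
          ≤ ∫ ω, (Real.exp (histSum ψ n (hist H D n ω))
              + g (hist H D n ω, (D n h ω).1, (D n h ω).2.1)
                * noise M h V (episode H D n ω)) ∂P := by
            refine integral_mono (hint _ hn) ((hint n hn'.le).add hzi) fun ω => ?_
            beta_reduce
            rw [histSum_hist_succ, Real.exp_add]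
            have e1 := exp_mul_le_cosh_add (l := L (episode H D n ω)) hH
              (hnb (episode H D n ω))
            have e2 := Real.cosh_le_exp_half_sq (L (episode H D n ω) * H)
            set u := Real.exp (histSum ψ n (hist H D n ω))
            have hu : 0 ≤ u := (Real.exp_pos _).le
            set q := L (episode H D n ω) * H with hq
            set ε := noise M h V (episode H D n ω) with hε
            have e3 : ψ n (hist H D n ω) (episode H D n ω)
                = -(q ^ 2 / 2) + L (episode H D n ω) * ε := by
              simp only [ψ, hq, hε]; ring
            have e4 : g (hist H D n ω, (D n h ω).1, (D n h ω).2.1)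
                = u * (Real.exp (-(q ^ 2 / 2)) * (Real.sinh q / H)) := rfl
            -- The compensator `(l H)² / 2` absorbs the constant term, since `cosh q ≤ exp(q² / 2)`.
            have e5 : Real.exp (-(q ^ 2 / 2)) * Real.cosh q ≤ 1 := by
              rw [Real.exp_neg, inv_mul_le_iff₀ (Real.exp_pos _), mul_one]
              exact e2
            rw [e3, e4, Real.exp_add]
            have e6 : Real.exp (-(q ^ 2 / 2)) * Real.exp (L (episode H D n ω) * ε)
                ≤ 1 + Real.exp (-(q ^ 2 / 2)) * (Real.sinh q / H) * ε := by
              have := mul_le_mul_of_nonneg_left e1 (Real.exp_pos (-(q ^ 2 / 2))).le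
              linarith
            have e7 := mul_le_mul_of_nonneg_left e6 hu
            linarith
        _ = ∫ ω, Real.exp (histSum ψ n (hist H D n ω)) ∂P := by
            rw [integral_add (hint n hn'.le) hzi, hz, add_zero]
  refine (measure_mono fun ω hω => ?_).trans
    (measure_log_inv_le_of_integral_exp_le (hint n hn) (key n hn) hδ)
  simp only [Set.mem_ofPred_eq, histSum_hist]
  exact hω

end IsAdaptiveData

/-! ### Linear structure and stability of the estimates -/

section Estimates

open Matrix

variable {S A : Type*} [MeasurableSpace S] [MeasurableSpace A] {ρ : Measure S} [SigmaFinite ρ]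
  {H k d : ℕ} {φ : ℕ → S → A → EuclideanSpace ℝ (Fin d)} {M : MDP S A ρ}

theorem norm_eq_sqrt_dotProduct (x : EuclideanSpace ℝ (Fin d)) : ‖x‖ = √(x.ofLp ⬝ᵥ x.ofLp) := by
  rw [EuclideanSpace.norm_eq]
  simp [dotProduct, ← sq]

theorem inner_eq_dotProduct (x y : EuclideanSpace ℝ (Fin d)) : ⟪x, y⟫ = x.ofLp ⬝ᵥ y.ofLp := by
  rw [EuclideanSpace.inner_eq_star_dotProduct, dotProduct_comm]
  simp

namespace MDP.IsLinear

theorem dot_le_one (hlin : M.IsLinear H φ) {h : ℕ} (hh : h < H) (s : S) (a : A) :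
    (φ h s a).ofLp ⬝ᵥ (φ h s a).ofLp ≤ 1 := by
  have := hlin.norm_le h hh s a
  rw [norm_eq_sqrt_dotProduct, Real.sqrt_le_left (by norm_num)] at this
  simpa using this

theorem abs_apply_le_one (hlin : M.IsLinear H φ) {h : ℕ} (hh : h < H) (s : S) (a : A)
    (i : Fin d) : |(φ h s a).ofLp i| ≤ 1 := by
  have h1 := hlin.dot_le_one hh s a
  have h2 : (φ h s a).ofLp i * (φ h s a).ofLp i ≤ (φ h s a).ofLp ⬝ᵥ (φ h s a).ofLp :=
    Finset.single_le_sum (f := fun i => (φ h s a).ofLp i * (φ h s a).ofLp i)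
      (fun _ _ => mul_self_nonneg _) (Finset.mem_univ i)
  rw [← abs_one, ← sq_le_sq]
  nlinarith

theorem measurable_apply (hlin : M.IsLinear H φ) {h : ℕ} (hh : h < H) (i : Fin d) :
    Measurable fun x : S × A => (φ h x.1 x.2).ofLp i := by
  have h1 : Measurable fun x : EuclideanSpace ℝ (Fin d) => x.ofLp i :=
    (EuclideanSpace.proj (𝕜 := ℝ) i).continuous.measurable
  exact h1.comp (hlin.meas h hh)

/-- Zero-dimensional features would force the transition densities to vanish, but they integrate to
one. -/
theorem one_le_dim (hlin : M.IsLinear H φ) (hH : 0 < H) [Nonempty S] [Nonempty A] : 1 ≤ d := by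
  by_contra hd
  have hd0 : d = 0 := by omega
  subst hd0
  obtain ⟨m, -, -, hm, -⟩ := hlin.trans 0 hH
  have s := Classical.arbitrary S
  have a := Classical.arbitrary A
  have h1 := M.p_mass 0 s a
  have h2 : ∀ s', M.p 0 s a s' = 0 := fun s' => by
    have := hm s a s'
    rw [inner_eq_dotProduct] at this
    simpa [dotProduct] using this
  simp [h2] at h1

/-- Bellman backups are linear in the features. -/
theorem exists_bellman_eq (hlin : M.IsLinear H φ) {h : ℕ} (hh : h < H) {V : S → ℝ}
    (hV : Measurable V) {c : ℝ} (hc : ∀ s, |V s| ≤ c) :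
    ∃ w : Fin d → ℝ, √(w ⬝ᵥ w) ≤ √d * (1 + c) ∧
      ∀ s a, M.bellman h V s a = (φ h s a).ofLp ⬝ᵥ w := by
  obtain ⟨θ, hθ, hr⟩ := hlin.reward h hh
  obtain ⟨m, hm, hmi, hp, hb⟩ := hlin.trans h hh
  have hVm : Integrable (fun s => V s • m s) ρ :=
    hmi.bdd_smul c hV.aestronglyMeasurable (Filter.Eventually.of_forall hc)
  refine ⟨(θ + ∫ s, V s • m s ∂ρ).ofLp, ?_, fun s a => ?_⟩
  · rw [← norm_eq_sqrt_dotProduct]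
    refine (norm_add_le _ _).trans ?_
    have := hb V c hV hc
    linarith
  · rw [← inner_eq_dotProduct, inner_add_right, ← hr s a]
    unfold MDP.bellman
    congr 1
    have hpm : Measurable fun s' => M.p h s a s' :=
      (M.p_meas h).comp (measurable_prodMk_left (x := (s, a)))
    rw [← integral_inner hVm, MDP.next, integral_withDensity_eq_integral_smul hpm]
    refine integral_congr_ae (Filter.Eventually.of_forall fun s' => ?_)
    simp only [inner_smul_right]
    rw [← hp s a s', NNReal.smul_def, smul_eq_mul, mul_comm]

end MDP.IsLinear

/-- The features of step `h` recorded in `τ`. -/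
def featVec (φ : ℕ → S → A → EuclideanSpace ℝ (Fin d)) (τ : History S A H k) (h : Fin H)
    (t : Fin k) : Fin d → ℝ := (φ h (τ t h).1 (τ t h).2.1).ofLp

/-- `‖φ_h(s, a)‖²` in the norm of the inverse Gram matrix of `τ`. -/
noncomputable def invQuad (φ : ℕ → S → A → EuclideanSpace ℝ (Fin d)) (τ : History S A H k)
    (h : Fin H) (s : S) (a : A) : ℝ :=
  (φ h s a).ofLp ⬝ᵥ (gram φ 1 τ h)⁻¹ *ᵥ (φ h s a).ofLp

theorem gram_eq (τ : History S A H k) (h : Fin H) :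
    gram φ 1 τ h = ∑ t, vecMulVec (featVec φ τ h t) (featVec φ τ h t) + 1 := by
  simp [_root_.gram, featVec]

theorem gram_geOne (τ : History S A H k) (h : Fin H) : (gram φ 1 τ h).GeOne := by
  rw [gram_eq]
  exact geOne_sum_vecMulVec _

theorem bonus_eq (β : ℝ) (τ : History S A H k) (h : Fin H) (s : S) (a : A) :
    bonus φ 1 β τ h s a = β * √(invQuad φ τ h s a) := rfl

theorem invQuad_mem (hlin : M.IsLinear H φ) (τ : History S A H k) (h : Fin H) (s : S) (a : A) :
    invQuad φ τ h s a ∈ Set.Icc (0 : ℝ) 1 :=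
  ⟨(gram_geOne τ h).inv_quad_nonneg _,
    ((gram_geOne τ h).inv_quad_le _).trans (hlin.dot_le_one h.2 s a)⟩

theorem measurable_invQuad (hlin : M.IsLinear H φ) (h : Fin H) :
    Measurable fun x : History S A H k × S × A => invQuad φ x.1 h x.2.1 x.2.2 := by
  have hφ : ∀ i, Measurable fun x : S × A => (φ h x.1 x.2).ofLp i := hlin.measurable_apply h.2
  have hv : ∀ t i, Measurable fun x : History S A H k × S × A => featVec φ x.1 h t i := by
    intro t i
    have : Measurable fun x : History S A H k × S × A => ((x.1 t h).1, (x.1 t h).2.1) := by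
      have h1 : Measurable fun x : History S A H k × S × A => x.1 t h :=
        (measurable_pi_apply h).comp ((measurable_pi_apply t).comp measurable_fst)
      exact h1.fst.prodMk h1.snd.fst
    exact (hφ i).comp this
  have hG : ∀ i j, Measurable fun x : History S A H k × S × A => gram φ 1 x.1 h i j := by
    intro i j
    simp only [gram_eq, Matrix.add_apply, Matrix.sum_apply, vecMulVec_apply]
    exact (Finset.measurable_sum _ fun t _ => (hv t i).mul (hv t j)).add_const _
  have hGi := measurable_matrix_inv_apply hG
  have hφ2 : ∀ i, Measurable fun x : History S A H k × S × A => (φ h x.2.1 x.2.2).ofLp i :=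
    fun i => (hφ i).comp measurable_snd
  simp only [invQuad, dotProduct, mulVec]
  exact Finset.measurable_sum _ fun i _ => (hφ2 i).mul
    (Finset.measurable_sum _ fun j _ => (hGi i j).mul (hφ2 j))

theorem measurable_invQuad_left (hlin : M.IsLinear H φ) (τ : History S A H k) (h : Fin H) :
    Measurable fun x : S × A => invQuad φ τ h x.1 x.2 :=
  (measurable_invQuad hlin h).comp measurable_prodMk_left

theorem qHat_mem (lam β : ℝ) (τ : History S A H k) (h : Fin H) (V : S → ℝ) (s : S) (a : A) :
    qHat φ lam β τ h V s a ∈ Set.Icc (0 : ℝ) (H - h) := by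
  have : ((h : ℕ) : ℝ) ≤ H := by exact_mod_cast h.2.le
  exact ⟨le_max_right _ _, max_le (min_le_right _ _) (by linarith)⟩

theorem measurable_qHat (hlin : M.IsLinear H φ) (β : ℝ) (τ : History S A H k) (h : Fin H)
    (V : S → ℝ) : Measurable fun x : S × A => qHat φ 1 β τ h V x.1 x.2 := by
  have h1 : Measurable fun x : S × A => (φ h x.1 x.2).ofLp ⬝ᵥ wHat φ 1 τ h V :=
    Finset.measurable_sum _ fun i _ => (hlin.measurable_apply h.2 i).mul_const _
  have h2 : Measurable fun x : S × A => bonus φ 1 β τ h x.1 x.2 := by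
    simp only [bonus_eq]
    exact (measurable_invQuad_left hlin τ h).sqrt.const_mul _
  exact ((h1.sub h2).min measurable_const).max measurable_const

theorem vHat_eq (lam β : ℝ) (τ : History S A H k) (π : Policy S A) (h : Fin H) (s : S) :
    vHat φ lam β τ π (H - h) s = ∫ a, estQ φ lam β τ π h s a ∂(π.kernel h s) := by
  obtain ⟨h, hh⟩ := h
  obtain ⟨n, hn⟩ : ∃ n, H - h = n + 1 := ⟨H - h - 1, by omega⟩
  have h1 : h = H - (n + 1) := by omega
  simp only [hn, vHat]
  rw [dif_pos (by omega)]
  have h2 : H - (h + 1) = n := by omega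
  simp only [estQ, h2]
  subst h1
  rfl

theorem measurable_vHat (hlin : M.IsLinear H φ) (β : ℝ) (τ : History S A H k) (π : Policy S A)
    (n : ℕ) : Measurable (vHat φ 1 β τ π n) := by
  cases n with
  | zero => exact measurable_const
  | succ n =>
    by_cases hn : n + 1 ≤ H
    · have : vHat φ 1 β τ π (n + 1) = fun s => ∫ a, qHat φ 1 β τ ⟨H - (n + 1), by omega⟩
          (vHat φ 1 β τ π n) s a ∂(π.kernel (H - (n + 1)) s) := by
        ext s
        rw [vHat, dif_pos hn]
      rw [this]
      exact MDP.measurable_integral_policy π _ (measurable_qHat hlin β τ _ _)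
    · have : vHat φ 1 β τ π (n + 1) = fun _ => 0 := by
        ext s
        rw [vHat, dif_neg hn]
      rw [this]
      exact measurable_const

theorem vHat_mem (hlin : M.IsLinear H φ) (β : ℝ) (τ : History S A H k) (π : Policy S A)
    {h : ℕ} (hh : h ≤ H) (s : S) : vHat φ 1 β τ π (H - h) s ∈ Set.Icc (0 : ℝ) (H - h) := by
  rcases hh.lt_or_eq with hh | rfl
  · have := vHat_eq (φ := φ) 1 β τ π ⟨h, hh⟩ s
    simp only at this
    rw [this]
    exact integral_mem_Icc ((measurable_qHat hlin β τ ⟨h, hh⟩ _).comp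
      (measurable_prodMk_left (x := s))) fun a => qHat_mem 1 β τ ⟨h, hh⟩ _ s a
  · simp [vHat]

/-- The regression error in terms of the noise. -/
theorem abs_wHat_sub_bellman_le (hlin : M.IsLinear H φ) (τ : History S A H k) (h : Fin H)
    {V : S → ℝ} (hV : Measurable V) (hb : ∀ s, V s ∈ Set.Icc (0 : ℝ) (H - (h + 1)))
    (hr : ∀ t, (τ t h).2.2 ∈ Set.Icc (0 : ℝ) 1) {Z : Fin d → ℝ}
    (hZ : Z = ∑ t, IsAdaptiveData.noise M h V (τ t) • featVec φ τ h t) (s : S) (a : A) :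
    |(φ h s a).ofLp ⬝ᵥ wHat φ 1 τ h V - M.bellman h V s a|
      ≤ √(invQuad φ τ h s a) * (√(Z ⬝ᵥ (gram φ 1 τ h)⁻¹ *ᵥ Z) + √d * H) := by
  obtain ⟨w, hw, hbw⟩ := hlin.exists_bellman_eq h.2 hV (c := H - (h + 1)) fun s => by
    rw [abs_of_nonneg (hb s).1]; exact (hb s).2
  have h1 := abs_ridge_sub_le (featVec φ τ h)
    (fun t => (τ t h).2.2 + if hh : (h : ℕ) + 1 < H then V (τ t ⟨h + 1, hh⟩).1 else 0) w
    (φ h s a).ofLp (gram_eq τ h) (S := Z) (by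
      rw [hZ]
      refine Finset.sum_congr rfl fun t _ => ?_
      congr 1
      rw [IsAdaptiveData.noise, min_eq_left (hr t).2, max_eq_left (hr t).1, hbw]
      rfl)
  rw [hbw s a]
  refine h1.trans (mul_le_mul_of_nonneg_left (add_le_add le_rfl (hw.trans ?_))
    (Real.sqrt_nonneg _))
  have : (0 : ℝ) ≤ (h : ℕ) := by positivity
  exact mul_le_mul_of_nonneg_left (by linarith) (Real.sqrt_nonneg _)

/-- Subtracting the error bound puts the estimate below the target `T` and costs at most twice the
bound; truncating to a range that contains `T` preserves both inequalities. -/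
theorem qHat_le_of_error_le {β T x n c : ℝ} (hT : T ∈ Set.Icc 0 c)
    (h : |x - T| ≤ β * n) : max (min (x - β * n) c) 0 ≤ T ∧
      T ≤ max (min (x - β * n) c) 0 + 2 * β * n := by
  have h1 := abs_le.1 h
  have h2 : 0 ≤ β * n := (abs_nonneg _).trans h
  refine ⟨max_le ((min_le_left _ _).trans (by linarith)) hT.1, ?_⟩
  have h3 : T - 2 * β * n ≤ min (x - β * n) c := le_min (by linarith) (by linarith [hT.2])
  have h4 := le_max_left (min (x - β * n) c) 0
  linarith

theorem abs_qHat_sub_le {x x' u u' c : ℝ} :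
    |max (min (x - u) c) 0 - max (min (x' - u') c) 0| ≤ |x - x'| + |u - u'| := by
  refine (abs_max_sub_max_le_abs _ _ _).trans ?_
  refine (abs_min_sub_min_le_max _ _ _ _).trans ?_
  rw [sub_self, abs_zero, max_eq_left (abs_nonneg _)]
  have : x - u - (x' - u') = (x - x') - (u - u') := by ring
  rw [this]
  exact abs_sub _ _

/-- The bonus involves a square root, which is only Hölder continuous at zero; this is why the
discretization must be much finer than the precision wanted. -/
theorem abs_sqrt_sub_sqrt_le {a b : ℝ} (ha : 0 ≤ a) (hb : 0 ≤ b) : |√a - √b| ≤ √|a - b| := by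
  apply Real.abs_le_sqrt
  have h1 := Real.sq_sqrt ha
  have h2 := Real.sq_sqrt hb
  have h3 := Real.sqrt_nonneg a
  have h4 := Real.sqrt_nonneg b
  rcases le_total (√a) (√b) with h | h
  · rw [abs_of_nonpos (by nlinarith)]
    nlinarith
  · rw [abs_of_nonneg (by nlinarith)]
    nlinarith

theorem abs_dotProduct_le_of_abs_le {x y : Fin d → ℝ} {η : ℝ} (hx : ∀ i, |x i| ≤ 1)
    (hy : ∀ i, |y i| ≤ η) : |x ⬝ᵥ y| ≤ d * η := by
  refine (Finset.abs_sum_le_sum_abs _ _).trans ?_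
  refine (Finset.sum_le_sum (g := fun _ => η) fun i _ => ?_).trans (by simp)
  rw [abs_mul]
  have := mul_le_mul (hx i) (hy i) (abs_nonneg _) zero_le_one
  linarith

/-- The estimated values depend continuously on the regression parameters. -/
theorem abs_estQ_sub_le (hlin : M.IsLinear H φ) {β η : ℝ} (hβ : 0 ≤ β)
    (τ τ' : History S A H k) (π π' : Policy S A) (h : Fin H)
    (hw : ∀ i, |wHat φ 1 τ h (vHat φ 1 β τ π (H - (h + 1))) i
      - wHat φ 1 τ' h (vHat φ 1 β τ' π' (H - (h + 1))) i| ≤ η)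
    (hG : ∀ i j, |(gram φ 1 τ h)⁻¹ i j - (gram φ 1 τ' h)⁻¹ i j| ≤ η) (s : S) (a : A) :
    |estQ φ 1 β τ π h s a - estQ φ 1 β τ' π' h s a| ≤ d * η + β * √(d * (d * η)) := by
  have hφ := hlin.abs_apply_le_one h.2 s a
  refine (abs_qHat_sub_le).trans (add_le_add ?_ ?_)
  · rw [← dotProduct_sub]
    exact abs_dotProduct_le_of_abs_le hφ hw
  · rw [bonus_eq, bonus_eq, ← mul_sub, abs_mul, abs_of_nonneg hβ]
    refine mul_le_mul_of_nonneg_left ((abs_sqrt_sub_sqrt_le (invQuad_mem hlin τ h s a).1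
      (invQuad_mem hlin τ' h s a).1).trans (Real.sqrt_le_sqrt ?_)) hβ
    rw [invQuad, invQuad, ← dotProduct_sub, ← sub_mulVec]
    refine abs_dotProduct_le_of_abs_le hφ fun i => ?_
    rw [mulVec, dotProduct_comm]
    exact abs_dotProduct_le_of_abs_le hφ fun j => hG i j

theorem integrable_estQ (hlin : M.IsLinear H φ) (β : ℝ) (τ : History S A H k) (π π' : Policy S A)
    (h : Fin H) (s : S) : Integrable (fun a => estQ φ 1 β τ π h s a) (π'.kernel h s) := by
  refine integrable_of_abs_le ((measurable_qHat hlin β τ h _).comp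
    (measurable_prodMk_left (x := s))) (H - h) fun a => ?_
  have := qHat_mem (φ := φ) 1 β τ h (vHat φ 1 β τ π (H - (h + 1))) s a
  exact (abs_of_nonneg this.1).le.trans this.2

/-- At feasible states, the optimized estimated values depend continuously on the estimates. -/
theorem abs_vHat_sub_le (hlin : M.IsLinear H φ) {supp : ℕ → S → Set A} {β ε : ℝ}
    {τ τ' : History S A H k} {π π' : Policy S A} (hπ : IsCPVIOutput M supp φ 1 β τ π)
    (hπ' : IsCPVIOutput M supp φ 1 β τ' π') (h : Fin H) (s : S) (hs : M.Feasible h s)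
    (hQ : ∀ a, |estQ φ 1 β τ π h s a - estQ φ 1 β τ' π' h s a| ≤ ε) :
    |vHat φ 1 β τ π (H - h) s - vHat φ 1 β τ' π' (H - h) s| ≤ ε := by
  have key : ∀ {τ τ' : History S A H k} {π π' : Policy S A}, IsCPVIOutput M supp φ 1 β τ π →
      IsCPVIOutput M supp φ 1 β τ' π' →
      (∀ a, |estQ φ 1 β τ π h s a - estQ φ 1 β τ' π' h s a| ≤ ε) →
      vHat φ 1 β τ' π' (H - h) s - ε ≤ vHat φ 1 β τ π (H - h) s := by
    intro τ τ' π π' hπ hπ' hQ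
    rw [vHat_eq, vHat_eq]
    -- The maximizer for `τ` does at least as well as `π'`, whose estimated values under the two
    -- data sets differ by at most `ε`.
    have h1 := (hπ h).2 π' (hπ' h).1 s hs
    refine le_trans ?_ h1
    have h2 := integral_mono (μ := π'.kernel h s)
      ((integrable_estQ hlin β τ' π' π' h s).sub (integrable_const ε))
      (integrable_estQ hlin β τ π π' h s) fun a => by
        have := (abs_le.1 (hQ a)).1
        simp only [Pi.sub_apply]
        linarith
    have h3 : ∫ a, (estQ φ 1 β τ' π' h s a - ε) ∂(π'.kernel h s)
        = ∫ a, estQ φ 1 β τ' π' h s a ∂(π'.kernel h s) - ε := by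
      rw [integral_sub (integrable_estQ hlin β τ' π' π' h s) (integrable_const ε)]
      simp
    rw [← h3]
    exact h2
  have h1 := key hπ hπ' hQ
  have h2 := key hπ' hπ fun a => by rw [abs_sub_comm]; exact hQ a
  rw [abs_le]
  constructor <;> linarith

end Estimates

/-! ### Noise bounds uniform over data-dependent value estimates -/

section UniformNoise

open Matrix

variable {d n : ℕ}

/-- Pair the sum with itself and bound every term by `B` times its norm; one factor of the norm
cancels. -/
theorem sum_smul_dot_self_le {v : Fin n → Fin d → ℝ} (hv : ∀ t, v t ⬝ᵥ v t ≤ 1) {e : Fin n → ℝ}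
    {B : ℝ} (he : ∀ t, |e t| ≤ B) :
    (∑ t, e t • v t) ⬝ᵥ (∑ t, e t • v t) ≤ (n * B) ^ 2 := by
  set Z := ∑ t, e t • v t with hZ
  have h0 := dotProduct_self_nonneg_real Z
  have h1 : ∀ t, |v t ⬝ᵥ Z| ≤ √(Z ⬝ᵥ Z) := fun t => by
    refine Real.abs_le_sqrt ((sq_dotProduct_le (v t) Z).trans ?_)
    exact mul_le_of_le_one_left h0 (hv t)
  have h2 : Z ⬝ᵥ Z ≤ n * B * √(Z ⬝ᵥ Z) := by
    conv_lhs => rw [hZ, sum_dotProduct]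
    calc ∑ t, (e t • v t) ⬝ᵥ Z ≤ ∑ _t : Fin n, B * √(Z ⬝ᵥ Z) := by
          refine Finset.sum_le_sum fun t _ => ?_
          rw [smul_dotProduct, smul_eq_mul]
          refine (le_abs_self _).trans ?_
          rw [abs_mul]
          exact mul_le_mul (he t) (h1 t) (abs_nonneg _) ((abs_nonneg _).trans (he t))
      _ = n * B * √(Z ⬝ᵥ Z) := by simp; ring
  have h3 := Real.sq_sqrt h0
  have h4 := Real.sqrt_nonneg (Z ⬝ᵥ Z)
  rcases h4.eq_or_lt with h5 | h5
  · have h6 : Z ⬝ᵥ Z = 0 := by rw [← h3, ← h5]; simp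
    rw [h6]
    exact sq_nonneg _
  · have h6 : √(Z ⬝ᵥ Z) ≤ n * B := by
      have : √(Z ⬝ᵥ Z) * √(Z ⬝ᵥ Z) ≤ n * B * √(Z ⬝ᵥ Z) := by nlinarith
      exact le_of_mul_le_mul_right this h5
    rw [← h3]
    exact pow_le_pow_left₀ h4 h6 2

/-- The size of the direction in which the noise is largest. -/
theorem direction_dot_self_le {v : Fin n → Fin d → ℝ} (hv : ∀ t, v t ⬝ᵥ v t ≤ 1)
    {e : Fin n → ℝ} {B : ℝ} (hB : 1 ≤ B) (he : ∀ t, |e t| ≤ B) {G : Matrix (Fin d) (Fin d) ℝ}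
    (hG : G.GeOne) {x : Fin d → ℝ} (hx : x = (B ^ 2)⁻¹ • G⁻¹ *ᵥ ∑ t, e t • v t) :
    x ⬝ᵥ x ≤ n ^ 2 := by
  rw [hx, smul_dotProduct, dotProduct_smul, smul_eq_mul, smul_eq_mul]
  have h1 := (hG.inv_mulVec_le _).trans (sum_smul_dot_self_le hv he)
  have h2 : (1 : ℝ) ≤ B ^ 2 := one_le_pow₀ hB
  rw [inv_mul_le_iff₀ (by positivity), inv_mul_le_iff₀ (by positivity)]
  refine h1.trans ?_
  rw [mul_pow]
  have h3 : (0 : ℝ) ≤ (n : ℝ) ^ 2 := by positivity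
  nlinarith [mul_nonneg h3 (by linarith : (0 : ℝ) ≤ B ^ 2),
    mul_nonneg (mul_nonneg h3 (by linarith : (0 : ℝ) ≤ B ^ 2)) (by linarith : (0 : ℝ) ≤ B ^ 2 - 1)]

/-- A bound on the noise in the norm of the inverse Gram matrix, from bounds in a nearby direction
for a nearby noise. -/
theorem quad_noise_le {v : Fin n → Fin d → ℝ} (hv : ∀ t, v t ⬝ᵥ v t ≤ 1)
    {e e' : Fin n → ℝ} {B ε η L : ℝ} (hB : 1 ≤ B) (hee : ∀ t, |e t - e' t| ≤ 2 * ε)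
    {G : Matrix (Fin d) (Fin d) ℝ} (hG : G = ∑ t, vecMulVec (v t) (v t) + 1)
    {Z x x' : Fin d → ℝ} (hZ : Z = ∑ t, e t • v t) (hx : x = (B ^ 2)⁻¹ • G⁻¹ *ᵥ Z)
    (hxx : ∀ i, |x' i - x i| ≤ η) (hx' : x' ⬝ᵥ x' ≤ n ^ 2)
    (hL : ∑ t, (x' ⬝ᵥ v t * e' t - (x' ⬝ᵥ v t * B) ^ 2 / 2) ≤ L)
    (hε2 : n ^ 2 * ε ≤ 1) (hη2 : B ^ 2 * (n + 1) * d * η ^ 2 ≤ 2) :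
    Z ⬝ᵥ G⁻¹ *ᵥ Z ≤ 2 * B ^ 2 * (L + 3) := by
  have hg : G.GeOne := hG ▸ geOne_sum_vecMulVec v
  have hB2 : (0 : ℝ) < B ^ 2 := by positivity
  have key := hg.quad_max_le hB2 x' Z
  rw [← hx] at key
  have h1 : (x' - x) ⬝ᵥ G *ᵥ (x' - x) ≤ (n + 1) * (d * η ^ 2) := by
    rw [hG]
    refine (sum_vecMulVec_quad_le hv _).trans ?_
    rw [Fintype.card_fin]
    refine mul_le_mul_of_nonneg_left ?_ (by positivity)
    refine (Finset.sum_le_sum (g := fun _ => η ^ 2) fun i _ => ?_).trans (by simp)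
    rw [Pi.sub_apply, ← sq, ← sq_abs]
    exact pow_le_pow_left₀ (abs_nonneg _) (hxx i) 2
  have h2 : ∑ t, (x' ⬝ᵥ v t) ^ 2 ≤ x' ⬝ᵥ G *ᵥ x' := by
    rw [hG, sum_vecMulVec_quad]
    linarith [dotProduct_self_nonneg_real x']
  have h3 : ∀ t, |x' ⬝ᵥ v t| ≤ n := fun t => by
    refine abs_le_of_sq_le_sq ((sq_dotProduct_le x' (v t)).trans ?_) (by positivity)
    have := mul_le_mul hx' (hv t) (dotProduct_self_nonneg_real _) (by positivity)
    linarith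
  have h4 : x' ⬝ᵥ Z = ∑ t, x' ⬝ᵥ v t * e t := by
    rw [hZ, dotProduct_sum]
    exact Finset.sum_congr rfl fun t _ => by rw [dotProduct_smul, smul_eq_mul, mul_comm]
  have h5 : x' ⬝ᵥ Z ≤ ∑ t, x' ⬝ᵥ v t * e' t + 2 := by
    have : ∑ t, x' ⬝ᵥ v t * e t - ∑ t, x' ⬝ᵥ v t * e' t ≤ ∑ _t : Fin n, (n : ℝ) * (2 * ε) := by
      rw [← Finset.sum_sub_distrib]
      refine Finset.sum_le_sum fun t _ => ?_
      rw [← mul_sub]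
      refine (le_abs_self _).trans ?_
      rw [abs_mul]
      exact mul_le_mul (h3 t) (hee t) (abs_nonneg _) (by positivity)
    rw [h4]
    simp only [Finset.sum_const, Finset.card_univ, Fintype.card_fin, nsmul_eq_mul] at this
    linarith
  have h6 : ∑ t, (x' ⬝ᵥ v t * e' t - (x' ⬝ᵥ v t * B) ^ 2 / 2)
      = ∑ t, x' ⬝ᵥ v t * e' t - B ^ 2 / 2 * ∑ t, (x' ⬝ᵥ v t) ^ 2 := by
    rw [Finset.sum_sub_distrib, Finset.mul_sum]
    congr 1
    exact Finset.sum_congr rfl fun t _ => by ring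
  have h7 : B ^ 2 / 2 * ∑ t, (x' ⬝ᵥ v t) ^ 2 ≤ B ^ 2 / 2 * (x' ⬝ᵥ G *ᵥ x') := by gcongr
  have h8 : B ^ 2 / 2 * ((x' - x) ⬝ᵥ G *ᵥ (x' - x)) ≤ B ^ 2 / 2 * ((n + 1) * (d * η ^ 2)) := by
    gcongr
  have h9 : Z ⬝ᵥ G⁻¹ *ᵥ Z / (2 * B ^ 2) ≤ L + 3 := by
    rw [key]
    rw [h6] at hL
    linarith
  rw [div_le_iff₀ (by positivity)] at h9
  linarith

namespace IsAdaptiveData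

variable {S A Ω : Type*} [MeasurableSpace S] [MeasurableSpace A] [MeasurableSpace Ω]
  {ρ : Measure S} [SigmaFinite ρ] {P : Measure Ω} [IsProbabilityMeasure P] {M : MDP S A ρ}
  {H K : ℕ} {μ : (t : ℕ) → AdaptivePolicy S A H t} {D : ℕ → ℕ → Ω → Step S A}
  {φ : ℕ → S → A → EuclideanSpace ℝ (Fin d)}

/-- The reward terms cancel; the difference of the value estimates enters once at the recorded next
state and once through its mean, each contributing `ε`. -/
theorem abs_noise_sub_le (h : Fin H) {V V' : S → ℝ} (hV : Measurable V) (hV' : Measurable V')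
    (hb : ∀ s, V s ∈ Set.Icc (0 : ℝ) (H - (h + 1)))
    (hb' : ∀ s, V' s ∈ Set.Icc (0 : ℝ) (H - (h + 1))) {ε : ℝ} (hε : 0 ≤ ε)
    (hVV : (h : ℕ) + 1 < H → ∀ s, M.Feasible (h + 1) s → |V s - V' s| ≤ ε)
    {e : Fin H → Step S A}
    (hf : ∀ hh : (h : ℕ) + 1 < H, M.Feasible (h + 1) (e ⟨h + 1, hh⟩).1)
    (hf' : (h : ℕ) + 1 < H → ∀ᵐ s' ∂(M.next h (e h).1 (e h).2.1), M.Feasible (h + 1) s') :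
    |noise M h V e - noise M h V' e| ≤ 2 * ε := by
  have i1 : Integrable V (M.next h (e h).1 (e h).2.1) :=
    integrable_of_abs_le hV (H - (h + 1)) fun s => by
      rw [abs_of_nonneg (hb s).1]; exact (hb s).2
  have i2 : Integrable V' (M.next h (e h).1 (e h).2.1) :=
    integrable_of_abs_le hV' (H - (h + 1)) fun s => by
      rw [abs_of_nonneg (hb' s).1]; exact (hb' s).2
  by_cases hh : (h : ℕ) + 1 < H
  · have h1 : noise M h V e - noise M h V' e
        = (V (e ⟨h + 1, hh⟩).1 - V' (e ⟨h + 1, hh⟩).1)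
          - ∫ s', (V s' - V' s') ∂(M.next h (e h).1 (e h).2.1) := by
      rw [integral_sub i1 i2]
      simp only [noise, MDP.bellman, dif_pos hh]
      ring
    have h2 : |∫ s', (V s' - V' s') ∂(M.next h (e h).1 (e h).2.1)| ≤ ε := by
      have := norm_integral_le_of_norm_le_const (μ := M.next h (e h).1 (e h).2.1)
        (f := fun s' => V s' - V' s') ((hf' hh).mono fun s' hs' => hVV hh s' hs')
      simpa using this
    rw [h1]
    exact (abs_sub _ _).trans (by linarith [hVV hh _ (hf hh)])
  · have hz : ∀ {V : S → ℝ}, (∀ s, V s ∈ Set.Icc (0 : ℝ) (H - (h + 1))) → V = fun _ => 0 := by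
      intro V hb
      ext s
      have h1 := hb s
      have h2 : (H : ℝ) ≤ (h : ℕ) + 1 := by exact_mod_cast not_lt.1 hh
      exact le_antisymm (by linarith [h1.2]) h1.1
    rw [hz hb, hz hb', sub_self, abs_zero]
    linarith

/-- The vector of the noise of step `h`, with value estimate `V`. -/
noncomputable def noiseVec (M : MDP S A ρ) (φ : ℕ → S → A → EuclideanSpace ℝ (Fin d))
    {k : ℕ} (h : Fin H) (V : S → ℝ) (τ : History S A H k) : Fin d → ℝ :=
  ∑ t, noise M h V (τ t) • featVec φ τ h t

/-- A bound on the noise that is uniform over random value estimates: up to `ε`, these are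
determined by parameters `y` that are known up to `η`. -/
theorem exists_uniform_noise_bound (hD : IsAdaptiveData P M H K μ D) (hlin : M.IsLinear H φ)
    (hn : n ≤ K) (h : Fin H) {ι : Type} [Fintype ι] {Γ : Set Ω} {V : Ω → S → ℝ}
    (hVm : ∀ ω ∈ Γ, Measurable (V ω))
    (hVb : ∀ ω ∈ Γ, ∀ s, V ω s ∈ Set.Icc (0 : ℝ) (H - (h + 1)))
    {y : Ω → ι → ℝ} {R η ε : ℝ} (hη : 0 < η) (hε : 0 ≤ ε) (hy : ∀ ω ∈ Γ, ∀ i, |y ω i| ≤ R)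
    (hR : n ≤ R)
    (hVV : ∀ ω ∈ Γ, ∀ ω' ∈ Γ, (∀ i, |y ω i - y ω' i| ≤ η) →
      (h : ℕ) + 1 < H → ∀ s, M.Feasible (h + 1) s → |V ω s - V ω' s| ≤ ε)
    (hf : ∀ ω ∈ Γ, ∀ t < n, (h : ℕ) + 1 < H → M.Feasible (h + 1) (D t (h + 1) ω).1 ∧
      ∀ᵐ s' ∂(M.next h (D t h ω).1 (D t h ω).2.1), M.Feasible (h + 1) s')
    (hε2 : n ^ 2 * ε ≤ 1) (hη2 : H ^ 2 * (n + 1) * d * η ^ 2 ≤ 2) {N : ℕ} (hN : R / η + 1 ≤ N)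
    {δ : ℝ} (hδ : 0 < δ) :
    ∃ B : Set Ω, P B ≤ ENNReal.ofReal δ ∧ ∀ ω ∈ Γ, ω ∉ B →
      noiseVec M φ h (V ω) (hist H D n ω) ⬝ᵥ (gram φ 1 (hist H D n ω) h)⁻¹ *ᵥ
          noiseVec M φ h (V ω) (hist H D n ω)
        ≤ 2 * H ^ 2 * (Real.log ((2 * N + 1) ^ (Fintype.card ι + d) / δ) + 3) := by
  classical
  have hH1 : (1 : ℝ) ≤ H := by exact_mod_cast (Nat.zero_le _).trans_lt h.2
  -- The direction that maximizes the concave function representing the quadratic form; it is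
  -- random, so it is discretized together with the parameters `y`.
  set x : Ω → Fin d → ℝ := fun ω => ((H : ℝ) ^ 2)⁻¹ • (gram φ 1 (hist H D n ω) h)⁻¹ *ᵥ
    noiseVec M φ h (V ω) (hist H D n ω) with hx
  set z : Ω → ι ⊕ Fin d → ℝ := fun ω => Sum.elim (y ω) (x ω) with hz
  set cell : Ω → ι ⊕ Fin d → ℤ := fun ω i => ⌊z ω i / η⌋ with hcell
  set T : Finset (ι ⊕ Fin d → ℤ) := Fintype.piFinset fun _ => Finset.Icc (-(N : ℤ)) N with hT
  have hTcard : (T.card : ℝ) = (2 * N + 1) ^ (Fintype.card ι + d) := by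
    have h1 : T.card = (2 * N + 1) ^ (Fintype.card ι + d) := by
      rw [hT, Fintype.card_piFinset]
      simp only [Int.card_Icc, Finset.prod_const, Finset.card_univ, Fintype.card_sum,
        Fintype.card_fin]
      congr 1
      omega
    rw [h1]
    push_cast
    rfl
  have hTpos : (0 : ℝ) < T.card := by rw [hTcard]; positivity
  have hv : ∀ ω (t : Fin n), featVec φ (hist H D n ω) h t ⬝ᵥ featVec φ (hist H D n ω) h t ≤ 1 :=
    fun ω t => hlin.dot_le_one h.2 _ _
  have hxx : ∀ ω ∈ Γ, x ω ⬝ᵥ x ω ≤ n ^ 2 := fun ω hω =>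
    direction_dot_self_le (hv ω) hH1 (fun t => abs_noise_le M h (hVm ω hω) (hVb ω hω) _)
      (gram_geOne _ h) rfl
  have hzR : ∀ ω ∈ Γ, ∀ i, |z ω i| ≤ R := fun ω hω i => by
    rcases i with i | i
    · exact hy ω hω i
    · refine le_trans ?_ hR
      refine abs_le_of_sq_le_sq ?_ (by positivity)
      refine le_trans ?_ (hxx ω hω)
      rw [sq]
      exact Finset.single_le_sum (f := fun i => x ω i * x ω i) (fun _ _ => mul_self_nonneg _)
        (Finset.mem_univ i)
  have hmem : ∀ ω ∈ Γ, cell ω ∈ T := fun ω hω => by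
    rw [hT, Fintype.mem_piFinset]
    intro i
    have h1 := abs_le.1 (hzR ω hω i)
    have h2 : z ω i / η ≤ R / η := div_le_div_of_nonneg_right h1.2 hη.le
    have h3 : -(R / η) ≤ z ω i / η := by
      rw [← neg_div]; exact div_le_div_of_nonneg_right h1.1 hη.le
    rw [Finset.mem_Icc]
    constructor
    · refine Int.le_floor.2 ?_
      push_cast
      linarith
    · have : ((⌊z ω i / η⌋ : ℤ) : ℝ) ≤ N := (Int.floor_le _).trans (by linarith)
      exact_mod_cast this
  have hlm : ∀ u : Fin d → ℝ, Measurable fun p : S × A => u ⬝ᵥ (φ h p.1 p.2).ofLp := fun u =>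
    Finset.measurable_sum _ fun i _ => (hlin.measurable_apply h.2 i).const_mul _
  have hlb : ∀ (u : Fin d → ℝ) (p : S × A), |u ⬝ᵥ (φ h p.1 p.2).ofLp| ≤ √(u ⬝ᵥ u) := fun u p => by
    refine Real.abs_le_sqrt ((sq_dotProduct_le _ _).trans ?_)
    exact mul_le_of_le_one_right (dotProduct_self_nonneg_real u) (hlin.dot_le_one h.2 _ _)
  have hδc : 0 < δ / T.card := by positivity
  -- Each inhabited cell gets a representative sample point, whose value estimate and direction are
  -- deterministic objects, so the fixed-direction bound applies to them. No measurability of the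
  -- random estimates in the sample is needed.
  let bad : (ι ⊕ Fin d → ℤ) → Set Ω := fun c =>
    if hc : ∃ ω ∈ Γ, cell ω = c then
      {ω | Real.log (1 / (δ / T.card)) ≤ ∑ t ∈ Finset.range n,
        (x hc.choose ⬝ᵥ (φ h (D t h ω).1 (D t h ω).2.1).ofLp
            * noise M h (V hc.choose) (episode H D t ω)
          - (x hc.choose ⬝ᵥ (φ h (D t h ω).1 (D t h ω).2.1).ofLp * H) ^ 2 / 2)}
    else ∅
  have hbad : ∀ c, P (bad c) ≤ ENNReal.ofReal (δ / T.card) := fun c => by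
    simp only [bad]
    split_ifs with hc
    · have hc' := hc.choose_spec.1
      exact hD.measure_sum_noise_ge_le hn h (hVm _ hc') (hVb _ hc') (hlm (x hc.choose))
        (hlb (x hc.choose)) hδc
    · simp
  refine ⟨⋃ c ∈ T, bad c, ?_, fun ω hω hωB => ?_⟩
  · refine (measure_biUnion_finset_le T bad).trans ((Finset.sum_le_sum fun c _ => hbad c).trans ?_)
    rw [Finset.sum_const, nsmul_eq_mul, ← ENNReal.ofReal_natCast, ← ENNReal.ofReal_mul (by simp)]
    refine ENNReal.ofReal_le_ofReal (le_of_eq ?_)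
    field_simp
  · have hnot : ω ∉ bad (cell ω) := fun hb => hωB (Set.mem_biUnion (hmem ω hω) hb)
    have hc : ∃ ω' ∈ Γ, cell ω' = cell ω := ⟨ω, hω, rfl⟩
    simp only [bad, dif_pos hc] at hnot
    set ω' := hc.choose with hω'
    have hω'Γ : ω' ∈ Γ := hc.choose_spec.1
    have hcc : cell ω' = cell ω := hc.choose_spec.2
    -- Sample points of the same cell have parameters within the mesh size, so the bound for the
    -- representative transfers.
    have hzz : ∀ i, |z ω i - z ω' i| ≤ η := fun i => by
      have h1 := Int.abs_sub_lt_one_of_floor_eq_floor (congrFun hcc i).symm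
      rw [← sub_div, abs_div, abs_of_pos hη, div_lt_one hη] at h1
      exact h1.le
    have hL : ∑ t : Fin n, (x ω' ⬝ᵥ featVec φ (hist H D n ω) h t
          * noise M h (V ω') (hist H D n ω t)
        - (x ω' ⬝ᵥ featVec φ (hist H D n ω) h t * H) ^ 2 / 2)
        ≤ Real.log ((2 * N + 1) ^ (Fintype.card ι + d) / δ) := by
      have h1 : ¬ Real.log (1 / (δ / T.card)) ≤ ∑ t ∈ Finset.range n,
        (x ω' ⬝ᵥ (φ h (D t h ω).1 (D t h ω).2.1).ofLp * noise M h (V ω') (episode H D t ω)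
          - (x ω' ⬝ᵥ (φ h (D t h ω).1 (D t h ω).2.1).ofLp * H) ^ 2 / 2) := hnot
      rw [Finset.sum_range, one_div_div, hTcard] at h1
      exact (not_le.1 h1).le
    refine quad_noise_le (hv ω) hH1
      (e' := fun t => noise M h (V ω') (hist H D n ω t)) (fun t => ?_) (gram_eq _ h) rfl
      (x := x ω) rfl (fun i => ?_) (hxx ω' hω'Γ) hL hε2 hη2
    · exact abs_noise_sub_le h (hVm ω hω) (hVm ω' hω'Γ) (hVb ω hω) (hVb ω' hω'Γ) hε
        (hVV ω hω ω' hω'Γ fun i => hzz (Sum.inl i)) (fun hh => (hf ω hω t t.2 hh).1)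
        fun hh => (hf ω hω t t.2 hh).2
    · have := hzz (Sum.inr i)
      rw [abs_sub_comm]
      exact this

end IsAdaptiveData

end UniformNoise

/-! ### The bonus dominates the regression error -/

section Pessimism

open Matrix

theorem one_le_three_halves_mul_log {u : ℝ} (hu : 2 ≤ u) : 1 ≤ 3 / 2 * Real.log u := by
  have h1 := Real.log_two_gt_d9
  have h2 := Real.log_le_log (by norm_num) hu
  linarith

/-- The numerical conditions on the discretization of the estimates. -/
theorem exists_discretization {d H n δ β : ℝ} {u : ℝ} (hd : 1 ≤ d) (hH : 1 ≤ H) (hn : 1 ≤ n)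
    (hδ0 : 0 < δ) (hδ1 : δ ≤ 1) (hu : u = d * H * (n + 1) / δ)
    (hβ : β = 30 * d * H * Real.log u) :
    2 ≤ u ∧ 0 ≤ β ∧ ∃ η : ℝ, 0 < η ∧ n ^ 2 * (d * η + β * √(d * (d * η))) ≤ 1 ∧
      H ^ 2 * (n + 1) * d * η ^ 2 ≤ 2 ∧
      ∃ N : ℕ, n * H / η + 1 ≤ N ∧ (2 * N + 1 : ℝ) ≤ u ^ 31 := by
  have hdH : 1 ≤ d * H := one_le_mul_of_one_le_of_one_le hd hH
  have h0 : d * H * (n + 1) ≤ u := by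
    rw [hu, le_div_iff₀ hδ0]
    exact mul_le_of_le_one_right (by positivity) hδ1
  have hdHu : d * H ≤ u := by nlinarith
  have hdu : d ≤ u := by nlinarith
  have hHu : H ≤ u := by nlinarith
  have hnu : n + 1 ≤ u := by nlinarith
  have hu2 : 2 ≤ u := by linarith
  have hu0 : 0 < u := by linarith
  have hL0 : 0 ≤ Real.log u := Real.log_nonneg (by linarith)
  have hLu : Real.log u ≤ u := (Real.log_le_sub_one_of_pos hu0).trans (by linarith)
  have hβ0 : 0 ≤ β := by rw [hβ]; positivity
  have hβu : β ≤ u ^ 7 := by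
    calc β = 30 * ((d * H) * Real.log u) := by rw [hβ]; ring
      _ ≤ 30 * (u * u) := by gcongr
      _ ≤ 2 ^ 5 * (u * u) := by nlinarith
      _ ≤ u ^ 5 * (u * u) := by gcongr
      _ = u ^ 7 := by ring
  -- The even power makes `√η = u⁻¹³` explicit: the bonus contribution `n² β d √η` is at most `u^(2
  -- + 7 + 1 - 13) = u⁻³`. The box has radius `nH ≤ u²`, so `nH / η ≤ u²⁸`.
  refine ⟨hu2, hβ0, (u ^ 26)⁻¹, by positivity, ?_, ?_, ⌈u ^ 28 + 1⌉₊, ?_, ?_⟩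
  · have h1 : √(d * (d * (u ^ 26)⁻¹)) = d * (u ^ 13)⁻¹ := by
      rw [show d * (d * (u ^ 26)⁻¹) = (d * (u ^ 13)⁻¹) ^ 2 by field_simp]
      exact Real.sqrt_sq (by positivity)
    rw [h1]
    have h2 : n ^ 2 ≤ u ^ 2 := pow_le_pow_left₀ (by linarith) (by linarith) 2
    calc n ^ 2 * (d * (u ^ 26)⁻¹ + β * (d * (u ^ 13)⁻¹))
        ≤ u ^ 2 * (u * (u ^ 26)⁻¹ + u ^ 7 * (u * (u ^ 13)⁻¹)) := by gcongr
      _ = (u ^ 23)⁻¹ + (u ^ 3)⁻¹ := by field_simp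
      _ ≤ (2 ^ 23)⁻¹ + (2 ^ 3)⁻¹ := by gcongr
      _ ≤ 1 := by norm_num
  · calc H ^ 2 * (n + 1) * d * (u ^ 26)⁻¹ ^ 2 ≤ u ^ 2 * u * u * (u ^ 26)⁻¹ ^ 2 := by gcongr
      _ = (u ^ 48)⁻¹ := by field_simp
      _ ≤ 1 := inv_le_one_of_one_le₀ (one_le_pow₀ (by linarith))
      _ ≤ 2 := by norm_num
  · refine le_trans ?_ (Nat.le_ceil _)
    rw [div_inv_eq_mul]
    have : n * H ≤ u * u := by
      have : n ≤ u := by linarith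
      gcongr
    calc n * H * u ^ 26 + 1 ≤ u * u * u ^ 26 + 1 := by gcongr
      _ = u ^ 28 + 1 := by ring
  · have h1 := (Nat.ceil_lt_add_one (a := u ^ 28 + 1) (by positivity)).le
    have h2 : (2 : ℝ) ^ 28 ≤ u ^ 28 := by gcongr
    have h3 : (2 : ℝ) ^ 3 ≤ u ^ 3 := by gcongr
    have h4 : u ^ 31 = u ^ 28 * u ^ 3 := by ring
    have h5 : (0 : ℝ) ≤ u ^ 28 := by positivity
    rw [h4]
    have h6 : u ^ 28 * 2 ^ 3 ≤ u ^ 28 * u ^ 3 := by gcongr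
    norm_num at h2 h6
    linarith

/-- The resulting bound on the regression error. -/
theorem sqrt_noise_add_le {d H n : ℕ} {δ u q : ℝ} (hd : 1 ≤ d) (hH : 1 ≤ H) (hn : 1 ≤ n)
    (hδ0 : 0 < δ) (hδ1 : δ ≤ 1) (hu : u = d * H * (n + 1) / δ) {N : ℕ}
    (hN : (2 * N + 1 : ℝ) ≤ u ^ 31)
    (hq : q ≤ 2 * H ^ 2 * (Real.log ((2 * N + 1) ^ (d + d * d + d)
      / (δ / (2 * H * (n * (n + 1))))) + 3)) :
    √q + √d * H ≤ 30 * d * H * Real.log u := by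
  have hd' : (1 : ℝ) ≤ d := by exact_mod_cast hd
  have hH' : (1 : ℝ) ≤ H := by exact_mod_cast hH
  have hn' : (1 : ℝ) ≤ n := by exact_mod_cast hn
  obtain ⟨hu2, -⟩ := exists_discretization hd' hH' hn' hδ0 hδ1 hu rfl
  have hu0 : 0 < u := by linarith
  set L := Real.log u with hL
  have hL1 := one_le_three_halves_mul_log hu2
  rw [← hL] at hL1
  have hL0 : 0 < L := by linarith
  -- The exponent is `31 (2d + d²) ≤ 93 d²`, and the factor from the union over steps and episodes
  -- is at most `u³`.
  have hlog : Real.log ((2 * N + 1) ^ (d + d * d + d) / (δ / (2 * H * (n * (n + 1)))))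
      ≤ 96 * d ^ 2 * L := by
    have h1 : (2 * N + 1 : ℝ) ^ (d + d * d + d) ≤ u ^ (93 * d ^ 2) := by
      calc (2 * N + 1 : ℝ) ^ (d + d * d + d) ≤ (u ^ 31) ^ (d + d * d + d) := by gcongr
        _ = u ^ (31 * (d + d * d + d)) := by rw [pow_mul]
        _ ≤ u ^ (93 * d ^ 2) := pow_le_pow_right₀ (by linarith) (by nlinarith)
    have h2 : (2 * H * (n * (n + 1)) : ℝ) / δ ≤ u ^ 3 := by
      have e1 : (H * (n + 1) : ℝ) / δ ≤ u := by
        rw [hu]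
        gcongr
        nlinarith
      have e2 : (n : ℝ) ≤ u := by
        rw [hu, le_div_iff₀ hδ0]
        have := one_le_mul_of_one_le_of_one_le hd' hH'
        nlinarith
      calc (2 * H * (n * (n + 1)) : ℝ) / δ = 2 * n * (H * (n + 1) / δ) := by ring
        _ ≤ u * u * u := by gcongr
        _ = u ^ 3 := by ring
    have h3 : (2 * N + 1 : ℝ) ^ (d + d * d + d) / (δ / (2 * H * (n * (n + 1))))
        ≤ u ^ (96 * d ^ 2) := by
      rw [div_div_eq_mul_div, mul_div_assoc]
      calc (2 * N + 1 : ℝ) ^ (d + d * d + d) * ((2 * H * (n * (n + 1))) / δ)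
          ≤ u ^ (93 * d ^ 2) * u ^ 3 := by gcongr
        _ = u ^ (93 * d ^ 2 + 3) := by rw [pow_add]
        _ ≤ u ^ (96 * d ^ 2) := pow_le_pow_right₀ (by linarith) (by nlinarith)
    refine (Real.log_le_log (by positivity) h3).trans (le_of_eq ?_)
    rw [Real.log_pow]
    push_cast
    ring
  -- The noise takes `20` of the constant `30`, as `2 · 200 = 20²`; the remaining `10` covers the
  -- regularization bias `√d H`.
  have h4 : √q ≤ 20 * d * H * L := by
    refine Real.sqrt_le_iff.2 ⟨by positivity, hq.trans ?_⟩
    have h5 : (1 : ℝ) ≤ d ^ 2 := one_le_pow₀ hd'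
    have h6 : 96 * (d : ℝ) ^ 2 * L + 3 ≤ 200 * d ^ 2 * L ^ 2 := by
      have e1 : (d : ℝ) ^ 2 * L ≤ d ^ 2 * (L * (3 / 2 * L)) := by
        gcongr
        exact le_mul_of_one_le_right hL0.le hL1
      have e2 : (1 : ℝ) ≤ d ^ 2 * (3 / 2 * L) ^ 2 :=
        one_le_mul_of_one_le_of_one_le h5 (one_le_pow₀ hL1)
      nlinarith
    calc 2 * (H : ℝ) ^ 2 * (_ + 3) ≤ 2 * (H : ℝ) ^ 2 * (96 * d ^ 2 * L + 3) := by gcongr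
      _ ≤ 2 * (H : ℝ) ^ 2 * (200 * d ^ 2 * L ^ 2) := by gcongr
      _ = (20 * d * H * L) ^ 2 := by ring
  have h7 : √(d : ℝ) * H ≤ 10 * d * H * L := by
    have e1 : √(d : ℝ) ≤ d := by
      rw [Real.sqrt_le_iff]
      exact ⟨by positivity, by nlinarith⟩
    calc √(d : ℝ) * H ≤ d * H * (3 / 2 * L) := by
          refine le_trans (mul_le_mul_of_nonneg_right e1 (by positivity)) ?_
          exact le_mul_of_one_le_right (by positivity) hL1
      _ ≤ 10 * d * H * L := by
          have : 0 ≤ (d : ℝ) * H * L := by positivity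
          nlinarith
  linarith

variable {S A Ω : Type*} [MeasurableSpace S] [MeasurableSpace A] [MeasurableSpace Ω]
  {ρ : Measure S} [SigmaFinite ρ] {P : Measure Ω} [IsProbabilityMeasure P] {M : MDP S A ρ}
  {H K d : ℕ} {μ : (t : ℕ) → AdaptivePolicy S A H t} {D : ℕ → ℕ → Ω → Step S A}
  {φ : ℕ → S → A → EuclideanSpace ℝ (Fin d)} {supp : ℕ → S → Set A} {δ : ℝ}
  {πhat : (k : ℕ) → AdaptivePolicy S A H k}

/-- The inverse Gram matrix is a contraction and the `k` regression targets are at most `H`; this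
bounds the box in which `ŵ` is discretized. -/
theorem abs_wHat_apply_le {k : ℕ} (hlin : M.IsLinear H φ) (τ : History S A H k) (h : Fin H)
    {V : S → ℝ} (hb : ∀ s, V s ∈ Set.Icc (0 : ℝ) (H - (h + 1)))
    (hr : ∀ t, (τ t h).2.2 ∈ Set.Icc (0 : ℝ) 1) (i : Fin d) : |wHat φ 1 τ h V i| ≤ k * H := by
  have hy : ∀ t, |(τ t h).2.2 + if hh : (h : ℕ) + 1 < H then V (τ t ⟨h + 1, hh⟩).1 else 0| ≤ H := by
    intro t
    have h1 := hr t
    have h3 : (if hh : (h : ℕ) + 1 < H then V (τ t ⟨h + 1, hh⟩).1 else 0)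
        ∈ Set.Icc (0 : ℝ) (H - (h + 1)) := by
      split_ifs with hh
      · exact hb _
      · refine ⟨le_rfl, ?_⟩
        have : ((h : ℕ) : ℝ) + 1 ≤ H := by exact_mod_cast h.2
        linarith
    have h4 : (0 : ℝ) ≤ (h : ℕ) := by positivity
    rw [abs_of_nonneg (add_nonneg h1.1 h3.1)]
    linarith [h1.2, h3.2]
  have h1 := ((gram_geOne (φ := φ) τ h).inv_mulVec_le _).trans
    (sum_smul_dot_self_le (v := featVec φ τ h) (fun t => hlin.dot_le_one h.2 _ _) hy)
  refine abs_le_of_sq_le_sq ?_ (by positivity)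
  refine le_trans ?_ h1
  rw [sq]
  exact Finset.single_le_sum (f := fun i => wHat φ 1 τ h V i * wHat φ 1 τ h V i)
    (fun _ _ => mul_self_nonneg _) (Finset.mem_univ i)

/-- The factor `β` of the bonus after `k` episodes. -/
noncomputable def bonusFactor (d H : ℕ) (δ : ℝ) (k : ℕ) : ℝ :=
  30 * d * H * Real.log (d * H * (k + 1 : ℕ) / δ)

/-- Properties of the recorded data that hold almost surely. -/
structure IsRegularSample (M : MDP S A ρ) (H K : ℕ) (φ : ℕ → S → A → EuclideanSpace ℝ (Fin d))
    (supp : ℕ → S → Set A) (δ : ℝ) (πhat : (k : ℕ) → AdaptivePolicy S A H k)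
    (D : ℕ → ℕ → Ω → Step S A) (ω : Ω) : Prop where
  reward : ∀ t < K, ∀ h < H, (D t h ω).2.2 ∈ Set.Icc (0 : ℝ) 1
  feasible : ∀ t < K, ∀ h < H, M.Feasible h (D t h ω).1
  next_feasible : ∀ t < K, ∀ h, h + 1 < H →
    ∀ᵐ s' ∂(M.next h (D t h ω).1 (D t h ω).2.1), M.Feasible (h + 1) s'
  output : ∀ k < K, IsCPVIOutput M supp φ 1 (bonusFactor d H δ k) (hist H D k ω)
    ((πhat k).run (hist H D k ω))

theorem ae_isRegularSample (hD : IsAdaptiveData P M H K μ D)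
    (hπ : ∀ᵐ ω ∂P, ∀ k < K, IsCPVIOutput M supp φ 1 (bonusFactor d H δ k) (hist H D k ω)
      ((πhat k).run (hist H D k ω))) :
    ∀ᵐ ω ∂P, IsRegularSample M H K φ supp δ πhat D ω := by
  have h1 : ∀ᵐ ω ∂P, ∀ t < K, ∀ h < H, (D t h ω).2.2 ∈ Set.Icc (0 : ℝ) 1 := by
    simp only [ae_all_iff]
    exact hD.reward_mem
  have h2 : ∀ᵐ ω ∂P, ∀ t < K, ∀ h < H, M.Feasible h (D t h ω).1 := by
    simp only [ae_all_iff]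
    exact fun t ht h hh => hD.ae_feasible ht hh
  have h3 : ∀ᵐ ω ∂P, ∀ t < K, ∀ h, h + 1 < H →
      ∀ᵐ s' ∂(M.next h (D t h ω).1 (D t h ω).2.1), M.Feasible (h + 1) s' := by
    simp only [ae_all_iff]
    exact fun t ht h hh => hD.ae_ae_next_feasible ht hh
  filter_upwards [h1, h2, h3, hπ] with ω a b c e
  exact ⟨a, b, c, e⟩

/-- The estimated value of step `h` after `k` episodes. -/
noncomputable def estV (φ : ℕ → S → A → EuclideanSpace ℝ (Fin d)) (δ : ℝ)
    (πhat : (k : ℕ) → AdaptivePolicy S A H k) (D : ℕ → ℕ → Ω → Step S A) (k : ℕ) (ω : Ω)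
    (h : ℕ) : S → ℝ :=
  vHat φ 1 (bonusFactor d H δ k) (hist H D k ω) ((πhat k).run (hist H D k ω)) (H - h)

theorem estV_mem (hlin : M.IsLinear H φ) (k : ℕ) (ω : Ω) {h : ℕ} (hh : h ≤ H) (s : S) :
    estV φ δ πhat D k ω h s ∈ Set.Icc (0 : ℝ) (H - h) := vHat_mem hlin _ _ _ hh s

theorem measurable_estV (hlin : M.IsLinear H φ) (k : ℕ) (ω : Ω) (h : ℕ) :
    Measurable (estV φ δ πhat D k ω h) := measurable_vHat hlin _ _ _ _

/-- Applies the uniform bound with the entries of `ŵ_{h+1}` and `Σ_{h+1}⁻¹` as parameters, which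
determine the optimized value estimate of step `h + 1` at feasible states. -/
theorem exists_noise_bound (hD : IsAdaptiveData P M H K μ D) (hlin : M.IsLinear H φ)
    (hd : 1 ≤ d) (hδ0 : 0 < δ) (hδ1 : δ ≤ 1) {n : ℕ} (hn1 : 1 ≤ n) (hn : n < K) (h : Fin H) :
    ∃ B : Set Ω, P B ≤ ENNReal.ofReal (δ / (2 * H * (n * (n + 1)))) ∧
      ∀ ω, IsRegularSample M H K φ supp δ πhat D ω → ω ∉ B → ∀ s a,
        |(φ h s a).ofLp ⬝ᵥ wHat φ 1 (hist H D n ω) h (estV φ δ πhat D n ω (h + 1))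
          - M.bellman h (estV φ δ πhat D n ω (h + 1)) s a|
        ≤ bonusFactor d H δ n * √(invQuad φ (hist H D n ω) h s a) := by
  have hH : 1 ≤ H := (Nat.zero_le _).trans_lt h.2
  have hd' : (1 : ℝ) ≤ d := by exact_mod_cast hd
  have hH' : (1 : ℝ) ≤ H := by exact_mod_cast hH
  have hn' : (1 : ℝ) ≤ n := by exact_mod_cast hn1
  set u : ℝ := d * H * (n + 1) / δ with hu
  have hβu : bonusFactor d H δ n = 30 * d * H * Real.log u := by
    rw [bonusFactor, hu]; push_cast; rfl
  obtain ⟨-, hβ0, η, hη, hη1, hη2, N, hN1, hN2⟩ :=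
    exists_discretization hd' hH' hn' hδ0 hδ1 hu hβu
  set β := bonusFactor d H δ n with hβ
  set Γ : Set Ω := {ω | IsRegularSample M H K φ supp δ πhat D ω} with hΓ
  have hbnd : ∀ ω, ∀ s, estV φ δ πhat D n ω (h + 1) s ∈ Set.Icc (0 : ℝ) (H - (h + 1)) := by
    intro ω s
    have := estV_mem (δ := δ) (πhat := πhat) (D := D) hlin n ω (h := (h : ℕ) + 1) h.2 s
    push_cast at this
    exact this
  have hr : ∀ ω ∈ Γ, ∀ (h : Fin H) (t : Fin n), (hist H D n ω t h).2.2 ∈ Set.Icc (0 : ℝ) 1 :=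
    fun ω hω h t => hω.reward t (t.2.trans hn) h h.2
  -- At the last step the next value estimate is identically zero and needs no parameters.
  let y : Ω → (Fin d ⊕ Fin d × Fin d) → ℝ := fun ω =>
    if hh : (h : ℕ) + 1 < H then
      Sum.elim (wHat φ 1 (hist H D n ω) ⟨h + 1, hh⟩ (estV φ δ πhat D n ω (h + 1 + 1)))
        fun p => (gram φ 1 (hist H D n ω) ⟨h + 1, hh⟩)⁻¹ p.1 p.2
    else 0
  obtain ⟨B, hB, hBω⟩ := hD.exists_uniform_noise_bound hlin hn.le h (Γ := Γ)
    (V := fun ω => estV φ δ πhat D n ω (h + 1)) (y := y) (R := n * H) (η := η)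
    (ε := d * η + β * √(d * (d * η))) (N := N) (δ := δ / (2 * H * (n * (n + 1))))
    (fun ω _ => measurable_estV hlin n ω _) (fun ω _ => hbnd ω) hη (by positivity)
    (fun ω hω i => by
      have hR0 : (0 : ℝ) ≤ n * H := by positivity
      by_cases hh : (h : ℕ) + 1 < H
      · simp only [y, dif_pos hh]
        rcases i with i | p
        · refine abs_wHat_apply_le hlin _ ⟨h + 1, hh⟩ (fun s => ?_) (hr ω hω _) i
          have := estV_mem (δ := δ) (πhat := πhat) (D := D) hlin n ω
            (h := (h : ℕ) + 1 + 1) hh s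
          push_cast at this ⊢
          exact this
        · refine ((gram_geOne _ _).abs_inv_apply_le p.1 p.2).trans ?_
          exact one_le_mul_of_one_le_of_one_le hn' hH'
      · simp only [y, dif_neg hh, Pi.zero_apply, abs_zero]
        exact hR0)
    (le_mul_of_one_le_right (by positivity) hH')
    (fun ω hω ω' hω' hy hh s hs => by
      simp only [y, dif_pos hh] at hy
      refine abs_vHat_sub_le hlin (hω.output n hn) (hω'.output n hn) ⟨h + 1, hh⟩ s hs fun a => ?_
      exact abs_estQ_sub_le hlin hβ0 _ _ _ _ ⟨h + 1, hh⟩ (fun i => hy (Sum.inl i))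
        (fun i j => hy (Sum.inr (i, j))) s a)
    (fun ω hω t ht hh => ⟨hω.feasible t (ht.trans hn) _ hh, hω.next_feasible t (ht.trans hn) _ hh⟩)
    hη1 hη2 hN1 (by positivity)
  refine ⟨B, hB, fun ω hω hωB s a => ?_⟩
  have h1 := hBω ω hω hωB
  rw [Fintype.card_sum, Fintype.card_prod, Fintype.card_fin] at h1
  have h2 := sqrt_noise_add_le hd hH hn1 hδ0 hδ1 hu hN2 h1
  refine (abs_wHat_sub_bellman_le hlin (hist H D n ω) h (measurable_estV hlin n ω _) (hbnd ω)
    (hr ω hω h) rfl s a).trans ?_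
  rw [hβu, mul_comm]
  exact mul_le_mul_of_nonneg_right h2 (Real.sqrt_nonneg _)

theorem sum_inv_mul_succ_le_one (K : ℕ) :
    ∑ n ∈ Finset.range K, (1 : ℝ) / ((n + 1) * (n + 1 + 1)) ≤ 1 := by
  have h : ∀ K : ℕ, ∑ n ∈ Finset.range K, (1 : ℝ) / ((n + 1) * (n + 1 + 1)) = 1 - 1 / (K + 1) := by
    intro K
    induction K with
    | zero => simp
    | succ K ih =>
      rw [Finset.sum_range_succ, ih]
      push_cast
      field_simp
      ring
  rw [h]
  have : (0 : ℝ) ≤ 1 / (K + 1) := by positivity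
  linarith

/-- The bonus dominates the regression error simultaneously for all episodes and steps. -/
theorem exists_regression_bound (hD : IsAdaptiveData P M H K μ D) (hlin : M.IsLinear H φ)
    (hH : 0 < H) (hd : 1 ≤ d) (hδ0 : 0 < δ) (hδ1 : δ ≤ 1) :
    ∃ B : Set Ω, P B ≤ ENNReal.ofReal (δ / 2) ∧
      ∀ ω, IsRegularSample M H K φ supp δ πhat D ω → ω ∉ B → ∀ n, 1 ≤ n → n < K → ∀ (h : Fin H) s a,
        |(φ h s a).ofLp ⬝ᵥ wHat φ 1 (hist H D n ω) h (estV φ δ πhat D n ω (h + 1))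
          - M.bellman h (estV φ δ πhat D n ω (h + 1)) s a|
        ≤ bonusFactor d H δ n * √(invQuad φ (hist H D n ω) h s a) := by
  have hH' : (0 : ℝ) < H := by exact_mod_cast hH
  have key := fun (n : ℕ) (hn : n + 1 < K) (h : Fin H) =>
    exists_noise_bound (supp := supp) (πhat := πhat) hD hlin hd hδ0 hδ1 (Nat.le_add_left 1 n) hn h
  choose! B hB hBω using key
  refine ⟨⋃ n ∈ Finset.range (K - 1), ⋃ h ∈ (Finset.univ : Finset (Fin H)), B n h, ?_,
    fun ω hω hωB n hn1 hn h => ?_⟩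
  -- The probabilities `δ / (2 H n (n + 1))`, summed over `H` steps and all `n ≥ 1`, telescope to at
  -- most `δ / 2`.
  · calc P (⋃ n ∈ Finset.range (K - 1), ⋃ h ∈ (Finset.univ : Finset (Fin H)), B n h)
        ≤ ∑ n ∈ Finset.range (K - 1), ∑ _h : Fin H,
          ENNReal.ofReal (δ / (2 * H * (((n : ℝ) + 1) * (n + 1 + 1)))) := by
          refine (measure_biUnion_finset_le _ _).trans (Finset.sum_le_sum fun n hn => ?_)
          refine (measure_biUnion_finset_le _ _).trans (Finset.sum_le_sum fun h _ => ?_)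
          have := hB n (by have := Finset.mem_range.1 hn; omega) h
          push_cast at this
          exact this
      _ = ENNReal.ofReal (δ / 2 *
            ∑ n ∈ Finset.range (K - 1), (1 : ℝ) / ((n + 1) * (n + 1 + 1))) := by
          rw [Finset.mul_sum, ENNReal.ofReal_sum_of_nonneg fun n _ => by positivity]
          refine Finset.sum_congr rfl fun n _ => ?_
          rw [← ENNReal.ofReal_sum_of_nonneg fun _ _ => by positivity]
          congr 1
          rw [Finset.sum_const, Finset.card_univ, Fintype.card_fin, nsmul_eq_mul]
          field_simp
      _ ≤ ENNReal.ofReal (δ / 2) := ENNReal.ofReal_le_ofReal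
          (mul_le_of_le_one_right (by positivity) (sum_inv_mul_succ_le_one _))
  · obtain ⟨n, rfl⟩ : ∃ m, n = m + 1 := ⟨n - 1, by omega⟩
    refine hBω n hn h ω hω fun hb => hωB ?_
    exact Set.mem_biUnion (Finset.mem_coe.2 (Finset.mem_range.2 (by omega)))
      (Set.mem_biUnion (Finset.mem_coe.2 (Finset.mem_univ h)) hb)

end Pessimism

/-! ### Mixtures of policies and elementary bounds -/

section Mixture

variable {S A : Type*} [MeasurableSpace S] [MeasurableSpace A] {ρ : Measure S} [SigmaFinite ρ]
  {M : MDP S A ρ} {H K : ℕ}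

theorem Policy.mixture_kernel (hK : 0 < K) (π : Fin K → Policy S A) (h : ℕ) (s : S) :
    (Policy.mixture hK π).kernel h s = (K : ℝ≥0∞)⁻¹ • ∑ k, (π k).kernel h s := rfl

theorem MDP.Supported.mixture {supp : ℕ → S → Set A} {h : ℕ} (hK : 0 < K)
    {π : Fin K → Policy S A} (hπ : ∀ k, M.Supported supp h (π k)) :
    M.Supported supp h (Policy.mixture hK π) := by
  intro s hs a ha
  by_contra hna
  have h0 : ∀ k, (π k).kernel h s {a} = 0 := fun k => by
    by_contra hk
    exact hna (hπ k s hs (pos_iff_ne_zero.2 hk))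
  have : (Policy.mixture hK π).kernel h s {a} = 0 := by
    rw [Policy.mixture_kernel]
    simp [h0]
  exact (ne_of_gt ha) this

theorem Policy.integral_mixture (hK : 0 < K) (π : Fin K → Policy S A) (h : ℕ) (s : S)
    {f : A → ℝ} (hf : ∀ k, Integrable f ((π k).kernel h s)) :
    ∫ a, f a ∂((Policy.mixture hK π).kernel h s)
      = (∑ k, ∫ a, f a ∂((π k).kernel h s)) / K := by
  rw [Policy.mixture_kernel, integral_smul_measure, integral_finsetSum_measure fun k _ => hf k]
  rw [ENNReal.toReal_inv, ENNReal.toReal_natCast, smul_eq_mul, div_eq_inv_mul]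

theorem MDP.integrable_integral_gap [MeasurableSingletonClass A] {πopt : Policy S A}
    (hopt : M.IsOptimal H πopt) {h : ℕ} (hh : h < H) (π : Policy S A) (m : Measure S)
    [IsFiniteMeasure m] : Integrable (fun s => ∫ a, M.gap H h s a ∂(π.kernel h s)) m := by
  refine integrable_of_abs_le (measurable_integral_policy π h (M.measurable_gap hopt hh)) H
    fun s => ?_
  exact abs_integral_le_of_abs_le fun a => M.abs_gap_le hopt hh s a

/-- The sub-optimality of a mixture in terms of the gaps of its members. -/
theorem MDP.subOpt_mixture_eq [MeasurableSingletonClass A] {πopt : Policy S A}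
    (hopt : M.IsOptimal H πopt) (hK : 0 < K) (π : Fin K → Policy S A) :
    M.subOpt H (Policy.mixture hK π)
      = (∑ k, ∑ h ∈ Finset.range H, ∫ s, ∫ a, M.gap H h s a ∂((π k).kernel h s)
          ∂(M.stateLaw (Policy.mixture hK π) h)) / K := by
  rw [M.subOpt_eq_sum_gap hopt, Finset.sum_comm, Finset.sum_div]
  refine Finset.sum_congr rfl fun h hh => ?_
  have hh := Finset.mem_range.1 hh
  rw [← integral_finsetSum _ fun k _ => integrable_integral_gap hopt hh (π k) _, ← integral_div]
  congr 1
  ext s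
  refine Policy.integral_mixture hK π h s fun k => ?_
  exact integrable_of_abs_le ((M.measurable_gap hopt hh).comp
    (measurable_prodMk_left (x := s))) H fun a => M.abs_gap_le hopt hh s a

theorem MDP.subOpt_le [MeasurableSingletonClass A] {πopt : Policy S A}
    (hopt : M.IsOptimal H πopt) (π : Policy S A) : M.subOpt H π ≤ H := by
  unfold MDP.subOpt
  rw [M.optV_eq hopt (Nat.zero_le H)]
  refine (le_abs_self _).trans (abs_integral_le_of_abs_le fun s => ?_)
  have h1 := M.V_mem (Nat.zero_le H) πopt s
  have h2 := M.V_mem (Nat.zero_le H) π s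
  simp only [Nat.cast_zero, sub_zero] at h1 h2
  exact abs_le.2 ⟨by linarith [h1.1, h2.2], by linarith [h1.2, h2.1]⟩

/-- Positivity rules out the default value `0` of the empty infimum, so a nonzero gap exists, and
gaps are at most `H`. -/
theorem MDP.minGap_le [MeasurableSingletonClass A] {πopt : Policy S A}
    (hopt : M.IsOptimal H πopt) (hg : 0 < M.minGap H) : M.minGap H ≤ H := by
  have hne : {x : ℝ | x ≠ 0 ∧ ∃ h < H, ∃ s a, M.gap H h s a = x}.Nonempty := by
    by_contra hne
    rw [Set.not_nonempty_iff_eq_empty] at hne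
    rw [MDP.minGap, hne, Real.sInf_empty] at hg
    exact lt_irrefl _ hg
  obtain ⟨x, hx0, h, hh, s, a, hx⟩ := hne
  have h1 := (M.gap_eq_zero_or_minGap_le hopt hh s a).resolve_left (hx ▸ hx0)
  exact h1.trans ((le_abs_self _).trans (M.abs_gap_le hopt hh s a))

theorem MDP.nonempty_state (M : MDP S A ρ) : Nonempty S := by
  by_contra hS
  rw [not_nonempty_iff] at hS
  have := M.init_mass
  simp [lintegral_of_isEmpty] at this

/-- Lower bounds on the positive visitation densities are at most one. -/
theorem MDP.one_le_of_le_occSA (hbd : M.BoundedDensity H) {μ : Policy S A} {h : ℕ} (hh : h < H)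
    {κ : ℝ} (hκ0 : 0 < κ)
    (hκ : ∀ s a, 0 < M.occSA μ h s a → ENNReal.ofReal κ⁻¹ ≤ M.occSA μ h s a) : 1 ≤ κ := by
  obtain ⟨s, hs⟩ := (M.ae_stateLaw_occ_pos μ h).exists
  obtain ⟨a, ha⟩ := exists_atom (μ.discrete h s)
  have h1 := (hκ s a (ENNReal.mul_pos hs.ne' ha.ne')).trans (hbd μ h hh s a)
  rw [ENNReal.ofReal_le_one, inv_le_one₀ hκ0] at h1
  exact h1

end Mixture

/-! ### Pessimism and potential bounds on the good event -/

section Guarantee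

open Matrix

variable {S A Ω : Type*} [MeasurableSpace S] [MeasurableSpace A] [MeasurableSpace Ω]
  {ρ : Measure S} [SigmaFinite ρ] {P : Measure Ω} [IsProbabilityMeasure P] {M : MDP S A ρ}
  {H K d : ℕ} {μ : (t : ℕ) → AdaptivePolicy S A H t} {D : ℕ → ℕ → Ω → Step S A}
  {φ : ℕ → S → A → EuclideanSpace ℝ (Fin d)} {supp : ℕ → S → Set A} {δ : ℝ}
  {πhat : (k : ℕ) → AdaptivePolicy S A H k}

/-- The elliptical potential of the recorded features. -/
theorem sum_invQuad_hist_le (hlin : M.IsLinear H φ) (K : ℕ) (h : Fin H) (ω : Ω) :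
    ∑ k ∈ Finset.range K, invQuad φ (hist H D k ω) h (D k h ω).1 (D k h ω).2.1
      ≤ 2 * d * Real.log (K + 1) := by
  refine le_trans (le_of_eq (Finset.sum_congr rfl fun k _ => ?_))
    (sum_inv_quad_le (fun t => (φ h (D t h ω).1 (D t h ω).2.1).ofLp)
      (fun t => hlin.dot_le_one h.2 _ _) K)
  rw [invQuad, gram_eq]
  rfl

theorem bonusFactor_mem {n : ℕ} (hd : 1 ≤ d) (hH : 1 ≤ H) (hδ0 : 0 < δ) (hδ1 : δ ≤ 1)
    (hn : n < K) :
    bonusFactor d H δ n ∈ Set.Icc 0 (30 * d * H * Real.log (d * K * H / δ)) := by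
  have hd' : (1 : ℝ) ≤ d := by exact_mod_cast hd
  have hH' : (1 : ℝ) ≤ H := by exact_mod_cast hH
  have hn' : (1 : ℝ) ≤ (n + 1 : ℕ) := by exact_mod_cast Nat.le_add_left 1 n
  have hK' : ((n + 1 : ℕ) : ℝ) ≤ K := by exact_mod_cast hn
  have h1 : 1 ≤ (d : ℝ) * H * (n + 1 : ℕ) / δ := by
    rw [one_le_div hδ0]
    exact hδ1.trans (one_le_mul_of_one_le_of_one_le (one_le_mul_of_one_le_of_one_le hd' hH') hn')
  refine ⟨mul_nonneg (by positivity) (Real.log_nonneg h1), ?_⟩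
  refine mul_le_mul_of_nonneg_left (Real.log_le_log (by linarith) ?_) (by positivity)
  rw [mul_right_comm (d : ℝ) K H]
  gcongr

/-- The regression bound makes the estimates pessimistic. -/
theorem estQ_bellman_le (hlin : M.IsLinear H φ) (hd : 1 ≤ d) (hδ0 : 0 < δ) (hδ1 : δ ≤ 1) {n : ℕ}
    (hn : n < K) (h : Fin H) {ω : Ω} {c : ℝ}
    (hc : 60 * d * H * Real.log (d * K * H / δ) ≤ c) (hc1 : d * H ≤ c) {s : S} {a : A}
    (hreg : 1 ≤ n →
      |(φ h s a).ofLp ⬝ᵥ wHat φ 1 (hist H D n ω) h (estV φ δ πhat D n ω (h + 1))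
          - M.bellman h (estV φ δ πhat D n ω (h + 1)) s a|
        ≤ bonusFactor d H δ n * √(invQuad φ (hist H D n ω) h s a)) :
    estQ φ 1 (bonusFactor d H δ n) (hist H D n ω) ((πhat n).run (hist H D n ω)) h s a
        ≤ M.bellman h (estV φ δ πhat D n ω (h + 1)) s a ∧
      M.bellman h (estV φ δ πhat D n ω (h + 1)) s a
        ≤ estQ φ 1 (bonusFactor d H δ n) (hist H D n ω) ((πhat n).run (hist H D n ω)) h s a
          + c * √(invQuad φ (hist H D n ω) h s a) := by
  have hH : 1 ≤ H := (Nat.zero_le _).trans_lt h.2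
  have hβ := bonusFactor_mem hd hH hδ0 hδ1 hn
  have hbnd : ∀ s, estV φ δ πhat D n ω (h + 1) s ∈ Set.Icc (0 : ℝ) (H - (h + 1)) := by
    intro s
    have := estV_mem (δ := δ) (πhat := πhat) (D := D) hlin n ω (h := (h : ℕ) + 1) h.2 s
    push_cast at this
    exact this
  have hT := M.bellman_mem h (measurable_estV hlin n ω _) hbnd s a
  rw [sub_add_eq_sub_sub, sub_add_cancel] at hT
  have hq := Real.sqrt_nonneg (invQuad φ (hist H D n ω) h s a)
  -- Without data the factor `β` can be zero (`d = H = δ = 1`), so the regression bound is not used.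
  -- Then `Q̂ = 0`, and only the bias `√d H` remains, which `c ≥ dH` covers.
  rcases Nat.eq_zero_or_pos n with rfl | hn1
  · have hw : wHat φ 1 (hist H D 0 ω) h (estV φ δ πhat D 0 ω (h + 1)) = 0 := by
      simp [wHat]
    have h0 : estQ φ 1 (bonusFactor d H δ 0) (hist H D 0 ω) ((πhat 0).run (hist H D 0 ω)) h s a
        = 0 := by
      have hx : estQ φ 1 (bonusFactor d H δ 0) (hist H D 0 ω) ((πhat 0).run (hist H D 0 ω)) h s a
          = qHat φ 1 (bonusFactor d H δ 0) (hist H D 0 ω) h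
            (estV φ δ πhat D 0 ω (h + 1)) s a := rfl
      rw [hx, qHat, hw, dotProduct_zero, bonus_eq]
      refine max_eq_right ((min_le_left _ _).trans ?_)
      rw [zero_sub, neg_nonpos]
      exact mul_nonneg hβ.1 hq
    rw [h0]
    refine ⟨hT.1, ?_⟩
    have h1 := abs_wHat_sub_bellman_le hlin (hist H D 0 ω) h (measurable_estV hlin 0 ω _) hbnd
      (fun t => t.elim0) (Z := 0) (by simp) s a
    rw [hw, dotProduct_zero, zero_sub, abs_neg, zero_dotProduct, Real.sqrt_zero, zero_add] at h1
    have h2 : √(d : ℝ) * H ≤ c := by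
      refine le_trans (mul_le_mul_of_nonneg_right ?_ (by positivity)) hc1
      have hd' : (1 : ℝ) ≤ d := by exact_mod_cast hd
      rw [Real.sqrt_le_iff]
      exact ⟨by positivity, by nlinarith⟩
    rw [zero_add, mul_comm]
    exact (le_abs_self _).trans (h1.trans (mul_le_mul_of_nonneg_left h2 hq))
  · have h1 := qHat_le_of_error_le hT (hreg hn1)
    refine ⟨h1.1, h1.2.trans ?_⟩
    have h2 : 2 * bonusFactor d H δ n ≤ c := by linarith [hβ.2]
    exact add_le_add le_rfl (mul_le_mul_of_nonneg_right h2 hq)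

/-- The regression error is at most the subtracted bonus, so the total deviation is at most twice
the bonus; `c ≥ 60 d H log(dKH/δ)` dominates that doubled factor for all episodes. -/
theorem isPessimistic_estimates (hlin : M.IsLinear H φ) (hd : 1 ≤ d) (hδ0 : 0 < δ) (hδ1 : δ ≤ 1)
    {n : ℕ} (hn : n < K) {ω : Ω} (hω : IsRegularSample M H K φ supp δ πhat D ω) {c : ℝ}
    (hc : 60 * d * H * Real.log (d * K * H / δ) ≤ c) (hc1 : d * H ≤ c)
    (hreg : 1 ≤ n → ∀ (h : Fin H) s a,
      |(φ h s a).ofLp ⬝ᵥ wHat φ 1 (hist H D n ω) h (estV φ δ πhat D n ω (h + 1))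
          - M.bellman h (estV φ δ πhat D n ω (h + 1)) s a|
        ≤ bonusFactor d H δ n * √(invQuad φ (hist H D n ω) h s a)) :
    M.IsPessimistic H supp ((πhat n).run (hist H D n ω))
      (fun h s a => if hh : h < H then estQ φ 1 (bonusFactor d H δ n) (hist H D n ω)
        ((πhat n).run (hist H D n ω)) ⟨h, hh⟩ s a else 0)
      (estV φ δ πhat D n ω)
      (fun h s a => if hh : h < H then c * √(invQuad φ (hist H D n ω) ⟨h, hh⟩ s a) else 0) where
  Q_meas h hh := by
    simp only [dif_pos hh]
    exact measurable_qHat hlin _ _ _ _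
  Q_mem h hh s a := by
    simp only [dif_pos hh]
    exact qHat_mem _ _ _ ⟨h, hh⟩ _ _ _
  W_eq h hh s := by
    simp only [dif_pos hh]
    exact vHat_eq _ _ _ _ ⟨h, hh⟩ s
  W_top s := by simp [estV, vHat]
  supported h hh := (hω.output n hn ⟨h, hh⟩).1
  greedy h hh π' hπ' s hs := by
    simp only [dif_pos hh]
    exact ((hω.output n hn ⟨h, hh⟩).2 π' hπ' s hs).trans (vHat_eq _ _ _ _ ⟨h, hh⟩ s).ge
  le_bellman h hh s a := by
    simp only [dif_pos hh]
    exact (estQ_bellman_le hlin hd hδ0 hδ1 hn ⟨h, hh⟩ hc hc1 fun h1 => hreg h1 _ s a).1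
  bellman_le h hh s a := by
    simp only [dif_pos hh]
    exact (estQ_bellman_le hlin hd hδ0 hδ1 hn ⟨h, hh⟩ hc hc1 fun h1 => hreg h1 _ s a).2
  b_meas h hh := by
    simp only [dif_pos hh]
    exact (measurable_invQuad_left hlin _ _).sqrt.const_mul _
  b_bdd := by
    have hc0 : 0 ≤ c := le_trans (by positivity) hc1
    refine ⟨c, fun h hh s a => ?_⟩
    simp only [dif_pos hh]
    rw [abs_of_nonneg (mul_nonneg hc0 (Real.sqrt_nonneg _))]
    exact mul_le_of_le_one_right hc0 (Real.sqrt_le_one.2 (invQuad_mem hlin _ _ s a).2)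

/-- The expected squared bonuses along the episodes are controlled by the elliptical potential. -/
theorem measure_sum_invQuad_ge_le (hD : IsAdaptiveData P M H K μ D) (hlin : M.IsLinear H φ)
    {κ : ℕ → ℝ} (hκ0 : ∀ h < H, 0 < κ h) {κtot : ℝ}
    (hκtot : κtot = ∑ h ∈ Finset.range H, κ h) (hH : 0 < H) (hδ0 : 0 < δ) :
    P {ω | κtot * (4 * d * Real.log (K + 1) + 2 * Real.log (2 / δ))
        < ∑ k ∈ Finset.range K, ∑ h : Fin H, κ h *
          ∫ x, invQuad φ (hist H D k ω) h x.1 x.2 ∂(M.law ((μ k).run (hist H D k ω)) h)}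
      ≤ ENNReal.ofReal (δ / 2) := by
  have hsum : ∑ h : Fin H, κ h = κtot := by rw [hκtot, Finset.sum_range]
  have hκp : 0 < κtot := by
    rw [hκtot]
    exact Finset.sum_pos (fun h hh => hκ0 h (Finset.mem_range.1 hh)) ⟨0, Finset.mem_range.2 hH⟩
  have hκ1 : ∑ h : Fin H, κ h / κtot = 1 := by
    rw [← Finset.sum_div, hsum, div_self hκp.ne']
  have hκq : ∀ h : Fin H, 0 ≤ κ h / κtot := fun h => (div_pos (hκ0 h h.2) hκp).le
  have hκle : ∀ h : Fin H, κ h / κtot ≤ 1 := fun h =>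
    (Finset.single_le_sum (f := fun h : Fin H => κ h / κtot) (fun h _ => hκq h)
      (Finset.mem_univ h)).trans hκ1.le
  -- With weights `κ_h / κ` of total mass one, the sum over the steps of an episode stays in `[0,
  -- 1]`; one application then handles all steps without a union bound.
  have key := hD.measure_sum_mean_ge_le
    (f := fun k h x => κ h / κtot * invQuad φ x.1 h x.2.1 x.2.2)
    (fun k h => (measurable_invQuad hlin h).const_mul _)
    (fun k h x => mul_nonneg (hκq h) (invQuad_mem hlin _ _ _ _).1)
    (fun k h x => mul_le_one₀ (hκle h) (invQuad_mem hlin _ _ _ _).1 (invQuad_mem hlin _ _ _ _).2)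
    (fun k τ e => (Finset.sum_le_sum fun h _ =>
      mul_le_of_le_one_right (hκq h) (invQuad_mem hlin _ _ _ _).2).trans hκ1.le)
    (half_pos hδ0)
  refine (measure_mono fun ω hω => ?_).trans key
  rw [Set.mem_ofPred_eq] at hω ⊢
  have h1 : ∑ k ∈ Finset.range K, ∑ h : Fin H,
      κ h / κtot * invQuad φ (hist H D k ω) h (D k h ω).1 (D k h ω).2.1
      ≤ 2 * d * Real.log (K + 1) := by
    rw [Finset.sum_comm]
    calc ∑ h : Fin H, ∑ k ∈ Finset.range K,
          κ h / κtot * invQuad φ (hist H D k ω) h (D k h ω).1 (D k h ω).2.1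
        ≤ ∑ h : Fin H, κ h / κtot * (2 * d * Real.log (K + 1)) := by
          refine Finset.sum_le_sum fun h _ => ?_
          rw [← Finset.mul_sum]
          exact mul_le_mul_of_nonneg_left (sum_invQuad_hist_le hlin K h ω) (hκq h)
      _ = 2 * d * Real.log (K + 1) := by rw [← Finset.sum_mul, hκ1, one_mul]
  have h2 : ∑ k ∈ Finset.range K, ∑ h : Fin H, κ h *
        ∫ x, invQuad φ (hist H D k ω) h x.1 x.2 ∂(M.law ((μ k).run (hist H D k ω)) h)
      = κtot * ∑ k ∈ Finset.range K, ∑ h : Fin H,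
        ∫ x, κ h / κtot * invQuad φ (hist H D k ω) h x.1 x.2
          ∂(M.law ((μ k).run (hist H D k ω)) h) := by
    simp only [Finset.mul_sum]
    refine Finset.sum_congr rfl fun k _ => Finset.sum_congr rfl fun h _ => ?_
    rw [integral_const_mul]
    field_simp
  rw [h2] at hω
  have h3 := lt_of_mul_lt_mul_left hω hκp.le
  rw [one_div_div]
  linarith

end Guarantee

/-! ### Combination of the bounds -/

section Main

open Matrix

/-- The arithmetic of the final bound. -/
theorem final_bound_le {d H κ Δ K L G B E : ℝ} (hd : 1 ≤ d) (hH : 1 ≤ H) (hHκ : H ≤ κ)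
    (hΔ : 0 < Δ) (hK : 0 < K) (hL : 0 ≤ L) (hE : E ≤ κ * (12 * d * L))
    (hB : B = 60 * d * H * L) (hG : G ≤ 2 * H ^ 2 / Δ * (B ^ 2 * E)) :
    G / K ≤ 43200 * (2 * (d ^ 3 * H ^ 2 * κ ^ 3 / (Δ * K)) * L ^ 3) := by
  have hκ : 1 ≤ κ := hH.trans hHκ
  have h1 : 2 * H ^ 2 / Δ * (B ^ 2 * E)
      ≤ 2 * H ^ 2 / Δ * ((60 * d * H * L) ^ 2 * (κ * (12 * d * L))) := by
    rw [hB]; gcongr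
  -- The argument gives `H⁴ κ`; two of these factors `H` are exchanged for `κ` because `H ≤ κ`.
  have h2 : H ^ 2 * κ ≤ κ ^ 3 := by
    calc H ^ 2 * κ ≤ κ ^ 2 * κ := by gcongr
      _ = κ ^ 3 := by ring
  calc G / K ≤ 2 * H ^ 2 / Δ * ((60 * d * H * L) ^ 2 * (κ * (12 * d * L))) / K := by
        gcongr
        exact hG.trans h1
    _ = 86400 * (d ^ 3 * H ^ 2 * (H ^ 2 * κ) / (Δ * K)) * L ^ 3 := by
        field_simp
        ring
    _ ≤ 86400 * (d ^ 3 * H ^ 2 * κ ^ 3 / (Δ * K)) * L ^ 3 := by gcongr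
    _ = 43200 * (2 * (d ^ 3 * H ^ 2 * κ ^ 3 / (Δ * K)) * L ^ 3) := by ring

variable {S A Ω : Type*} [MeasurableSpace S] [MeasurableSpace A] [MeasurableSingletonClass A]
  [MeasurableSpace Ω]
  {ρ : Measure S} [SigmaFinite ρ] {P : Measure Ω} [IsProbabilityMeasure P] {M : MDP S A ρ}
  {H K d : ℕ} {μ : (t : ℕ) → AdaptivePolicy S A H t} {D : ℕ → ℕ → Ω → Step S A}
  {φ : ℕ → S → A → EuclideanSpace ℝ (Fin d)} {supp : ℕ → S → Set A} {δ : ℝ}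
  {πhat : (k : ℕ) → AdaptivePolicy S A H k}

/-- With high probability, the gaps of the extracted policies are small along any supported
policies. -/
theorem exists_sum_gap_le (hD : IsAdaptiveData P M H K μ D) (hlin : M.IsLinear H φ)
    (hbd : M.BoundedDensity H) (hH : 0 < H) (hK : 0 < K) (hd : 1 ≤ d) (hδ0 : 0 < δ) (hδ1 : δ ≤ 1)
    (hL2 : 2 ≤ d * K * H / δ)
    (hsupp : ∀ᵐ ω ∂P, ∀ t < K, ∀ h < H, ∀ s, M.Feasible h s →
      {a | 0 < ((μ t).run (hist H D t ω)).kernel h s {a}} = supp h s)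
    {πopt : Policy S A} (hopt : M.IsOptimal H πopt) (hos : ∀ h < H, M.Supported supp h πopt)
    {κ : ℕ → ℝ} (hκ0 : ∀ h < H, 0 < κ h)
    (hκ : ∀ᵐ ω ∂P, ∀ t < K, ∀ h < H, ∀ s a,
      0 < M.occSA ((μ t).run (hist H D t ω)) h s a →
      ENNReal.ofReal (κ h)⁻¹ ≤ M.occSA ((μ t).run (hist H D t ω)) h s a)
    {κtot : ℝ} (hκtot : κtot = ∑ h ∈ Finset.range H, κ h) (hg : 0 < M.minGap H)
    (hπ : ∀ᵐ ω ∂P, ∀ k < K, IsCPVIOutput M supp φ 1 (bonusFactor d H δ k) (hist H D k ω)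
      ((πhat k).run (hist H D k ω))) :
    ∃ B : Set Ω, P B ≤ ENNReal.ofReal δ ∧ ∀ ω, ω ∉ B →
      (∀ k < K, ∀ h < H, M.Supported supp h ((πhat k).run (hist H D k ω))) ∧
      ∀ σ : Fin K → Policy S A, (∀ k, ∀ h < H, M.Supported supp h (σ k)) →
        (∑ k : Fin K, ∑ h ∈ Finset.range H,
          ∫ s, ∫ a, M.gap H h s a ∂(((πhat k).run (hist H D k ω)).kernel h s)
            ∂(M.stateLaw (σ k) h)) / K
          ≤ 43200 * (2 * (d ^ 3 * H ^ 2 * κtot ^ 3 / (M.minGap H * K))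
            * Real.log (d * K * H / δ) ^ 3) := by
  obtain ⟨B₁, hB₁, hreg⟩ := exists_regression_bound (supp := supp) (πhat := πhat)
    hD hlin hH hd hδ0 hδ1
  have hB₂ := measure_sum_invQuad_ge_le (μ := μ) hD hlin hκ0 hκtot hH hδ0
  set B₂ := {ω | κtot * (4 * d * Real.log (K + 1) + 2 * Real.log (2 / δ))
        < ∑ k ∈ Finset.range K, ∑ h : Fin H, κ h *
          ∫ x, invQuad φ (hist H D k ω) h x.1 x.2 ∂(M.law ((μ k).run (hist H D k ω)) h)} with hB₂'
  have hae := (ae_isRegularSample hD hπ).and (hsupp.and hκ)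
  set N := {ω | ¬ (IsRegularSample M H K φ supp δ πhat D ω ∧
    (∀ t < K, ∀ h < H, ∀ s, M.Feasible h s →
      {a | 0 < ((μ t).run (hist H D t ω)).kernel h s {a}} = supp h s) ∧
    ∀ t < K, ∀ h < H, ∀ s a, 0 < M.occSA ((μ t).run (hist H D t ω)) h s a →
      ENNReal.ofReal (κ h)⁻¹ ≤ M.occSA ((μ t).run (hist H D t ω)) h s a)} with hN
  have hN0 : P N = 0 := ae_iff.1 hae
  refine ⟨N ∪ (B₁ ∪ B₂), ?_, fun ω hω => ?_⟩
  · calc P (N ∪ (B₁ ∪ B₂)) ≤ P N + (P B₁ + P B₂) :=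
          (measure_union_le _ _).trans (add_le_add le_rfl (measure_union_le _ _))
      _ ≤ 0 + (ENNReal.ofReal (δ / 2) + ENNReal.ofReal (δ / 2)) :=
          add_le_add hN0.le (add_le_add hB₁ hB₂)
      _ = ENNReal.ofReal δ := by
          rw [zero_add, ← ENNReal.ofReal_add (by positivity) (by positivity), add_halves]
  simp only [Set.mem_union, not_or] at hω
  obtain ⟨hωN, hω1, hω2⟩ := hω
  obtain ⟨hR, hS, hκω⟩ := not_not.1 hωN
  refine ⟨fun k hk h hh => (hR.output k hk ⟨h, hh⟩).1, fun σ hσ => ?_⟩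
  have hd' : (1 : ℝ) ≤ d := by exact_mod_cast hd
  have hH' : (1 : ℝ) ≤ H := by exact_mod_cast hH
  have hK' : (1 : ℝ) ≤ K := by exact_mod_cast hK
  set x : ℝ := d * K * H / δ with hx
  have hL1 := one_le_three_halves_mul_log hL2
  set L := Real.log x with hL
  have hL0 : 0 < L := by linarith
  set c : ℝ := 60 * d * H * L with hc
  have hdH : (0 : ℝ) < d * H := by positivity
  have hc1 : (d : ℝ) * H ≤ c := by
    calc (d : ℝ) * H ≤ d * H * (60 * L) := le_mul_of_one_le_right hdH.le (by linarith)
      _ = c := by rw [hc]; ring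
  -- Densities bounded by one force every `κ_h` to be at least one.
  have hHκ : (H : ℝ) ≤ κtot := by
    rw [hκtot]
    have : ∑ _h ∈ Finset.range H, (1 : ℝ) = H := by simp
    rw [← this]
    exact Finset.sum_le_sum fun h hh => MDP.one_le_of_le_occSA hbd (Finset.mem_range.1 hh)
      (hκ0 h (Finset.mem_range.1 hh)) (hκω 0 hK h (Finset.mem_range.1 hh))
  have hstep : ∀ k : Fin K, ∑ h ∈ Finset.range H,
      ∫ s, ∫ a, M.gap H h s a ∂(((πhat k).run (hist H D k ω)).kernel h s) ∂(M.stateLaw (σ k) h)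
      ≤ 2 * H ^ 2 / M.minGap H * (c ^ 2 * ∑ h : Fin H, κ h *
        ∫ x, invQuad φ (hist H D k ω) h x.1 x.2 ∂(M.law ((μ k).run (hist H D k ω)) h)) := by
    intro k
    have hP := isPessimistic_estimates hlin hd hδ0 hδ1 k.2 hR hc.ge hc1
      fun h1 => hreg ω hR hω1 k h1 k.2
    refine (hP.sum_integral_gap_le hbd hopt hos hg (hS k k.2) hκ0 (hκω k k.2) (hσ k)).trans
      (le_of_eq ?_)
    congr 1
    rw [Finset.sum_range, Finset.mul_sum]
    refine Finset.sum_congr rfl fun h _ => ?_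
    simp only [dif_pos h.2, Fin.eta, mul_pow, Real.sq_sqrt (invQuad_mem hlin _ _ _ _).1]
    rw [integral_const_mul]
    ring
  have htot : ∑ k : Fin K, ∑ h ∈ Finset.range H,
      ∫ s, ∫ a, M.gap H h s a ∂(((πhat k).run (hist H D k ω)).kernel h s) ∂(M.stateLaw (σ k) h)
      ≤ 2 * H ^ 2 / M.minGap H * (c ^ 2 * ∑ k ∈ Finset.range K, ∑ h : Fin H, κ h *
        ∫ x, invQuad φ (hist H D k ω) h x.1 x.2 ∂(M.law ((μ k).run (hist H D k ω)) h)) := by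
    refine (Finset.sum_le_sum fun k _ => hstep k).trans (le_of_eq ?_)
    rw [← Finset.mul_sum, ← Finset.mul_sum, Finset.sum_range]
  refine final_bound_le hd' hH' hHκ hg (by linarith) hL0.le ?_ hc htot
  refine (not_lt.1 hω2).trans (mul_le_mul_of_nonneg_left ?_ (by linarith))
  have hKx : (K : ℝ) ≤ x := by
    rw [hx, le_div_iff₀ hδ0]
    have : (1 : ℝ) ≤ d * H := one_le_mul_of_one_le_of_one_le hd' hH'
    nlinarith
  have h1δ : 1 / δ ≤ x := by
    rw [hx]
    have : (1 : ℝ) ≤ d * K * H :=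
      one_le_mul_of_one_le_of_one_le (one_le_mul_of_one_le_of_one_le hd' hK') hH'
    gcongr
  -- Both `K + 1` and `2 / δ` are at most `x²` because `x ≥ 2`; this gives `4d · 2L + 2 · 2L ≤ 12 d
  -- L`.
  have hlx : Real.log (x * x) = 2 * L := by
    rw [Real.log_mul (by linarith) (by linarith)]; ring
  have hl1 : Real.log (K + 1) ≤ 2 * L := by
    rw [← hlx]
    refine Real.log_le_log (by positivity) ?_
    nlinarith
  have hl2 : Real.log (2 / δ) ≤ 2 * L := by
    rw [← hlx]
    refine Real.log_le_log (by positivity) ?_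
    have : 2 / δ = 2 * (1 / δ) := by ring
    rw [this]
    have : 0 ≤ 1 / δ := by positivity
    exact mul_le_mul hL2 h1δ this (by linarith)
  have e1 : 4 * d * Real.log (K + 1) ≤ 4 * d * (2 * L) := by gcongr
  have e2 : L ≤ d * L := le_mul_of_one_le_left hL0.le hd'
  linarith

end Main

theorem theorem2 :
    ∃ c₁ : ℝ, 0 < c₁ ∧ ∃ C : ℝ, 0 < C ∧
    ∀ (S : Type*) (A : Type*) (Ω : Type*)
      [MeasurableSpace S] [MeasurableSpace A] [MeasurableSingletonClass A] [MeasurableSpace Ω]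
      (ρ : Measure S) [SigmaFinite ρ] (P : Measure Ω) [IsProbabilityMeasure P]
      (H K d : ℕ) (_hH : 0 < H) (hK : 0 < K) (δ : ℝ) (_hδ0 : 0 < δ) (_hδ1 : δ ≤ 1)
      -- the linear MDP
      (M : MDP S A ρ) (φ : ℕ → S → A → EuclideanSpace ℝ (Fin d))
      (_hlin : M.IsLinear H φ) (_hbdd : M.BoundedDensity H)
      -- the adaptively collected data
      (μ : (t : ℕ) → AdaptivePolicy S A H t) (D : ℕ → ℕ → Ω → Step S A)
      (_hD : IsAdaptiveData P M H K μ D)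
      -- the known support of the behavior policy
      (supp : ℕ → S → Set A)
      (_hsupp : ∀ᵐ ω ∂P, ∀ t < K, ∀ h < H, ∀ s, M.Feasible h s →
        {a | 0 < ((μ t).run (hist H D t ω)).kernel h s {a}} = supp h s)
      -- optimal-policy concentrability, the optimal policy being `μ`-supported
      (πopt : Policy S A) (_hopt : M.IsOptimal H πopt)
      (_hoptsupp : ∀ h < H, M.Supported supp h πopt)
      (_hOPC : ∀ᵐ ω ∂P, ∀ t < K, ∀ h < H, ∀ s a, 0 < M.occSA πopt h s a →
        0 < M.occSA ((μ t).run (hist H D t ω)) h s a)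
      -- the occupancy densities of `μ` are at least `(κ h)⁻¹` where they are positive
      (κ : ℕ → ℝ) (_hκ0 : ∀ h < H, 0 < κ h)
      (_hκ : ∀ᵐ ω ∂P, ∀ t < K, ∀ h < H, ∀ s a,
        0 < M.occSA ((μ t).run (hist H D t ω)) h s a →
        ENNReal.ofReal (κ h)⁻¹ ≤ M.occSA ((μ t).run (hist H D t ω)) h s a)
      (κtot : ℝ) (_hκtot : κtot = ∑ h ∈ Finset.range H, κ h)
      (_hKκ : 2 ≤ K * κtot / δ)
      -- positive minimum gap
      (_hgap : 0 < M.minGap H)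
      -- the ensemble of BCP-VI: `πhat k` is computed from the first `k` episodes
      (πhat : (k : ℕ) → AdaptivePolicy S A H k)
      (_hπhat : ∀ᵐ ω ∂P, ∀ k < K,
        IsCPVIOutput M supp φ 1 (c₁ * d * H * Real.log (d * H * (k + 1 : ℕ) / δ))
          (hist H D k ω) ((πhat k).run (hist H D k ω)))
      (bound : ℝ)
      (_hbound : bound =
        C * (2 * (d ^ 3 * H ^ 2 * κtot ^ 3 / (M.minGap H * K)) * Real.log (d * K * H / δ) ^ 3)
          + 16 * κtot / (3 * K) * Real.log (Real.logb 2 (K * κtot / δ)) + 2 / K),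
      P {ω | ¬ (
          -- the policy with the averaged action probabilities
          M.subOpt H (Policy.mixture hK fun k : Fin K => (πhat k).run (hist H D k ω)) ≤ bound ∧
          -- a uniformly drawn member of the ensemble, followed for the whole episode
          (∑ k : Fin K, M.subOpt H ((πhat k).run (hist H D k ω))) / K ≤ bound)}
        ≤ ENNReal.ofReal ((1 + 3 * Real.logb 2 (H / M.minGap H)) * δ) := by
  refine ⟨30, by norm_num, 43200, by norm_num, ?_⟩
  intro S A Ω _ _ _ _ ρ _ P _ H K d hH hK δ hδ0 hδ1 M φ hlin hbdd μ D hD supp hsupp πopt hopt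
    hoptsupp _ κ hκ0 hκ κtot hκtot hKκ hgap πhat hπhat bound hbound
  have hS := M.nonempty_state
  have hA : Nonempty A := ⟨(exists_atom (πopt.discrete 0 (Classical.arbitrary S))).choose⟩
  have hd := hlin.one_le_dim hH
  have hd' : (1 : ℝ) ≤ d := by exact_mod_cast hd
  have hH' : (1 : ℝ) ≤ H := by exact_mod_cast hH
  have hK' : (1 : ℝ) ≤ K := by exact_mod_cast hK
  have hK0 : (0 : ℝ) < K := by linarith
  have hκp : 0 < κtot := by
    rw [hκtot]
    exact Finset.sum_pos (fun h hh => hκ0 h (Finset.mem_range.1 hh)) ⟨0, Finset.mem_range.2 hH⟩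
  have hdKH : (1 : ℝ) ≤ d * K * H :=
    one_le_mul_of_one_le_of_one_le (one_le_mul_of_one_le_of_one_le hd' hK') hH'
  have hlog0 : 0 ≤ Real.log (d * K * H / δ) :=
    Real.log_nonneg ((one_le_div hδ0).2 (hδ1.trans hdKH))
  set main : ℝ := 43200 * (2 * (d ^ 3 * H ^ 2 * κtot ^ 3 / (M.minGap H * K))
    * Real.log (d * K * H / δ) ^ 3) with hmain
  have hmain0 : 0 ≤ main := by positivity
  -- From `Kκ/δ ≥ 2` the inner logarithm is at least one, so the iterated logarithm is nonnegative
  -- and can be dropped.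
  have hll : 0 ≤ 16 * κtot / (3 * K) * Real.log (Real.logb 2 (K * κtot / δ)) := by
    refine mul_nonneg (by positivity) (Real.log_nonneg ?_)
    rw [Real.le_logb_iff_rpow_le (by norm_num) (by linarith), Real.rpow_one]
    exact hKκ
  have hle1 : main + 2 / K ≤ bound := by
    rw [hbound]
    linarith
  have hprob : δ ≤ (1 + 3 * Real.logb 2 (H / M.minGap H)) * δ := by
    have : 0 ≤ Real.logb 2 (H / M.minGap H) :=
      Real.logb_nonneg (by norm_num) ((one_le_div hgap).2 (MDP.minGap_le hopt hgap))
    exact le_mul_of_one_le_left hδ0.le (by linarith)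
  -- The logarithm is bounded away from zero only if its argument is at least `2`. Otherwise `KH <
  -- 2`, and the trivial bound `H ≤ 2 / K` suffices; this is what the last term of the bound is for.
  by_cases hL2 : 2 ≤ d * K * H / δ
  · obtain ⟨B, hB, hBω⟩ := exists_sum_gap_le hD hlin hbdd hH hK hd hδ0 hδ1 hL2 hsupp hopt hoptsupp
      hκ0 hκ hκtot hgap hπhat
    refine (measure_mono fun ω hω => ?_).trans (hB.trans (ENNReal.ofReal_le_ofReal hprob))
    by_contra hωB
    obtain ⟨hsup, hgaps⟩ := hBω ω hωB
    have h2K : (0 : ℝ) ≤ 2 / K := by positivity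
    refine hω ⟨?_, ?_⟩
    · rw [MDP.subOpt_mixture_eq hopt]
      -- All members are evaluated at the states visited by the averaged policy, which is itself
      -- supported.
      exact (hgaps (fun _ => Policy.mixture hK fun k : Fin K => (πhat k).run (hist H D k ω))
        fun _ h hh => MDP.Supported.mixture hK fun k => hsup k k.2 h hh).trans (by linarith)
    · simp only [M.subOpt_eq_sum_gap hopt]
      exact (hgaps (fun k => (πhat k).run (hist H D k ω)) fun k h hh => hsup k k.2 h hh).trans
        (by linarith)
  · have hlt : (d * K * H : ℝ) < 2 := by
      refine lt_of_le_of_lt ?_ (not_le.1 hL2)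
      exact (le_div_iff₀ hδ0).2 (mul_le_of_le_one_right (by linarith) hδ1)
    have hHK : (K * H : ℝ) < 2 := by
      refine lt_of_le_of_lt ?_ hlt
      rw [mul_assoc]
      exact le_mul_of_one_le_left (by positivity) hd'
    have hb : (H : ℝ) ≤ bound := by
      refine le_trans ?_ hle1
      have : (H : ℝ) ≤ 2 / K := by
        rw [le_div_iff₀ hK0]
        linarith
      linarith
    refine (measure_mono_null (fun ω hω => ?_) measure_empty).le.trans zero_le
    refine (hω ⟨(MDP.subOpt_le hopt _).trans hb, ?_⟩).elim
    refine le_trans ?_ hb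
    rw [div_le_iff₀ hK0]
    calc ∑ k : Fin K, M.subOpt H ((πhat k).run (hist H D k ω)) ≤ ∑ _k : Fin K, (H : ℝ) :=
          Finset.sum_le_sum fun k _ => MDP.subOpt_le hopt _
      _ = H * K := by simp [mul_comm]
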